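/- Let $\tau\in\mathbb C$ with $\operatorname{Im}\tau>0$, $\Lambda=\mathbb Z+\mathbb Z\tau$, $E=\mathbb C/\Lambda$ with coordinate $x$, and $X=E\setminus\{0\}$, which is the affine curve $v^2=P(u)=4u^3-60G_4(\tau)u-140G_6(\tau)$ via $u=\wp(x)$, $v=\wp'(x)$. For $n\ge 0$ let $\Gamma_n$ be the coordinate ring (ring of regular functions) of the variety $F(X,n)=\{(x_1,\dots,x_n)\in X^n\mid x_i\neq x_j \text{ for } i\neq j\}$, and let $\Omega_{\mathrm{dR}}(\Gamma_n)=\bigwedge^\bullet_{\Gamma_n}\Omega_{\Gamma_n/\mathbb C}$ be its algebraic de Rham complex, a commutative dg-algebra. Let $\Xi_n$ be the commutative dg-algebra over $\mathbb C$ with generators $\omega_i,\nu_i$ ($1\le i\le n$) and $\omega_{ij}^{(m)}$ ($1\le i,j\le n$, $m\ge0$), all of degree $1$, and relations $$\omega_{ij}^{(m)}+(-1)^m\omega_{ji}^{(m)}=0,\qquad \omega_{ij}^{(0)}=\omega_i-\omega_j,$$ together with all the quadratic relations given, for all $i,j,\ell$, by the coefficients in powers of $\alpha,\beta$ (after multiplication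 by $\alpha\beta(\alpha+\beta)$, which removes negative powers) of $$\Omega_{i\ell}(\alpha)\wedge\Omega_{j\ell}(\beta)+\Omega_{ji}(\beta)\wedge\Omega_{i\ell}(\alpha+\beta)+\Omega_{j\ell}(\alpha+\beta)\wedge\Omega_{ij}(\alpha)=0,\qquad \Omega_{ij}(\alpha)=\sum_{m\ge0}\omega_{ij}^{(m)}\alpha^{m-1},$$ and with differential $d\omega_i=d\nu_i=0$, $d\omega_{ij}^{(m+1)}=(\nu_i-\nu_j)\wedge\omega_{ij}^{(m)}$ for $m\ge0$. Let $\mathcal E_1(x)=\zeta(x)$ be the Weierstrass zeta function normalised by $\zeta(x)=x^{-1}-\sum_{k\ge0}G_{2k+2}(\tau)x^{2k+1}$ near $0$, and for $m\ge2$ let $$\mathcal E_m(x)=\frac1{x^m}+\sum_{\lambda\in\Lambda\setminus0}\Big(\frac1{(x+\lambda)^m}-\frac1{\lambda^m}\Big)$$ (so $\mathcal E_2=\wp$). Let $dx_i\in\Omega_{\Gamma_n/\mathbb C}$ be the pullback along the $i$-th projection of the global section $dx=du/v$ of $\Omega_E$, i.e. the unique form with $d\wp(x_i)=\wp'(x_i)\,dx_i$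 and $d\wp'(x_i)=\tfrac12P'(\wp(x_i))\,dx_i$. For $i\ne j$ put $$\widetilde\Omega_{ij}(\alpha)=\alpha^{-1}\exp\big[\alpha\big(\mathcal E_1(x_i-x_j)-\mathcal E_1(x_i)+\mathcal E_1(x_j)\big)\big]\exp\Big[-\sum_{m\ge2}\frac{(-\alpha)^m}{m}\mathcal E_m(x_i-x_j)\Big](dx_i-dx_j)=\sum_{m\ge0}\widetilde\omega_{ij}^{(m)}\alpha^{m-1},$$ and put $\widetilde\omega_{ii}^{(m)}=0$. Then the coefficients of $dx_i-dx_j$ in the $\widetilde\omega_{ij}^{(m)}$ ($i\neq j$) are regular functions on $F(X,n)$, so that $\widetilde\omega_{ij}^{(m)}\in\Omega_{\Gamma_n/\mathbb C}$, and the assignments $$\varphi(\nu_i)=\wp(x_i)\,dx_i,\qquad \varphi(\omega_i)=dx_i,\qquad \varphi(\omega_{ij}^{(m)})=\widetilde\omega_{ij}^{(m)}$$ extend (uniquely) to a morphism of dg-algebras $\varphi:\Xi_n\to\Omega_{\mathrm{dR}}(\Gamma_n)$. -/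

import Mathlib

namespace EllConf

open KaehlerDifferential

/-- A commutative differential graded algebra. -/
structure IsCommDGAlgebra {k A : Type*} [CommRing k] [Ring A] [Algebra k A]
    (𝒜 : ℕ → Submodule k A) [GradedAlgebra 𝒜] (d : A →ₗ[k] A) : Prop where
  d_mem : ∀ (p : ℕ) (a : A), a ∈ 𝒜 p → d a ∈ 𝒜 (p + 1)
  d_d : ∀ a : A, d (d a) = 0
  leibniz : ∀ (p : ℕ) (a b : A), a ∈ 𝒜 p → d (a * b) = d a * b + (-1) ^ p * (a * d b)
  comm : ∀ (p q : ℕ) (a b : A), a ∈ 𝒜 p → b ∈ 𝒜 q → a * b = (-1) ^ (p * q) * (b * a)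

/-- Morphisms of dg-algebras. -/
structure IsDGAlgebraHom {k A B : Type*} [CommRing k] [Ring A] [Algebra k A] [Ring B] [Algebra k B]
    (𝒜 : ℕ → Submodule k A) (dA : A →ₗ[k] A) (ℬ : ℕ → Submodule k B) (dB : B →ₗ[k] B)
    (φ : A →ₐ[k] B) : Prop where
  map_mem : ∀ (p : ℕ) (a : A), a ∈ 𝒜 p → φ a ∈ ℬ p
  map_d : ∀ a : A, φ (dA a) = dB (φ a)

theorem comm_of_pow {R A : Type*} [CommRing R] [Ring A] [Algebra R A] (V : Submodule R A)
    (h : ∀ v ∈ V, ∀ w ∈ V, v * w = -(w * v)) (p q : ℕ) (a b : A)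
    (ha : a ∈ V ^ p) (hb : b ∈ V ^ q) : a * b = (-1) ^ (p * q) * (b * a) := by
  have h1 : ∀ v ∈ V, v * b = (-1) ^ q * (b * v) := by
    intro v hv
    induction hb using Submodule.pow_induction_on_left' with
    | algebraMap r => simp [Algebra.commutes]
    | add x y i hx hy ihx ihy => rw [mul_add, ihx, ihy, add_mul, mul_add]
    | mem_mul m hm i x hx ih =>
      rw [← mul_assoc, h v hv m hm, neg_mul, mul_assoc, ih, pow_succ]
      rw [← mul_assoc m, ((Commute.neg_one_right m).pow_right i).eq]
      simp [mul_assoc]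
  induction ha using Submodule.pow_induction_on_left' with
  | algebraMap r => simp [Algebra.commutes]
  | add x y i hx hy ihx ihy => rw [mul_add, ← mul_add, add_mul, ihx, ihy]; noncomm_ring
  | mem_mul m hm i x hx ih =>
    rw [mul_assoc, ih, ← mul_assoc m, ((Commute.neg_one_right m).pow_right _).eq, mul_assoc,
      ← mul_assoc m, h1 m hm, Nat.succ_mul, pow_add]
    simp [mul_assoc]

section DeRham

variable (k R : Type*) [CommRing k] [CommRing R] [Algebra k R]

/-- The algebra of algebraic differential forms. -/
abbrev DeRham : Type _ := ExteriorAlgebra R (Ω[R⁄k])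

variable {k R} in
/-- A 1-form, considered as an element of the algebra of differential forms. -/
noncomputable abbrev DeRham.form (η : Ω[R⁄k]) : DeRham k R := ExteriorAlgebra.ι R η

/-- The grading by the degree of forms. -/
noncomputable abbrev DeRham.deg (p : ℕ) : Submodule k (DeRham k R) :=
  (⋀[R]^p (Ω[R⁄k])).restrictScalars k

variable {k R} in
/-- The automorphism `a ↦ (-1) ^ deg a * a`. -/
noncomputable abbrev DeRham.inv : DeRham k R →ₐ[R] DeRham k R := CliffordAlgebra.involute

variable {k R}

theorem DeRham.inv_form (η : Ω[R⁄k]) : DeRham.inv (DeRham.form η) = -DeRham.form η :=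
  CliffordAlgebra.involute_ι η

theorem DeRham.form_mul_form (x y : Ω[R⁄k]) : form x * form y = -(form y * form x) :=
  eq_neg_of_add_eq_zero_left (ExteriorAlgebra.ι_add_mul_swap x y)

theorem DeRham.form_mul (η : Ω[R⁄k]) (a : DeRham k R) : form η * a = inv a * form η := by
  induction a using ExteriorAlgebra.induction with
  | algebraMap r => rw [AlgHom.commutes, Algebra.commutes]
  | ι x => rw [inv_form, form_mul_form, neg_mul]
  | mul a b ha hb => rw [map_mul, ← mul_assoc, ha, mul_assoc, hb, mul_assoc]
  | add a b ha hb => rw [map_add, add_mul, mul_add, ha, hb]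

variable (k R) in
/-- An auxiliary ring of matrices `!![inv a, b; 0, a]`. -/
noncomputable def DeRham.twSubring : Subring (Matrix (Fin 2) (Fin 2) (DeRham k R)) where
  carrier := {M | M 1 0 = 0 ∧ M 0 0 = inv (M 1 1)}
  mul_mem' := by
    rintro M N ⟨h1, h2⟩ ⟨h3, h4⟩
    simp [Matrix.mul_apply, Fin.sum_univ_two, h1, h2, h3, h4]
  one_mem' := by simp
  add_mem' := by
    rintro M N ⟨h1, h2⟩ ⟨h3, h4⟩
    simp [h1, h2, h3, h4]
  zero_mem' := by simp
  neg_mem' := by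
    rintro M ⟨h1, h2⟩
    simp [h1, h2]

variable (k R) in
abbrev DeRham.Tw : Type _ := twSubring k R

theorem DeRham.Tw.ext {x y : Tw k R} (h : x.1 0 1 = y.1 0 1) (h' : x.1 1 1 = y.1 1 1) : x = y := by
  apply Subtype.ext
  ext i j
  fin_cases i <;> fin_cases j
  · exact x.2.2.trans ((congrArg inv h').trans y.2.2.symm)
  · exact h
  · exact x.2.1.trans y.2.1.symm
  · exact h'

/-- The matrix with entries `inv a`, `b`, `0`, `a`. -/
noncomputable def DeRham.Tw.mk (a b : DeRham k R) : Tw k R :=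
  ⟨!![inv a, b; 0, a], by simp [twSubring]⟩

@[simp] theorem DeRham.Tw.mk_01 (a b : DeRham k R) : (Tw.mk a b).1 0 1 = b := by simp [Tw.mk]
@[simp] theorem DeRham.Tw.mk_11 (a b : DeRham k R) : (Tw.mk a b).1 1 1 = a := by simp [Tw.mk]

theorem DeRham.Tw.mul_01 (x y : Tw k R) :
    (x * y).1 0 1 = x.1 0 1 * y.1 1 1 + inv (x.1 1 1) * y.1 0 1 := by
  rw [← x.2.2, add_comm]
  exact (Matrix.mul_apply ..).trans (Fin.sum_univ_two _)

theorem DeRham.Tw.mul_11 (x y : Tw k R) : (x * y).1 1 1 = x.1 1 1 * y.1 1 1 := by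
  have h : (x * y).1 1 1 = x.1 1 0 * y.1 0 1 + x.1 1 1 * y.1 1 1 :=
    (Matrix.mul_apply ..).trans (Fin.sum_univ_two _)
  rw [h, x.2.1, zero_mul, zero_add]

variable (k R) in
noncomputable def DeRham.Tw.scalar : R →+* Tw k R where
  toFun r := Tw.mk (algebraMap R _ r) (form (D k R r))
  map_one' := by
    apply Tw.ext <;> simp
  map_zero' := by
    apply Tw.ext <;> simp
  map_add' x y := by
    apply Tw.ext <;> simp
  map_mul' x y := by
    apply Tw.ext
    · rw [Tw.mul_01]
      simp only [mk_01, mk_11, Derivation.leibniz, AlgHom.commutes, form, map_add, map_smul,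
        Algebra.smul_def]
      rw [add_comm, Algebra.commutes y]
    · rw [Tw.mul_11]; simp

noncomputable instance : Algebra R (DeRham.Tw k R) :=
  (DeRham.Tw.scalar k R).toAlgebra' (by
    intro c x
    apply DeRham.Tw.ext
    · rw [DeRham.Tw.mul_01, DeRham.Tw.mul_01]
      simp [DeRham.Tw.scalar, DeRham.form_mul, Algebra.commutes, add_comm]
    · rw [DeRham.Tw.mul_11, DeRham.Tw.mul_11]
      simp [DeRham.Tw.scalar, Algebra.commutes])

theorem DeRham.Tw.smul_01 (r : R) (x : Tw k R) :
    (r • x).1 0 1 = form (D k R r) * x.1 1 1 + r • x.1 0 1 := by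
  rw [Algebra.smul_def, Tw.mul_01]
  change (Tw.mk _ _).1 0 1 * _ + inv ((Tw.mk _ _).1 1 1) * _ = _
  rw [Tw.mk_01, Tw.mk_11, AlgHom.commutes, Algebra.smul_def]

theorem DeRham.Tw.smul_11 (r : R) (x : Tw k R) : (r • x).1 1 1 = r • x.1 1 1 := by
  rw [Algebra.smul_def, Tw.mul_11]
  change (Tw.mk _ _).1 1 1 * _ = _
  rw [Tw.mk_11, Algebra.smul_def]

noncomputable instance : Algebra k (DeRham.Tw k R) := Algebra.compHom _ (algebraMap k R)

instance : IsScalarTower k R (DeRham.Tw k R) := IsScalarTower.of_algebraMap_eq fun _ => rfl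

variable (k R) in
/-- The `k`-derivation `r ↦ !![-dr, 0; 0, dr]`. -/
noncomputable def DeRham.Tw.der : Derivation k R (Tw k R) where
  toFun r := Tw.mk (form (D k R r)) 0
  map_add' x y := by apply Tw.ext <;> simp
  map_smul' c x := by
    rw [RingHom.id_apply, ← algebraMap_smul R c (Tw.mk _ _)]
    apply Tw.ext
    · rw [Tw.smul_01]; simp
    · rw [Tw.smul_11]; simp
  map_one_eq_zero' := by
    apply Tw.ext <;> simp
  leibniz' x y := by
    apply Tw.ext
    · have h : ∀ u v : Tw k R, (u + v).1 0 1 = u.1 0 1 + v.1 0 1 := fun _ _ => rfl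
      rw [LinearMap.coe_mk, AddHom.coe_mk, h, Tw.smul_01, Tw.smul_01]
      simp [form_mul_form (D k R x)]
    · have h : ∀ u v : Tw k R, (u + v).1 1 1 = u.1 1 1 + v.1 1 1 := fun _ _ => rfl
      rw [LinearMap.coe_mk, AddHom.coe_mk, h, Tw.smul_11, Tw.smul_11]
      simp

/-- The `R`-linear map `η ↦ !![-η, dη; 0, η]`. -/
noncomputable def DeRham.Tw.lin : Ω[R⁄k] →ₗ[R] Tw k R := (der k R).liftKaehlerDifferential

theorem DeRham.Tw.lin_D (r : R) : lin (D k R r) = Tw.mk (form (D k R r)) 0 :=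
  (der k R).liftKaehlerDifferential_comp_D r

theorem DeRham.Tw.lin_11 (η : Ω[R⁄k]) : (lin η).1 1 1 = form η := by
  have h : η ∈ Submodule.span R (Set.range (D k R)) := by
    rw [KaehlerDifferential.span_range_derivation]; trivial
  induction h using Submodule.span_induction with
  | mem x hx => obtain ⟨r, rfl⟩ := hx; rw [lin_D, mk_11]
  | zero => rw [map_zero, form, map_zero]; rfl
  | add x y _ _ hx hy => rw [map_add, form, map_add, ← form, ← form, ← hx, ← hy]; rfl
  | smul r x _ hx => rw [map_smul, smul_11, hx, form, form, map_smul]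

theorem DeRham.Tw.lin_01_mem (η : Ω[R⁄k]) : (lin η).1 0 1 ∈ ⋀[R]^2 (Ω[R⁄k]) := by
  have h : η ∈ Submodule.span R (Set.range (D k R)) := by
    rw [KaehlerDifferential.span_range_derivation]; trivial
  induction h using Submodule.span_induction with
  | mem x hx => obtain ⟨r, rfl⟩ := hx; rw [lin_D, mk_01]; exact zero_mem _
  | zero => rw [map_zero]; exact zero_mem _
  | add x y _ _ hx hy => rw [map_add]; exact add_mem hx hy
  | smul r x _ hx =>
    rw [map_smul, smul_01, lin_11]
    refine add_mem ?_ (Submodule.smul_mem _ _ hx)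
    rw [ExteriorAlgebra.exteriorPower, pow_two]
    exact Submodule.mul_mem_mul ⟨_, rfl⟩ ⟨_, rfl⟩

theorem DeRham.comm (p q : ℕ) (a b : DeRham k R) (ha : a ∈ ⋀[R]^p (Ω[R⁄k]))
    (hb : b ∈ ⋀[R]^q (Ω[R⁄k])) : a * b = (-1) ^ (p * q) * (b * a) := by
  refine comm_of_pow _ ?_ p q a b ha hb
  rintro _ ⟨x, rfl⟩ _ ⟨y, rfl⟩
  exact form_mul_form x y

theorem DeRham.form_mem (η : Ω[R⁄k]) : form η ∈ ⋀[R]^1 (Ω[R⁄k]) := by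
  rw [ExteriorAlgebra.exteriorPower, pow_one]; exact ⟨η, rfl⟩

variable (k R) in
/-- The algebra homomorphism `a ↦ !![inv a, da; 0, a]`. -/
noncomputable def DeRham.Tw.hom : DeRham k R →ₐ[R] Tw k R :=
  ExteriorAlgebra.lift R ⟨lin, fun η => by
    apply Tw.ext
    · rw [Tw.mul_01, lin_11, inv_form, DeRham.comm 2 1 _ _ (lin_01_mem η) (form_mem η)]
      simp
    · rw [Tw.mul_11, lin_11, ExteriorAlgebra.ι_sq_zero]; rfl⟩

theorem DeRham.Tw.hom_form (η : Ω[R⁄k]) : hom k R (form η) = lin η :=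
  ExteriorAlgebra.lift_ι_apply ..

theorem DeRham.Tw.hom_algebraMap (r : R) :
    hom k R (algebraMap R _ r) = Tw.mk (algebraMap R _ r) (form (D k R r)) :=
  AlgHom.commutes _ r

theorem DeRham.Tw.hom_11 (a : DeRham k R) : (hom k R a).1 1 1 = a := by
  induction a using ExteriorAlgebra.induction with
  | algebraMap r => rw [hom_algebraMap, mk_11]
  | ι x => exact (congrArg (fun y : Tw k R => y.1 1 1) (hom_form x)).trans (lin_11 x)
  | mul a b ha hb => rw [map_mul, mul_11, ha, hb]
  | add a b ha hb => rw [map_add]; exact congrArg₂ (· + ·) ha hb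

variable (k R) in
/-- The de Rham differential: the unique `k`-linear map with `d r = D r` for `r : R`, `d (D r) = 0`
and `d (a b) = da b + (-1) ^ deg a * a db` (see `d_algebraMap`, `d_form_D`, `d_mul` below). -/
noncomputable def DeRham.d : DeRham k R →ₗ[k] DeRham k R where
  toFun a := (Tw.hom k R a).1 0 1
  map_add' a b := by rw [map_add]; rfl
  map_smul' c a := by
    rw [RingHom.id_apply, ← algebraMap_smul R c a, map_smul, Tw.smul_01]
    simp

theorem DeRham.d_algebraMap (r : R) : d k R (algebraMap R _ r) = form (D k R r) := by
  change (Tw.hom k R _).1 0 1 = _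
  rw [Tw.hom_algebraMap, Tw.mk_01]

theorem DeRham.d_form_D (r : R) : d k R (form (D k R r)) = 0 := by
  change (Tw.hom k R _).1 0 1 = _
  rw [Tw.hom_form, Tw.lin_D, Tw.mk_01]

theorem DeRham.d_mul (a b : DeRham k R) : d k R (a * b) = d k R a * b + inv a * d k R b := by
  change (Tw.hom k R _).1 0 1 = (Tw.hom k R _).1 0 1 * _ + _ * (Tw.hom k R _).1 0 1
  rw [map_mul, Tw.mul_01, Tw.hom_11, Tw.hom_11]

theorem DeRham.inv_of_mem (p : ℕ) (a : DeRham k R) (ha : a ∈ ⋀[R]^p (Ω[R⁄k])) :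
    inv a = (-1) ^ p * a := by
  induction ha using Submodule.pow_induction_on_left' with
  | algebraMap r => simp
  | add x y i hx hy ihx ihy => rw [map_add, ihx, ihy, mul_add]
  | mem_mul m hm i x hx ih =>
    obtain ⟨η, rfl⟩ := hm
    rw [map_mul, ih, inv_form, pow_succ]
    rw [← mul_assoc, neg_mul, ((Commute.neg_one_right (form η)).pow_right i).eq]
    simp [mul_assoc]

theorem DeRham.d_mem (p : ℕ) (a : DeRham k R) (ha : a ∈ ⋀[R]^p (Ω[R⁄k])) :
    d k R a ∈ ⋀[R]^(p + 1) (Ω[R⁄k]) := by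
  induction ha using Submodule.pow_induction_on_left' with
  | algebraMap r => rw [d_algebraMap]; exact form_mem _
  | add x y i hx hy ihx ihy => rw [map_add]; exact add_mem ihx ihy
  | mem_mul m hm i x hx ih =>
    obtain ⟨η, rfl⟩ := hm
    rw [d_mul, inv_form]
    refine add_mem ?_ ?_
    · have h : d k R (form η) ∈ ⋀[R]^2 (Ω[R⁄k]) := by
        change (Tw.hom k R _).1 0 1 ∈ _
        rw [Tw.hom_form]; exact Tw.lin_01_mem η
      have := Submodule.mul_mem_mul h hx
      rw [ExteriorAlgebra.exteriorPower, ← pow_add] at this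
      rwa [ExteriorAlgebra.exteriorPower, show i + 1 + 1 = 2 + i by ring]
    · rw [neg_mul]
      refine neg_mem ?_
      have := Submodule.mul_mem_mul (form_mem η) ih
      rw [ExteriorAlgebra.exteriorPower, ExteriorAlgebra.exteriorPower, ← pow_add] at this
      rwa [ExteriorAlgebra.exteriorPower, show i + 1 + 1 = 1 + (i + 1) by ring]

theorem DeRham.d_d (a : DeRham k R) : d k R (d k R a) = 0 := by
  have key : ∀ a b : DeRham k R, inv (d k R a) = -d k R (inv a) → d k R (d k R a) = 0 →
      d k R (d k R b) = 0 → d k R (d k R (a * b)) = 0 := by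
    intro a b h1 h2 h3
    rw [d_mul, map_add, d_mul, d_mul, h1, h2, h3]
    simp
  have hf : ∀ η : Ω[R⁄k], d k R (d k R (form η)) = 0 := by
    intro η
    have h : η ∈ Submodule.span R (Set.range (D k R)) := by
      rw [KaehlerDifferential.span_range_derivation]; trivial
    induction h using Submodule.span_induction with
    | mem x hx => obtain ⟨r, rfl⟩ := hx; rw [d_form_D, map_zero]
    | zero => simp [form]
    | add x y _ _ hx hy => rw [form, map_add, map_add, map_add, ← form, ← form, hx, hy, add_zero]
    | smul r x _ hx =>
      rw [form, map_smul, Algebra.smul_def]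
      refine key _ _ ?_ ?_ hx
      · rw [d_algebraMap, inv_form, AlgHom.commutes, d_algebraMap]
      · rw [d_algebraMap, d_form_D]
  have : inv (d k R a) = -d k R (inv a) ∧ d k R (d k R a) = 0 := by
    induction a using ExteriorAlgebra.induction with
    | algebraMap r =>
      refine ⟨?_, ?_⟩
      · rw [d_algebraMap, inv_form, AlgHom.commutes, d_algebraMap]
      · rw [d_algebraMap, d_form_D]
    | ι x =>
      refine ⟨?_, hf x⟩
      have := inv_of_mem 2 _ (d_mem 1 _ (form_mem x))
      rw [this]
      simp
    | mul a b ha hb =>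
      refine ⟨?_, key a b ha.1 ha.2 hb.2⟩
      rw [d_mul, map_mul, d_mul, map_add, map_mul, map_mul, ha.1, hb.1, neg_mul, mul_neg, neg_add]
    | add a b ha hb =>
      refine ⟨?_, ?_⟩
      · rw [map_add, map_add, ha.1, hb.1, map_add, map_add, neg_add]
      · rw [map_add, map_add, ha.2, hb.2, add_zero]
  exact this.2

variable (k R) in
theorem DeRham.isCommDGAlgebra : IsCommDGAlgebra (DeRham.deg k R) (DeRham.d k R) where
  d_mem := d_mem
  d_d := d_d
  leibniz p a b ha := by rw [d_mul, inv_of_mem p a ha, mul_assoc]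
  comm := DeRham.comm

end DeRham


section Xi

/-- The generators `ν_i`, `ω_i`, `ω_ij^(m)`. -/
inductive XiGen (n : ℕ) : Type
  | nu (i : Fin n) : XiGen n
  | om (i : Fin n) : XiGen n
  | kr (i j : Fin n) (m : ℕ) : XiGen n

/-- The free associative algebra on the generators. -/
abbrev XiFree (n : ℕ) : Type := FreeAlgebra ℂ (XiGen n)

namespace XiFree

variable {n : ℕ}

/-- A generator. -/
noncomputable abbrev gen (x : XiGen n) : XiFree n := FreeAlgebra.ι ℂ x

/-- `A(α)` for `A(t) = ∑ a m t^m`, as a formal power series in two (commuting) variables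
`α = X 0` and `β = X 1`, which commute with the coefficients. -/
def inAlpha {A : Type*} [Ring A] (a : ℕ → A) : MvPowerSeries (Fin 2) A :=
  fun e => if e 1 = 0 then a (e 0) else 0

/-- `A(β)`. -/
def inBeta {A : Type*} [Ring A] (a : ℕ → A) : MvPowerSeries (Fin 2) A :=
  fun e => if e 0 = 0 then a (e 1) else 0

/-- `A(α + β)`: the coefficient of `α^p β^q` is `(p + q).choose p • a (p + q)`. -/
def inSum {A : Type*} [Ring A] (a : ℕ → A) : MvPowerSeries (Fin 2) A :=
  fun e => (e 0 + e 1).choose (e 0) • a (e 0 + e 1)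

/-- For `Ω_ij(t) = ∑ ω i j m t^(m-1)`, the product of `αβ(α + β)` with
`Ω_il(α) Ω_jl(β) + Ω_ji(β) Ω_il(α + β) + Ω_jl(α + β) Ω_ij(α)`. The factor `αβ(α + β)` removes the
negative powers, and it does not change the span of the coefficients (of an expansion in
`ℂ((α))((β))`). -/
noncomputable def fay {A : Type*} [Ring A] (ω : Fin n → Fin n → ℕ → A) (i j l : Fin n) :
    MvPowerSeries (Fin 2) A :=
  (MvPowerSeries.X 0 + MvPowerSeries.X 1) * (inAlpha (ω i l) * inBeta (ω j l)) +
    MvPowerSeries.X 0 * (inBeta (ω j i) * inSum (ω i l)) +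
    MvPowerSeries.X 1 * (inSum (ω j l) * inAlpha (ω i j))

end XiFree

open XiFree in
/-- The relations: graded commutativity of the generators (of degree one), and the three
families of relations between the generators. -/
inductive XiRel (n : ℕ) : XiFree n → XiFree n → Prop
  | anticomm (x y : XiGen n) : XiRel n (gen x * gen y) (-(gen y * gen x))
  | antisymm (i j : Fin n) (m : ℕ) :
      XiRel n (gen (.kr i j m) + (-1) ^ m * gen (.kr j i m)) 0
  | zero (i j : Fin n) : XiRel n (gen (.kr i j 0)) (gen (.om i) - gen (.om j))
  | fay (i j l : Fin n) (e : Fin 2 →₀ ℕ) :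
      XiRel n (MvPowerSeries.coeff e (fay (fun i j m => gen (.kr i j m)) i j l)) 0

/-- The graded commutative algebra `Ξ_n`. -/
def Xi (n : ℕ) : Type := RingQuot (XiRel n)

noncomputable instance (n : ℕ) : Ring (Xi n) := inferInstanceAs (Ring (RingQuot (XiRel n)))

noncomputable instance (n : ℕ) : Algebra ℂ (Xi n) :=
  inferInstanceAs (Algebra ℂ (RingQuot (XiRel n)))

namespace Xi

variable {n : ℕ}

/-- The quotient map. -/
noncomputable def mk (n : ℕ) : XiFree n →ₐ[ℂ] Xi n := RingQuot.mkAlgHom ℂ (XiRel n)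

theorem mk_rel {n : ℕ} {a b : XiFree n} (h : XiRel n a b) : mk n a = mk n b :=
  RingQuot.mkAlgHom_rel ℂ h

theorem mk_surjective (n : ℕ) : Function.Surjective (mk n) :=
  RingQuot.mkAlgHom_surjective ℂ (XiRel n)

/-- The universal property of the quotient. -/
noncomputable def lift {n : ℕ} {B : Type*} [Semiring B] [Algebra ℂ B] (f : XiFree n →ₐ[ℂ] B)
    (hf : ∀ a b, XiRel n a b → f a = f b) : Xi n →ₐ[ℂ] B :=
  RingQuot.liftAlgHom ℂ ⟨f, hf⟩

theorem lift_mk {n : ℕ} {B : Type*} [Semiring B] [Algebra ℂ B] (f : XiFree n →ₐ[ℂ] B)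
    (hf : ∀ a b, XiRel n a b → f a = f b) (a : XiFree n) : lift f hf (mk n a) = f a :=
  RingQuot.liftAlgHom_mkAlgHom_apply ..

/-- A generator. -/
noncomputable def gen (x : XiGen n) : Xi n := mk n (XiFree.gen x)

/-- The generator `ν_i`. -/
noncomputable abbrev nu (i : Fin n) : Xi n := gen (.nu i)
/-- The generator `ω_i`. -/
noncomputable abbrev om (i : Fin n) : Xi n := gen (.om i)
/-- The generator `ω_ij^(m)`. -/
noncomputable abbrev kr (i j : Fin n) (m : ℕ) : Xi n := gen (.kr i j m)

theorem anticomm (x y : XiGen n) : gen x * gen y = -(gen y * gen x) := by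
  have := mk_rel (XiRel.anticomm x y)
  rwa [map_mul, map_neg, map_mul] at this

theorem antisymm (i j : Fin n) (m : ℕ) : kr i j m + (-1) ^ m * kr j i m = 0 := by
  have := mk_rel (XiRel.antisymm i j m)
  rwa [map_add, map_mul, map_pow, map_neg, map_one, map_zero] at this

theorem kr_zero (i j : Fin n) : kr i j 0 = om i - om j := by
  have := mk_rel (XiRel.zero i j)
  rwa [map_sub] at this

open XiFree in
theorem map_fay {A B : Type*} [Ring A] [Ring B] (f : A →+* B) (ω : Fin n → Fin n → ℕ → A)
    (i j l : Fin n) :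
    MvPowerSeries.map f (fay ω i j l) = fay (fun i j m => f (ω i j m)) i j l := by
  have h1 : ∀ a : ℕ → A, MvPowerSeries.map f (inAlpha a) = inAlpha (fun m => f (a m)) := by
    intro a; funext e
    change f (ite _ _ _) = ite _ _ _
    split_ifs <;> simp
  have h2 : ∀ a : ℕ → A, MvPowerSeries.map f (inBeta a) = inBeta (fun m => f (a m)) := by
    intro a; funext e
    change f (ite _ _ _) = ite _ _ _
    split_ifs <;> simp
  have h3 : ∀ a : ℕ → A, MvPowerSeries.map f (inSum a) = inSum (fun m => f (a m)) := by
    intro a; funext e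
    exact map_nsmul f _ _
  simp only [fay, map_add, map_mul, h1, h2, h3, MvPowerSeries.map_X]

theorem fay_eq_zero (i j l : Fin n) : XiFree.fay (kr (n := n)) i j l = 0 := by
  have : MvPowerSeries.map (mk n : XiFree n →+* Xi n)
      (XiFree.fay (fun i j m => XiFree.gen (.kr i j m)) i j l) = 0 := by
    ext e
    rw [MvPowerSeries.coeff_map]
    have := mk_rel (XiRel.fay i j l e)
    rwa [map_zero] at this
  rwa [map_fay] at this

/-- The automorphism of the free algebra that changes the sign of all generators. -/
noncomputable def freeInv : XiFree n →ₐ[ℂ] XiFree n :=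
  FreeAlgebra.lift ℂ fun x => -XiFree.gen x

theorem freeInv_gen (x : XiGen n) : freeInv (XiFree.gen x) = -XiFree.gen x :=
  FreeAlgebra.lift_ι_apply _ _

/-- The differential on the generators: `dν_i = dω_i = 0`, `dω_ij^(0) = 0` (as forced by
`ω_ij^(0) = ω_i - ω_j`), and `dω_ij^(m+1) = (ν_i - ν_j) ω_ij^(m)`. -/
noncomputable def dGen : XiGen n → Xi n
  | .nu _ => 0
  | .om _ => 0
  | .kr _ _ 0 => 0
  | .kr i j (m + 1) => (nu i - nu j) * kr i j m

/-- The algebra homomorphism with `x ↦ !![-x, dx; 0, x]` for the generators `x`. -/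
noncomputable def freeTw : XiFree n →ₐ[ℂ] Matrix (Fin 2) (Fin 2) (Xi n) :=
  FreeAlgebra.lift ℂ fun x => !![-gen x, dGen x; 0, gen x]

theorem freeTw_gen (x : XiGen n) : freeTw (XiFree.gen x) = !![-gen x, dGen x; 0, gen x] :=
  FreeAlgebra.lift_ι_apply _ _

theorem freeTw_apply (a : XiFree n) :
    freeTw a 1 0 = 0 ∧ freeTw a 1 1 = mk n a ∧ freeTw a 0 0 = mk n (freeInv a) := by
  induction a using FreeAlgebra.induction with
  | grade0 r => simp [AlgHom.commutes, Matrix.algebraMap_matrix_apply]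
  | grade1 x =>
    have h1 : freeTw (FreeAlgebra.ι ℂ x) = _ := freeTw_gen x
    have h2 : freeInv (FreeAlgebra.ι ℂ x) = _ := freeInv_gen x
    rw [h1, h2]
    simp [gen]
  | mul a b ha hb =>
    simp [Matrix.mul_apply, Fin.sum_univ_two, ha.1, ha.2, hb.1, hb.2]
  | add a b ha hb => simp [ha.1, ha.2, hb.1, hb.2]

theorem freeTw_mul (a b : XiFree n) :
    freeTw (a * b) 0 1 = freeTw a 0 1 * mk n b + mk n (freeInv a) * freeTw b 0 1 := by
  rw [map_mul, Matrix.mul_apply, Fin.sum_univ_two, (freeTw_apply a).2.2, (freeTw_apply b).2.1,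
    add_comm]

/-- Coefficientwise application of `freeTw a 0 1` to a power series. -/
noncomputable def dSer (F : MvPowerSeries (Fin 2) (XiFree n)) : MvPowerSeries (Fin 2) (Xi n) :=
  fun e => freeTw (MvPowerSeries.coeff e F) 0 1

theorem dSer_add (F G : MvPowerSeries (Fin 2) (XiFree n)) : dSer (F + G) = dSer F + dSer G := by
  funext e
  change freeTw _ 0 1 = freeTw _ 0 1 + freeTw _ 0 1
  rw [map_add, map_add]; rfl

theorem dSer_mul (F G : MvPowerSeries (Fin 2) (XiFree n)) :
    dSer (F * G) = dSer F * MvPowerSeries.map (mk n : XiFree n →+* Xi n) G +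
      MvPowerSeries.map (mk n : XiFree n →+* Xi n)
        (MvPowerSeries.map (freeInv (n := n) : XiFree n →+* XiFree n) F) * dSer G := by
  ext e
  rw [map_add, MvPowerSeries.coeff_mul, MvPowerSeries.coeff_mul, ← Finset.sum_add_distrib]
  change freeTw (MvPowerSeries.coeff e (F * G)) 0 1 = _
  rw [MvPowerSeries.coeff_mul, map_sum, Matrix.sum_apply]
  refine Finset.sum_congr rfl fun p _ => ?_
  rw [freeTw_mul]
  rfl

theorem dSer_X (s : Fin 2) : dSer (n := n) (MvPowerSeries.X s) = 0 := by
  funext e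
  change freeTw (MvPowerSeries.coeff e _) 0 1 = 0
  rw [MvPowerSeries.coeff_X]
  split_ifs <;> simp

theorem freeTw_fay (i j l : Fin n) (e : Fin 2 →₀ ℕ) :
    freeTw (MvPowerSeries.coeff e
      (XiFree.fay (fun i j m => XiFree.gen (.kr i j m)) i j l)) 0 1 = 0 := by
  open XiFree in
  have hcX : ∀ (s : Fin 2) (F : MvPowerSeries (Fin 2) (Xi n)) (e : Fin 2 →₀ ℕ),
      MvPowerSeries.coeff e (MvPowerSeries.X s * F) =
        if e s = 0 then 0 else MvPowerSeries.coeff (e - Finsupp.single s 1) F := by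
    intro s F e
    rw [MvPowerSeries.X, MvPowerSeries.coeff_monomial_mul]
    by_cases h : e s = 0
    · simp [h]
    · have : 1 ≤ e s := Nat.one_le_iff_ne_zero.mpr h
      simp [h, this]
  have hg : ∀ (i j : Fin n) (m : ℕ), freeTw (XiFree.gen (.kr i j m)) 0 1 =
      dGen (.kr i j m) := by
    intro i j m; rw [freeTw_gen]; rfl
  let N : Fin n → Fin n → MvPowerSeries (Fin 2) (Xi n) := fun i j => MvPowerSeries.C (nu i - nu j)
  let w : Fin n → Fin n → ℕ → XiFree n := fun i j m => XiFree.gen (.kr i j m)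
  have hA : ∀ i j, dSer (inAlpha (w i j)) = MvPowerSeries.X 0 * (N i j * inAlpha (kr i j)) := by
    intro i j; ext e
    rw [hcX, MvPowerSeries.coeff_C_mul]
    change freeTw (ite _ _ _) 0 1 = ite _ _ (_ * ite _ _ _)
    by_cases h1 : e 1 = 0
    · obtain h0 | ⟨m, h0⟩ : e 0 = 0 ∨ ∃ m, e 0 = m + 1 := by
        rcases e 0 with _ | m
        · exact Or.inl rfl
        · exact Or.inr ⟨m, rfl⟩
      · rw [if_pos h1, if_pos h0, hg, h0]; rfl
      · have : (e - Finsupp.single 0 1 : Fin 2 →₀ ℕ) 0 = m := by simp [h0]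
        have h' : (e - Finsupp.single 0 1 : Fin 2 →₀ ℕ) 1 = 0 := by simp [h1]
        rw [if_pos h1, if_neg (by omega), if_pos h', hg, this, h0]; rfl
    · have h' : (e - Finsupp.single 0 1 : Fin 2 →₀ ℕ) 1 ≠ 0 := by simpa using h1
      rw [if_neg h1, if_neg h']; simp
  have hB : ∀ i j, dSer (inBeta (w i j)) = MvPowerSeries.X 1 * (N i j * inBeta (kr i j)) := by
    intro i j; ext e
    rw [hcX, MvPowerSeries.coeff_C_mul]
    change freeTw (ite _ _ _) 0 1 = ite _ _ (_ * ite _ _ _)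
    by_cases h1 : e 0 = 0
    · obtain h0 | ⟨m, h0⟩ : e 1 = 0 ∨ ∃ m, e 1 = m + 1 := by
        rcases e 1 with _ | m
        · exact Or.inl rfl
        · exact Or.inr ⟨m, rfl⟩
      · rw [if_pos h1, if_pos h0, hg, h0]; rfl
      · have : (e - Finsupp.single 1 1 : Fin 2 →₀ ℕ) 1 = m := by simp [h0]
        have h' : (e - Finsupp.single 1 1 : Fin 2 →₀ ℕ) 0 = 0 := by simp [h1]
        rw [if_pos h1, if_neg (by omega), if_pos h', hg, this, h0]; rfl
    · have h' : (e - Finsupp.single 1 1 : Fin 2 →₀ ℕ) 0 ≠ 0 := by simpa using h1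
      rw [if_neg h1, if_neg h']; simp
  have hS : ∀ i j, dSer (inSum (w i j)) =
      (MvPowerSeries.X 0 + MvPowerSeries.X 1) * (N i j * inSum (kr i j)) := by
    intro i j; ext e
    rw [add_mul, map_add, hcX, hcX, MvPowerSeries.coeff_C_mul, MvPowerSeries.coeff_C_mul]
    change freeTw ((e 0 + e 1).choose (e 0) • XiFree.gen _) 0 1 =
      ite _ _ (_ * (Nat.choose _ _ • kr _ _ _)) + ite _ _ (_ * (Nat.choose _ _ • kr _ _ _))
    rw [map_nsmul, Matrix.smul_apply, hg]
    have e1 : (e - Finsupp.single 0 1 : Fin 2 →₀ ℕ) 0 = e 0 - 1 := by simp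
    have e2 : (e - Finsupp.single 0 1 : Fin 2 →₀ ℕ) 1 = e 1 := by simp
    have e3 : (e - Finsupp.single 1 1 : Fin 2 →₀ ℕ) 0 = e 0 := by simp
    have e4 : (e - Finsupp.single 1 1 : Fin 2 →₀ ℕ) 1 = e 1 - 1 := by simp
    rw [e1, e2, e3, e4]
    generalize e 0 = p
    generalize e 1 = q
    rcases p with _ | p <;> rcases q with _ | q
    · simp [dGen]
    · simp [dGen]
    · simp [dGen]
    · rw [if_neg (by omega), if_neg (by omega), show p + 1 + (q + 1) = (p + q + 1) + 1 by ring,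
        show p + 1 - 1 + (q + 1) = p + q + 1 by omega, show p + 1 + (q + 1 - 1) = p + q + 1 by omega,
        Nat.choose_succ_succ, add_smul, Nat.add_sub_cancel, mul_smul_comm, mul_smul_comm]
      rfl
  have hX : ∀ (s : Fin 2) (F : MvPowerSeries (Fin 2) (XiFree n)),
      dSer (MvPowerSeries.X s * F) = MvPowerSeries.X s * dSer F := by
    intro s F
    rw [dSer_mul, dSer_X]
    simp
  have mA : ∀ i j, MvPowerSeries.map (mk n : XiFree n →+* Xi n) (inAlpha (w i j)) =
      inAlpha (kr i j) := by
    intro i j; funext e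
    change (mk n) (ite _ _ _) = ite _ _ _
    split_ifs
    · rfl
    · exact map_zero _
  have mB : ∀ i j, MvPowerSeries.map (mk n : XiFree n →+* Xi n) (inBeta (w i j)) =
      inBeta (kr i j) := by
    intro i j; funext e
    change (mk n) (ite _ _ _) = ite _ _ _
    split_ifs
    · rfl
    · exact map_zero _
  have mS : ∀ i j, MvPowerSeries.map (mk n : XiFree n →+* Xi n) (inSum (w i j)) =
      inSum (kr i j) := by
    intro i j; funext e
    exact map_nsmul (mk n) _ _
  have iA : ∀ i j, MvPowerSeries.map (freeInv (n := n) : XiFree n →+* XiFree n) (inAlpha (w i j)) =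
      -inAlpha (w i j) := by
    intro i j; funext e
    change freeInv (ite _ _ _) = -ite _ _ _
    split_ifs
    · exact freeInv_gen _
    · simp
  have iB : ∀ i j, MvPowerSeries.map (freeInv (n := n) : XiFree n →+* XiFree n) (inBeta (w i j)) =
      -inBeta (w i j) := by
    intro i j; funext e
    change freeInv (ite _ _ _) = -ite _ _ _
    split_ifs
    · exact freeInv_gen _
    · simp
  have iS : ∀ i j, MvPowerSeries.map (freeInv (n := n) : XiFree n →+* XiFree n) (inSum (w i j)) =
      -inSum (w i j) := by
    intro i j; funext e
    change freeInv ((e 0 + e 1).choose (e 0) • XiFree.gen (.kr i j (e 0 + e 1))) =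
      -((e 0 + e 1).choose (e 0) • XiFree.gen (.kr i j (e 0 + e 1)))
    rw [map_nsmul, freeInv_gen, smul_neg]
  have hac : ∀ (i j i' j' : Fin n) (m : ℕ), kr i j m * (nu i' - nu j') =
      -((nu i' - nu j') * kr i j m) := by
    intro i j i' j' m
    rw [mul_sub, sub_mul, anticomm _ (.nu i'), anticomm _ (.nu j')]
    abel
  have cA : ∀ i j i' j', inAlpha (kr i j) * N i' j' = -(N i' j' * inAlpha (kr i j)) := by
    intro i j i' j'; ext e
    rw [map_neg, MvPowerSeries.coeff_C_mul, MvPowerSeries.coeff_mul_C]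
    change ite _ _ _ * _ = -(_ * ite _ _ _)
    split_ifs
    · exact hac ..
    · simp
  have cB : ∀ i j i' j', inBeta (kr i j) * N i' j' = -(N i' j' * inBeta (kr i j)) := by
    intro i j i' j'; ext e
    rw [map_neg, MvPowerSeries.coeff_C_mul, MvPowerSeries.coeff_mul_C]
    change ite _ _ _ * _ = -(_ * ite _ _ _)
    split_ifs
    · exact hac ..
    · simp
  have cS : ∀ i j i' j', inSum (kr i j) * N i' j' = -(N i' j' * inSum (kr i j)) := by
    intro i j i' j'; ext e
    rw [map_neg, MvPowerSeries.coeff_C_mul, MvPowerSeries.coeff_mul_C]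
    change ((e 0 + e 1).choose (e 0) • kr i j (e 0 + e 1)) * (nu i' - nu j') =
      -((nu i' - nu j') * ((e 0 + e 1).choose (e 0) • kr i j (e 0 + e 1)))
    rw [smul_mul_assoc, hac, mul_smul_comm, smul_neg]
  have hXc : ∀ (s : Fin 2) (F : MvPowerSeries (Fin 2) (Xi n)),
      F * MvPowerSeries.X s = MvPowerSeries.X s * F := fun s F => (MvPowerSeries.commute_X F s).eq
  have hNadd : ∀ i j l : Fin n, N i j + N j l = N i l := by
    intro i j l
    change MvPowerSeries.C _ + MvPowerSeries.C _ = MvPowerSeries.C _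
    rw [← map_add, sub_add_sub_cancel]
  -- the product rule for a product of two series
  have hprod : ∀ (F G : MvPowerSeries (Fin 2) (XiFree n)) (F' G' x y M M' :
      MvPowerSeries (Fin 2) (Xi n)),
      MvPowerSeries.map (mk n : XiFree n →+* Xi n) F = F' →
      MvPowerSeries.map (mk n : XiFree n →+* Xi n) G = G' →
      MvPowerSeries.map (freeInv (n := n) : XiFree n →+* XiFree n) F = -F →
      dSer F = x * (M * F') → dSer G = y * (M' * G') → F' * M' = -(M' * F') →
      F' * y = y * F' →
      dSer (F * G) = (x * M + y * M') * (F' * G') := by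
    intro F G F' G' x y M M' h1 h2 h3 h4 h5 h6 h7
    rw [dSer_mul, h2, h3, map_neg, h1, h4, h5, add_mul, neg_mul, ← mul_assoc F', h7,
      mul_assoc y, ← mul_assoc F', h6]
    simp only [mul_assoc, neg_mul, mul_neg, neg_neg]
  have hXadd : ∀ F : MvPowerSeries (Fin 2) (Xi n),
      F * (MvPowerSeries.X 0 + MvPowerSeries.X 1) = (MvPowerSeries.X 0 + MvPowerSeries.X 1) * F := by
    intro F; rw [mul_add, add_mul, hXc, hXc]
  have key : dSer (fay w i j l) =
      (MvPowerSeries.X 0 * N i l + MvPowerSeries.X 1 * N j l) * fay (kr (n := n)) i j l := by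
    have p1 := hprod _ _ _ _ _ _ _ _ (mA i l) (mB j l) (iA i l) (hA i l) (hB j l)
      (cA i l j l) (hXc 1 _)
    have p2 := hprod _ _ _ _ _ _ _ _ (mB j i) (mS i l) (iB j i) (hB j i) (hS i l)
      (cB j i i l) (hXadd _)
    have p3 := hprod _ _ _ _ _ _ _ _ (mS j l) (mA i j) (iS j l) (hS j l) (hA i j)
      (cS j l i j) (hXc 0 _)
    have q2 : MvPowerSeries.X 1 * N j i + (MvPowerSeries.X 0 + MvPowerSeries.X 1) * N i l =
        MvPowerSeries.X 0 * N i l + MvPowerSeries.X 1 * N j l := by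
      rw [← hNadd j i l]; noncomm_ring
    have q3 : (MvPowerSeries.X 0 + MvPowerSeries.X 1) * N j l + MvPowerSeries.X 0 * N i j =
        MvPowerSeries.X 0 * N i l + MvPowerSeries.X 1 * N j l := by
      rw [← hNadd i j l]; noncomm_ring
    rw [q2] at p2
    rw [q3] at p3
    have hXc' : ∀ (s : Fin 2) (F G : MvPowerSeries (Fin 2) (Xi n)),
        MvPowerSeries.X s * (F * G) = F * (MvPowerSeries.X s * G) := by
      intro s F G; rw [← mul_assoc, ← hXc, mul_assoc]
    unfold fay
    rw [dSer_add, dSer_add, add_mul, dSer_add, hX, hX, hX, hX, p1, p2, p3]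
    generalize MvPowerSeries.X 0 * N i l + MvPowerSeries.X 1 * N j l = P
    rw [hXc' 0 P, hXc' 1 P, hXc' 0 P, hXc' 1 P]
    simp only [mul_add, add_mul]
  have hz := congrFun key e
  rw [fay_eq_zero, mul_zero] at hz
  exact hz

theorem freeTw_rel {a b : XiFree n} (h : XiRel n a b) : freeTw a 0 1 = freeTw b 0 1 := by
  cases h with
  | anticomm x y =>
    have h1 : ∀ (x y : XiGen n), dGen x * gen y = gen y * dGen x := by
      intro x y
      rcases x with i | i | ⟨i, j, _ | m⟩
      · simp [dGen]
      · simp [dGen]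
      · simp [dGen]
      · change (nu i - nu j) * kr i j m * gen y = gen y * ((nu i - nu j) * kr i j m)
        rw [mul_assoc, anticomm _ y, ← mul_assoc (gen y), mul_sub (gen y), anticomm y (.nu i),
          anticomm y (.nu j)]
        noncomm_ring
    have h2 : ∀ x y : XiGen n, freeTw (XiFree.gen x * XiFree.gen y) 0 1 =
        dGen x * gen y - gen x * dGen y := by
      intro x y
      rw [freeTw_mul, freeTw_gen, freeTw_gen, freeInv_gen, map_neg]
      simp [gen, sub_eq_add_neg]
    rw [map_neg, Matrix.neg_apply, h2, h2, h1 x y, h1 y x]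
    abel
  | antisymm i j m =>
    have h0 : ∀ m (a : XiFree n), freeTw ((-1) ^ m * a) 0 1 = (-1) ^ m * freeTw a 0 1 := by
      intro m a
      rcases neg_one_pow_eq_or ℤ m with h | h
      · have e1 := congrArg (Int.cast : ℤ → XiFree n) h
        have e2 := congrArg (Int.cast : ℤ → Xi n) h
        push_cast at e1 e2
        rw [e1, e2, one_mul, one_mul]
      · have e1 := congrArg (Int.cast : ℤ → XiFree n) h
        have e2 := congrArg (Int.cast : ℤ → Xi n) h
        push_cast at e1 e2
        rw [e1, e2, neg_one_mul, neg_one_mul, map_neg]; rfl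
    rw [map_add, Matrix.add_apply, h0, freeTw_gen, freeTw_gen, map_zero]
    rcases m with _ | m
    · simp [dGen]
    · have := antisymm i j m
      have h3 : (nu i - nu j) * (kr i j m + (-1) ^ m * kr j i m) = 0 := by rw [this, mul_zero]
      change (nu i - nu j) * kr i j m + (-1) ^ (m + 1) * ((nu j - nu i) * kr j i m) = 0
      rw [← h3, mul_add, ← mul_assoc (nu i - nu j) ((-1) ^ m),
        ((Commute.neg_one_right (nu i - nu j)).pow_right m).eq, pow_succ]
      noncomm_ring
  | zero i j =>
    rw [map_sub, Matrix.sub_apply, freeTw_gen, freeTw_gen, freeTw_gen]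
    simp [dGen]
  | fay i j l e => rw [freeTw_fay, map_zero]; rfl

theorem mk_freeInv_rel {a b : XiFree n} (h : XiRel n a b) :
    mk n (freeInv a) = mk n (freeInv b) := by
  cases h with
  | anticomm x y =>
    simp only [map_mul, map_neg, freeInv_gen, neg_mul_neg]
    exact anticomm x y
  | antisymm i j m =>
    have := antisymm i j m
    simp only [map_add, map_mul, map_pow, map_neg, map_one, map_zero, freeInv_gen]
    rw [mul_neg, ← neg_add]
    exact neg_eq_zero.mpr this
  | zero i j =>
    simp only [map_sub, freeInv_gen, map_neg]
    have := kr_zero i j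
    change -kr i j 0 = -om i - -om j
    rw [this]; abel
  | fay i j l e =>
    rw [map_zero, map_zero]
    have h1 := map_fay (freeInv (n := n) : XiFree n →+* XiFree n)
      (fun i j m => XiFree.gen (.kr i j m)) i j l
    have h2 : XiFree.fay (fun i j m => (freeInv (n := n) : XiFree n →+* XiFree n)
        (XiFree.gen (.kr i j m))) i j l = XiFree.fay (fun i j m => XiFree.gen (.kr i j m)) i j l := by
      have a1 : ∀ i j : Fin n, XiFree.inAlpha (fun m => (freeInv (n := n) : XiFree n →+* XiFree n)
          (XiFree.gen (.kr i j m))) = -XiFree.inAlpha (fun m => XiFree.gen (.kr i j m)) := by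
        intro i j; funext e
        change ite _ (freeInv _) _ = -ite _ _ _
        rw [freeInv_gen]
        split_ifs <;> simp
      have a2 : ∀ i j : Fin n, XiFree.inBeta (fun m => (freeInv (n := n) : XiFree n →+* XiFree n)
          (XiFree.gen (.kr i j m))) = -XiFree.inBeta (fun m => XiFree.gen (.kr i j m)) := by
        intro i j; funext e
        change ite _ (freeInv _) _ = -ite _ _ _
        rw [freeInv_gen]
        split_ifs <;> simp
      have a3 : ∀ i j : Fin n, XiFree.inSum (fun m => (freeInv (n := n) : XiFree n →+* XiFree n)
          (XiFree.gen (.kr i j m))) = -XiFree.inSum (fun m => XiFree.gen (.kr i j m)) := by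
        intro i j; funext e
        change (e 0 + e 1).choose (e 0) • freeInv (XiFree.gen (.kr i j (e 0 + e 1))) =
          -((e 0 + e 1).choose (e 0) • XiFree.gen (.kr i j (e 0 + e 1)))
        rw [freeInv_gen, smul_neg]
      simp only [XiFree.fay, a1, a2, a3, neg_mul_neg]
    rw [h2] at h1
    have h3 := congrArg (MvPowerSeries.coeff e) h1
    rw [MvPowerSeries.coeff_map] at h3
    have h4 := mk_rel (XiRel.fay i j l e)
    rw [map_zero] at h4
    exact (congrArg (mk n) h3).trans h4

/-- The automorphism `a ↦ (-1) ^ deg a * a`. -/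
noncomputable def inv : Xi n →ₐ[ℂ] Xi n :=
  lift ((mk n).comp freeInv) fun _ _ h => mk_freeInv_rel h

theorem inv_mk (a : XiFree n) : inv (mk n a) = mk n (freeInv a) :=
  lift_mk ..

theorem inv_gen (x : XiGen n) : inv (gen x) = -gen x := by
  rw [gen, inv_mk, freeInv_gen, map_neg]

/-- The algebra homomorphism `a ↦ !![inv a, da; 0, a]`. -/
noncomputable def tw : Xi n →ₐ[ℂ] Matrix (Fin 2) (Fin 2) (Xi n) :=
  lift freeTw fun a b h => by
    ext i j
    fin_cases i <;> fin_cases j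
    · exact (freeTw_apply a).2.2.trans ((mk_freeInv_rel h).trans (freeTw_apply b).2.2.symm)
    · exact freeTw_rel h
    · exact (freeTw_apply a).1.trans (freeTw_apply b).1.symm
    · exact (freeTw_apply a).2.1.trans
        ((mk_rel h).trans (freeTw_apply b).2.1.symm)

theorem tw_mk (a : XiFree n) : tw (mk n a) = freeTw a :=
  lift_mk ..

variable (n) in
/-- The differential of `Ξ_n`: the antiderivation with the given values `dGen` on the generators
(see `d_gen`, `d_mul` below). -/
noncomputable def d : Xi n →ₗ[ℂ] Xi n where
  toFun a := tw a 0 1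
  map_add' a b := by rw [map_add]; rfl
  map_smul' c a := by rw [map_smul]; rfl

theorem d_gen (x : XiGen n) : d n (gen x) = dGen x := by
  change tw (mk n _) 0 1 = _
  rw [tw_mk, freeTw_gen]; rfl

theorem d_mul (a b : Xi n) : d n (a * b) = d n a * b + inv a * d n b := by
  obtain ⟨a, rfl⟩ := mk_surjective n a
  obtain ⟨b, rfl⟩ := mk_surjective n b
  change tw _ 0 1 = tw (mk n a) 0 1 * _ + inv (mk n a) * tw (mk n b) 0 1
  rw [← map_mul (mk n), tw_mk, tw_mk, tw_mk, freeTw_mul, inv_mk]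

theorem d_algebraMap (c : ℂ) : d n (algebraMap ℂ _ c) = 0 := by
  change tw _ 0 1 = 0
  rw [AlgHom.commutes]; rfl

variable (n) in
/-- The span of the generators. -/
noncomputable def degOne : Submodule ℂ (Xi n) := Submodule.span ℂ (Set.range gen)

variable (n) in
/-- The component of degree `p`, spanned by the products of `p` generators. -/
noncomputable def deg (p : ℕ) : Submodule ℂ (Xi n) := degOne n ^ p

theorem gen_mem (x : XiGen n) : gen x ∈ degOne n := Submodule.subset_span ⟨x, rfl⟩

theorem gen_mem_deg (x : XiGen n) : gen x ∈ deg n 1 := by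
  rw [deg, pow_one]; exact gen_mem x

instance : SetLike.GradedMonoid (deg n) := Submodule.nat_power_gradedMonoid (degOne n)

theorem induction {C : Xi n → Prop} (h0 : ∀ c : ℂ, C (algebraMap ℂ _ c)) (h1 : ∀ x, C (gen x))
    (hm : ∀ a b, C a → C b → C (a * b)) (ha : ∀ a b, C a → C b → C (a + b)) (a : Xi n) : C a := by
  obtain ⟨a, rfl⟩ := mk_surjective n a
  induction a using FreeAlgebra.induction with
  | grade0 r => rw [AlgHom.commutes]; exact h0 r
  | grade1 x => exact h1 x
  | mul a b iha ihb => rw [map_mul]; exact hm _ _ iha ihb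
  | add a b iha ihb => rw [map_add]; exact ha _ _ iha ihb

theorem hom_ext {B : Type*} [Ring B] [Algebra ℂ B] {f g : Xi n →ₐ[ℂ] B}
    (h : ∀ x, f (gen x) = g (gen x)) : f = g := by
  ext a
  induction a using Xi.induction with
  | h0 c => rw [AlgHom.commutes, AlgHom.commutes]
  | h1 x => exact h x
  | hm a b ha hb => rw [map_mul, map_mul, ha, hb]
  | ha a b ha hb => rw [map_add, map_add, ha, hb]

open scoped DirectSum

/-- Auxiliary: the decomposition on the free algebra. -/
noncomputable def freeDec : XiFree n →ₐ[ℂ] ⨁ p : ℕ, deg n p :=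
  FreeAlgebra.lift ℂ fun x => DirectSum.of (fun p => deg n p) 1 ⟨gen x, gen_mem_deg x⟩

theorem freeDec_gen (x : XiGen n) : freeDec (XiFree.gen x) =
    DirectSum.of (fun p => deg n p) 1 ⟨gen x, gen_mem_deg x⟩ :=
  FreeAlgebra.lift_ι_apply _ _

variable (n) in
/-- Auxiliary: the homogeneous elements of the free algebra. -/
noncomputable def freeDeg (p : ℕ) : Submodule ℂ (XiFree n) :=
  Submodule.span ℂ (Set.range XiFree.gen) ^ p

theorem freeDec_eq (p : ℕ) (a : XiFree n) (ha : a ∈ freeDeg n p) :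
    ∃ h : mk n a ∈ deg n p, freeDec a = DirectSum.of (fun p => deg n p) p ⟨mk n a, h⟩ := by
  unfold freeDeg at ha
  induction ha using Submodule.pow_induction_on_left' with
  | algebraMap r =>
    refine ⟨?_, ?_⟩
    · rw [AlgHom.commutes, deg, pow_zero]; exact Submodule.algebraMap_mem r
    · rw [AlgHom.commutes, DirectSum.algebraMap_apply]
      refine congrArg _ (Subtype.ext ?_)
      exact (AlgHom.commutes (mk n) r).symm
  | add x y i hx hy ihx ihy =>
    obtain ⟨h1, e1⟩ := ihx
    obtain ⟨h2, e2⟩ := ihy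
    refine ⟨by rw [map_add]; exact add_mem h1 h2, ?_⟩
    rw [map_add, e1, e2, ← map_add]
    exact congrArg _ (Subtype.ext (map_add (mk n) x y).symm)
  | mem_mul m hm i x hx ih =>
    obtain ⟨h, e⟩ := ih
    induction hm using Submodule.span_induction with
    | mem y hy =>
      obtain ⟨y, rfl⟩ := hy
      refine ⟨?_, ?_⟩
      · rw [map_mul, deg, pow_succ']; exact Submodule.mul_mem_mul (gen_mem y) h
      · rw [map_mul, e, freeDec_gen, DirectSum.of_mul_of]
        exact DirectSum.of_eq_of_gradedMonoid_eq (Sigma.subtype_ext (add_comm _ _)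
          (map_mul (mk n) _ _).symm)
    | zero =>
      refine ⟨by rw [zero_mul, map_zero]; exact zero_mem _, ?_⟩
      refine (congrArg freeDec (zero_mul x)).trans ((map_zero _).trans ?_)
      refine ((congrArg (DirectSum.of (fun p => deg n p) _) (Subtype.ext ?_)).trans
        (map_zero (DirectSum.of (fun p => deg n p) _))).symm
      exact (congrArg (mk n) (zero_mul x)).trans (map_zero _)
    | add u v _ _ hu hv =>
      obtain ⟨h1, e1⟩ := hu
      obtain ⟨h2, e2⟩ := hv
      refine ⟨by rw [add_mul, map_add]; exact add_mem h1 h2, ?_⟩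
      refine (congrArg freeDec (add_mul u v x)).trans ?_
      rw [map_add, e1, e2, ← map_add]
      exact congrArg _ (Subtype.ext
        ((map_add (mk n) _ _).symm.trans (congrArg (mk n) (add_mul u v x).symm)))
    | smul c u _ hu =>
      obtain ⟨h1, e1⟩ := hu
      refine ⟨by rw [smul_mul_assoc, map_smul]; exact Submodule.smul_mem _ _ h1, ?_⟩
      refine (congrArg freeDec (smul_mul_assoc c u x)).trans ?_
      rw [map_smul, e1, ← DirectSum.lof_eq_of ℂ, ← map_smul, DirectSum.lof_eq_of]
      exact congrArg _ (Subtype.ext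
        ((map_smul (mk n) _ _).symm.trans (congrArg (mk n) (smul_mul_assoc c u x).symm)))

theorem freeDec_congr (p : ℕ) {a b : XiFree n} (ha : a ∈ freeDeg n p) (hb : b ∈ freeDeg n p)
    (h : mk n a = mk n b) : freeDec a = freeDec b := by
  obtain ⟨h1, e1⟩ := freeDec_eq p a ha
  obtain ⟨h2, e2⟩ := freeDec_eq p b hb
  rw [e1, e2]
  exact congrArg _ (Subtype.ext h)

theorem freeDec_rel {a b : XiFree n} (h : XiRel n a b) : freeDec a = freeDec b := by
  have hg : ∀ x : XiGen n, XiFree.gen x ∈ Submodule.span ℂ (Set.range (XiFree.gen (n := n))) :=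
    fun x => Submodule.subset_span ⟨x, rfl⟩
  have hg1 : ∀ x : XiGen n, XiFree.gen x ∈ freeDeg n 1 := by
    intro x; rw [freeDeg, pow_one]; exact hg x
  have hg2 : ∀ x y : XiGen n, XiFree.gen x * XiFree.gen y ∈ freeDeg n 2 := by
    intro x y; rw [freeDeg, pow_two]; exact Submodule.mul_mem_mul (hg x) (hg y)
  have hmk := mk_rel h
  cases h with
  | anticomm x y => exact freeDec_congr 2 (hg2 x y) (neg_mem (hg2 y x)) hmk
  | antisymm i j m =>
    refine freeDec_congr 1 (add_mem (hg1 _) ?_) (zero_mem _) hmk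
    rcases neg_one_pow_eq_or ℤ m with h | h
    · have e1 := congrArg (Int.cast : ℤ → XiFree n) h
      push_cast at e1
      rw [e1, one_mul]; exact hg1 _
    · have e1 := congrArg (Int.cast : ℤ → XiFree n) h
      push_cast at e1
      rw [e1, neg_one_mul]; exact neg_mem (hg1 _)
  | zero i j => exact freeDec_congr 1 (hg1 _) (sub_mem (hg1 _) (hg1 _)) hmk
  | fay i j l e =>
    refine freeDec_congr 2 ?_ (zero_mem _) hmk
    have hA : ∀ (i j : Fin n) e, MvPowerSeries.coeff e
        (XiFree.inAlpha (fun m => XiFree.gen (.kr i j m))) ∈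
          Submodule.span ℂ (Set.range (XiFree.gen (n := n))) := by
      intro i j e
      change ite _ _ _ ∈ _
      split_ifs
      exacts [hg _, zero_mem _]
    have hB : ∀ (i j : Fin n) e, MvPowerSeries.coeff e
        (XiFree.inBeta (fun m => XiFree.gen (.kr i j m))) ∈
          Submodule.span ℂ (Set.range (XiFree.gen (n := n))) := by
      intro i j e
      change ite _ _ _ ∈ _
      split_ifs
      exacts [hg _, zero_mem _]
    have hS : ∀ (i j : Fin n) e, MvPowerSeries.coeff e
        (XiFree.inSum (fun m => XiFree.gen (.kr i j m))) ∈
          Submodule.span ℂ (Set.range (XiFree.gen (n := n))) := by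
      intro i j e
      exact nsmul_mem (hg _) _
    have hmul : ∀ F G : MvPowerSeries (Fin 2) (XiFree n),
        (∀ e, MvPowerSeries.coeff e F ∈ Submodule.span ℂ (Set.range (XiFree.gen (n := n)))) →
        (∀ e, MvPowerSeries.coeff e G ∈ Submodule.span ℂ (Set.range (XiFree.gen (n := n)))) →
        ∀ e, MvPowerSeries.coeff e (F * G) ∈ freeDeg n 2 := by
      intro F G hF hG e
      rw [MvPowerSeries.coeff_mul, freeDeg, pow_two]
      exact sum_mem fun p _ => Submodule.mul_mem_mul (hF _) (hG _)
    have hX : ∀ (s : Fin 2) (F : MvPowerSeries (Fin 2) (XiFree n)),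
        (∀ e, MvPowerSeries.coeff e F ∈ freeDeg n 2) →
        ∀ e, MvPowerSeries.coeff e (MvPowerSeries.X s * F) ∈ freeDeg n 2 := by
      intro s F hF e
      rw [MvPowerSeries.X, MvPowerSeries.coeff_monomial_mul]
      split_ifs
      · rw [one_mul]; exact hF _
      · exact zero_mem _
    unfold XiFree.fay
    rw [add_mul, map_add, map_add, map_add]
    exact add_mem (add_mem (add_mem (hX _ _ (hmul _ _ (hA _ _) (hB _ _)) _)
      (hX _ _ (hmul _ _ (hA _ _) (hB _ _)) _)) (hX _ _ (hmul _ _ (hB _ _) (hS _ _)) _))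
      (hX _ _ (hmul _ _ (hS _ _) (hA _ _)) _)

/-- Auxiliary: the decomposition of `Ξ_n`. -/
noncomputable def dec : Xi n →ₐ[ℂ] ⨁ p : ℕ, deg n p :=
  lift freeDec fun _ _ h => freeDec_rel h

theorem dec_gen (x : XiGen n) :
    dec (gen x) = DirectSum.of (fun p => deg n p) 1 ⟨gen x, gen_mem_deg x⟩ := by
  rw [← freeDec_gen]
  exact lift_mk ..

theorem dec_eq (p : ℕ) (a : deg n p) : dec (a : Xi n) = DirectSum.of (fun p => deg n p) p a := by
  obtain ⟨a, ha⟩ := a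
  have hle : deg n p ≤ Submodule.map (mk n).toLinearMap (freeDeg n p) := by
    rw [deg, freeDeg, Submodule.map_pow, degOne, Submodule.map_span, ← Set.range_comp]
    exact le_rfl
  obtain ⟨b, hb, rfl⟩ := hle ha
  obtain ⟨h, e⟩ := freeDec_eq p b hb
  exact (lift_mk ..).trans e

noncomputable instance gradedAlgebra : GradedAlgebra (deg n) :=
  GradedAlgebra.ofAlgHom _ dec
    (by
      refine hom_ext fun x => ?_
      change DirectSum.coeAlgHom _ (dec (gen x)) = gen x
      rw [dec_gen, DirectSum.coeAlgHom_of])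
    dec_eq

theorem inv_of_mem (p : ℕ) (a : Xi n) (ha : a ∈ deg n p) : inv a = (-1) ^ p * a := by
  unfold deg at ha
  induction ha using Submodule.pow_induction_on_left' with
  | algebraMap r => simp
  | add x y i hx hy ihx ihy => rw [map_add, ihx, ihy, mul_add]
  | mem_mul m hm i x hx ih =>
    have hm' : inv m = -m := by
      unfold degOne at hm
      induction hm using Submodule.span_induction with
      | mem y hy => obtain ⟨y, rfl⟩ := hy; exact inv_gen y
      | zero => simp
      | add u v _ _ hu hv => rw [map_add, hu, hv, neg_add]
      | smul c u _ hu => rw [map_smul, hu, smul_neg]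
    rw [map_mul, ih, hm', pow_succ]
    rw [← mul_assoc, neg_mul, ((Commute.neg_one_right m).pow_right i).eq]
    simp [mul_assoc]

theorem dGen_mem (x : XiGen n) : dGen x ∈ degOne n ^ 2 := by
  rcases x with i | i | ⟨i, j, _ | m⟩
  · exact zero_mem _
  · exact zero_mem _
  · exact zero_mem _
  · rw [pow_two]
    exact Submodule.mul_mem_mul (sub_mem (gen_mem _) (gen_mem _)) (gen_mem _)

theorem d_mem (p : ℕ) (a : Xi n) (ha : a ∈ deg n p) : d n a ∈ deg n (p + 1) := by
  unfold deg at ha ⊢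
  induction ha using Submodule.pow_induction_on_left' with
  | algebraMap r => rw [d_algebraMap]; exact zero_mem _
  | add x y i hx hy ihx ihy => rw [map_add]; exact add_mem ihx ihy
  | mem_mul m hm i x hx ih =>
    rw [d_mul]
    refine add_mem ?_ ?_
    · have h : d n m ∈ degOne n ^ 2 := by
        unfold degOne at hm
        induction hm using Submodule.span_induction with
        | mem y hy => obtain ⟨y, rfl⟩ := hy; rw [d_gen]; exact dGen_mem y
        | zero => simp
        | add u v _ _ hu hv => rw [map_add]; exact add_mem hu hv
        | smul c u _ hu => rw [map_smul]; exact Submodule.smul_mem _ _ hu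
      have := Submodule.mul_mem_mul h hx
      rwa [← pow_add, show 2 + i = i + 1 + 1 by ring] at this
    · have hm' : inv m ∈ degOne n := by
        rw [inv_of_mem 1 m (by rw [deg, pow_one]; exact hm), pow_one, neg_one_mul]
        exact neg_mem hm
      have := Submodule.mul_mem_mul hm' ih
      rwa [← pow_succ'] at this

theorem d_dGen (x : XiGen n) : d n (dGen x) = 0 := by
  rcases x with i | i | ⟨i, j, _ | m⟩
  · exact map_zero _
  · exact map_zero _
  · exact map_zero _
  · have h : d n (nu i - nu j) = 0 := by
      rw [map_sub, d_gen, d_gen]; exact sub_zero _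
    change d n ((nu i - nu j) * kr i j m) = 0
    rw [d_mul, h, zero_mul, zero_add, map_sub, inv_gen, inv_gen, d_gen]
    rcases m with _ | m
    · exact mul_zero _
    · change (-nu i - -nu j) * ((nu i - nu j) * kr i j m) = 0
      have hs : ∀ x : XiGen n, gen x * gen x = 0 := by
        intro x
        have h2 := anticomm x x
        have h3 : (2 : ℂ) • (gen x * gen x) = 0 := by
          rw [two_smul]; nth_rewrite 1 [h2]; exact neg_add_cancel _
        exact (smul_eq_zero.mp h3).resolve_left two_ne_zero
      rw [← mul_assoc, show (-nu i - -nu j) * (nu i - nu j) =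
        -(nu i * nu i) - nu j * nu j + (nu i * nu j + nu j * nu i) by noncomm_ring, hs, hs,
        anticomm (.nu i) (.nu j)]
      simp

theorem d_d (a : Xi n) : d n (d n a) = 0 := by
  have : inv (d n a) = -d n (inv a) ∧ d n (d n a) = 0 := by
    induction a using Xi.induction with
    | h0 c => simp [d_algebraMap]
    | h1 x =>
      refine ⟨?_, by rw [d_gen, d_dGen]⟩
      rw [inv_gen, map_neg, neg_neg, inv_of_mem 2 _ (d_mem 1 _ (gen_mem_deg x))]
      simp
    | hm a b ha hb =>
      refine ⟨?_, ?_⟩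
      · rw [d_mul, map_mul, d_mul, map_add, map_mul, map_mul, ha.1, hb.1, neg_mul, mul_neg, neg_add]
      · rw [d_mul, map_add, d_mul, d_mul, ha.1, ha.2, hb.2]
        simp
    | ha a b ha hb =>
      refine ⟨?_, ?_⟩
      · rw [map_add, map_add, ha.1, hb.1, map_add, map_add, neg_add]
      · rw [map_add, map_add, ha.2, hb.2, add_zero]
  exact this.2

theorem anticomm' (v : Xi n) (hv : v ∈ degOne n) (w : Xi n) (hw : w ∈ degOne n) :
    v * w = -(w * v) := by
  unfold degOne at hv hw
  induction hv using Submodule.span_induction with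
  | mem x hx =>
    obtain ⟨x, rfl⟩ := hx
    induction hw using Submodule.span_induction with
    | mem y hy => obtain ⟨y, rfl⟩ := hy; exact anticomm x y
    | zero => simp
    | add u v _ _ hu hv => rw [mul_add, hu, hv, add_mul, neg_add]
    | smul c u _ hu => rw [mul_smul_comm, hu, smul_mul_assoc, smul_neg]
  | zero => simp
  | add u v _ _ hu hv => rw [add_mul, hu, hv, mul_add, neg_add]
  | smul c u _ hu => rw [smul_mul_assoc, hu, mul_smul_comm, smul_neg]

variable (n) in
theorem isCommDGAlgebra : IsCommDGAlgebra (deg n) (d n) where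
  d_mem := d_mem
  d_d := d_d
  leibniz p a b ha := by rw [d_mul, inv_of_mem p a ha, mul_assoc]
  comm := comm_of_pow _ anticomm'

end Xi

end Xi

section Elliptic

open UpperHalfPlane

/-- The periods `1`, `τ`. -/
noncomputable def periods (τ : ℍ) : PeriodPair where
  ω₁ := 1
  ω₂ := τ
  indep := by
    refine LinearIndependent.pair_iff.mpr fun s t h => ?_
    have him := congrArg Complex.im h
    have hre := congrArg Complex.re h
    simp only [Complex.add_im, Complex.real_smul, Complex.mul_im, Complex.ofReal_re,
      Complex.ofReal_im, Complex.one_im, Complex.zero_im, coe_im, mul_zero, zero_mul,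
      add_zero, zero_add] at him
    have ht : t = 0 := (mul_eq_zero.mp him).resolve_right τ.im_pos.ne'
    subst ht
    simp only [Complex.real_smul, Complex.add_re, Complex.mul_re, Complex.ofReal_re,
      Complex.ofReal_im, Complex.one_re, Complex.one_im, Complex.zero_re] at hre
    exact ⟨by linarith, rfl⟩

/-- The Weierstrass zeta function, normalised by `ζ(x) = 1/x - ∑_{k ≥ 0} G_{2k+2}(τ) x^(2k+1)`,
so that `ζ(x + 1) = ζ(x)`. The summand with `l = 0` is `1 / x`. -/
noncomputable def zeta (τ : ℍ) (x : ℂ) : ℂ :=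
  ∑' l : (periods τ).lattice, (1 / (x - l) + 1 / l + x / (l : ℂ) ^ 2) - EisensteinSeries.G2 τ * x

/-- The functions `𝓔_m(x) = 1/x^m + ∑_{l ≠ 0} (1/(x + l)^m - 1/l^m)` for `m ≥ 2`, and `𝓔_1 = ζ`.
The summand with `l = 0` is `1 / x ^ m`. -/
noncomputable def eisensteinE (τ : ℍ) (m : ℕ) (x : ℂ) : ℂ :=
  if m = 1 then zeta τ x else ∑' l : (periods τ).lattice, (1 / (x + l) ^ m - 1 / (l : ℂ) ^ m)

/-- The power series `α * Ω(α)` in `α`, where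
`Ω(α) = α⁻¹ exp(α (𝓔_1(x - y) - 𝓔_1(x) + 𝓔_1(y))) exp(-∑_{m ≥ 2} (-α)^m / m * 𝓔_m(x - y))`. -/
noncomputable def kroneckerSeries (τ : ℍ) (x y : ℂ) : PowerSeries ℂ :=
  (PowerSeries.exp ℂ).subst
      (PowerSeries.mk fun m =>
        if m = 1 then eisensteinE τ 1 (x - y) - eisensteinE τ 1 x + eisensteinE τ 1 y else 0) *
    (PowerSeries.exp ℂ).subst
      (PowerSeries.mk fun m => if 2 ≤ m then -((-1) ^ m / (m : ℂ) * eisensteinE τ m (x - y)) else 0)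

/-- The elliptic curve `ℂ / (ℤ + ℤτ)`. -/
abbrev EllCurve (τ : ℍ) : Type := ℂ ⧸ (periods τ).lattice

/-- The class of a complex number. -/
noncomputable abbrev EllCurve.mk (τ : ℍ) (z : ℂ) : EllCurve τ := Submodule.Quotient.mk z

/-- The function `u = ℘` on the curve (with the junk value `0` at the origin). -/
noncomputable def EllCurve.u (τ : ℍ) (x : EllCurve τ) : ℂ :=
  Quotient.liftOn' x (periods τ).weierstrassP fun a b h => by
    have h' : -a + b ∈ (periods τ).lattice := QuotientAddGroup.leftRel_apply.mp h
    have := (periods τ).weierstrassP_add_coe a ⟨-a + b, h'⟩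
    rw [← this]; congr 1; simp

/-- The function `v = ℘'` on the curve (with the junk value `0` at the origin). -/
noncomputable def EllCurve.v (τ : ℍ) (x : EllCurve τ) : ℂ :=
  Quotient.liftOn' x (periods τ).derivWeierstrassP fun a b h => by
    have h' : -a + b ∈ (periods τ).lattice := QuotientAddGroup.leftRel_apply.mp h
    have := (periods τ).derivWeierstrassP_add_coe a ⟨-a + b, h'⟩
    rw [← this]; congr 1; simp

/-- The configuration space `F(X, n)` of the punctured curve `X`. -/
def Conf (τ : ℍ) (n : ℕ) : Type :=
  {x : Fin n → EllCurve τ // (∀ i, x i ≠ 0) ∧ ∀ i j, i ≠ j → x i ≠ x j}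

/-- The value at a configuration of a polynomial in the affine coordinates `u_i`, `v_i`. -/
noncomputable def Conf.eval {τ : ℍ} {n : ℕ} (x : Conf τ n) :
    MvPolynomial (Fin n ⊕ Fin n) ℂ →ₐ[ℂ] ℂ :=
  MvPolynomial.aeval (Sum.elim (fun i => EllCurve.u τ (x.1 i)) fun i => EllCurve.v τ (x.1 i))

/-- The coordinate ring `Γ_n` of `F(X, n)`: the regular functions on this open subvariety of the
affine variety `X^n`, that is the functions which are Zariski-locally quotients of polynomials in
the coordinates `u_i`, `v_i`. -/
noncomputable def regularFunctions (τ : ℍ) (n : ℕ) : Subalgebra ℂ (Conf τ n → ℂ) where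
  carrier := {f | ∀ P : Conf τ n, ∃ p q : MvPolynomial (Fin n ⊕ Fin n) ℂ,
    P.eval q ≠ 0 ∧ ∀ Q : Conf τ n, Q.eval q ≠ 0 → f Q = Q.eval p / Q.eval q}
  mul_mem' := by
    intro f g hf hg P
    obtain ⟨p, q, h1, h2⟩ := hf P
    obtain ⟨p', q', h3, h4⟩ := hg P
    refine ⟨p * p', q * q', by rw [map_mul]; exact mul_ne_zero h1 h3, fun Q hQ => ?_⟩
    rw [map_mul] at hQ
    have hq := left_ne_zero_of_mul hQ
    have hq' := right_ne_zero_of_mul hQ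
    rw [Pi.mul_apply, h2 Q hq, h4 Q hq', map_mul, map_mul, div_mul_div_comm]
  add_mem' := by
    intro f g hf hg P
    obtain ⟨p, q, h1, h2⟩ := hf P
    obtain ⟨p', q', h3, h4⟩ := hg P
    refine ⟨p * q' + q * p', q * q', by rw [map_mul]; exact mul_ne_zero h1 h3, fun Q hQ => ?_⟩
    rw [map_mul] at hQ
    have hq := left_ne_zero_of_mul hQ
    have hq' := right_ne_zero_of_mul hQ
    rw [Pi.add_apply, h2 Q hq, h4 Q hq', map_add, map_mul, map_mul, map_mul, div_add_div _ _ hq hq']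
  algebraMap_mem' := by
    intro c P
    refine ⟨MvPolynomial.C c, 1, by simp, fun Q _ => ?_⟩
    rw [map_one, div_one]
    exact (AlgHom.commutes Q.eval c).symm

/-- The coordinate ring `Γ_n`. -/
abbrev CoordRing (τ : ℍ) (n : ℕ) : Type := regularFunctions τ n

namespace CoordRing

variable {τ : ℍ} {n : ℕ}

theorem eval_mem (p : MvPolynomial (Fin n ⊕ Fin n) ℂ) :
    (fun x : Conf τ n => x.eval p) ∈ regularFunctions τ n := fun P =>
  ⟨p, 1, by simp, fun Q _ => by simp⟩

variable (τ) in
/-- The regular function `u_i = ℘(x_i)`. -/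
noncomputable def u (i : Fin n) : CoordRing τ n :=
  ⟨fun x => EllCurve.u τ (x.1 i), by simpa [Conf.eval] using eval_mem (MvPolynomial.X (.inl i))⟩

variable (τ) in
/-- The regular function `v_i = ℘'(x_i)`. -/
noncomputable def v (i : Fin n) : CoordRing τ n :=
  ⟨fun x => EllCurve.v τ (x.1 i), by simpa [Conf.eval] using eval_mem (MvPolynomial.X (.inr i))⟩

/-- `η` is the form `dx_i = du_i / v_i`, the pullback along the `i`-th projection of the global
section `dx` dual to the derivation `∂_x = v ∂_u + (P'(u) / 2) ∂_v`, with
`P(u) = 4 u^3 - g₂ u - g₃`: it satisfies `du_i = v_i η` and `dv_i = (P'(u_i) / 2) η`.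
(The second equation determines `η` where `v_i` vanishes.) -/
def IsDx (i : Fin n) (η : Ω[CoordRing τ n⁄ℂ]) : Prop :=
  D ℂ (CoordRing τ n) (u τ i) = v τ i • η ∧
    D ℂ (CoordRing τ n) (v τ i) =
      (6 * u τ i ^ 2 - algebraMap ℂ (CoordRing τ n) ((periods τ).g₂ / 2)) • η

end CoordRing

end Elliptic

end EllConf

/-! An algebra homomorphism out of `Xi n` is the same as a choice of images of the generators that
respects the relations. So three things have to be shown: the coefficients of the Kronecker series
are regular, the resulting forms satisfy the quadratic relations, and their de Rham differentials
are the prescribed ones.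

Regularity. The function s = ζ(x - y) - ζ(x) + ζ(y) is half the slope of the line through the points
x and -y of the curve. Liouville's theorem gives s² = ℘(x - y) + ℘(x) + ℘(y) (`slopeFn_sq`).
Differentiation then gives two formulas for s, with denominators ℘(x) - ℘(y) and ℘'(x) - ℘'(y).
These do not vanish together, because (℘, ℘') is injective modulo the lattice
(`sub_mem_lattice_of_eq`), so s is regular (`slopeVal_mem`). Then ℘(x - y) and ℘'(x - y) are
polynomials in s and the coordinates, and for m ≥ 2 every 𝓔_m is a polynomial in ℘ and ℘'
(`exists_eisFn_eq`).

Quadratic relations. They reduce to a scalar Fay identity, since the three products of differences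
of the dx_i agree up to sign (`fay_ι_smul`). Let `fayDiff` be the difference of its two sides, as a
function of a. Its singularities are removable, and translation by a period l multiplies it by
exp(η(l) α), with η the quasi-period of ζ. If it were nonzero, some coefficient of lowest degree in
α would be a nonzero constant C, and the next one would change by η(l) C under translation by l. By
Liouville's theorem η would be linear, which is impossible (`not_quasiPeriod_linear`,
`coeff_fayDiff_eq_zero`). The factors exp(±α ζ) that distinguish the series of the theorem from the
plain Kronecker series form a coboundary and drop out.

Differentials. Identities in the module of Kähler differentials are checked after multiplication by
functions that generate the unit ideal: v_i and P'(u_i)/2, or u_i - u_j and v_i - v_j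
(`eq_zero_of_smul`, `eq_zero_of_sub_smul`). This constructs dx_i, shows that it is unique and
closed, and computes ds (`D_slope`). Modulo multiples of dx_i - dx_j, ds is u_i dx_i - u_j dx_j. As
s enters the series through exp(α s), the coefficient of index m + 1 has as differential, modulo the
same multiples, the coefficient of index m times ds (`D_kron_succ`). The wedge product with dx_i -
dx_j kills the ambiguity. -/

namespace EllConf

/-! ### Liouville's theorem for quasi-periodic functions. -/

section Liouville

open Filter Topology Asymptotics

/-- The union of the lattice with its translate by `b`. -/
def poleSet (L : PeriodPair) (b : ℂ) : Set ℂ := {x | x ∈ L.lattice ∨ x - b ∈ L.lattice}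

variable {L : PeriodPair} {b : ℂ}

theorem eventually_notMem_lattice (L : PeriodPair) (x : ℂ) : ∀ᶠ z in 𝓝[≠] x, z ∉ L.lattice := by
  filter_upwards [self_mem_nhdsWithin,
    mem_nhdsWithin_of_mem_nhds (L.compl_lattice_sdiff_singleton_mem_nhds x)] with z hz hz' h
  exact hz' ⟨h, hz⟩

theorem tendsto_sub_nhdsNE (x a : ℂ) : Tendsto (fun z => z - a) (𝓝[≠] x) (𝓝[≠] (x - a)) := by
  refine tendsto_nhdsWithin_of_tendsto_nhds_of_eventually_within _
    ((continuous_id.sub continuous_const).tendsto x |>.mono_left nhdsWithin_le_nhds) ?_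
  filter_upwards [self_mem_nhdsWithin] with z hz h
  exact hz (sub_left_inj.mp h)

theorem tendsto_add_nhdsNE (x a : ℂ) : Tendsto (fun z => z + a) (𝓝[≠] x) (𝓝[≠] (x + a)) := by
  simpa using tendsto_sub_nhdsNE x (-a)

theorem eventually_notMem_poleSet (L : PeriodPair) (b x : ℂ) :
    ∀ᶠ z in 𝓝[≠] x, z ∉ poleSet L b := by
  filter_upwards [eventually_notMem_lattice L x,
    (tendsto_sub_nhdsNE x b).eventually (eventually_notMem_lattice L (x - b))] with z h1 h2
  rintro (h | h)
  exacts [h1 h, h2 h]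

theorem add_mem_lattice_iff {x l : ℂ} (hl : l ∈ L.lattice) : x + l ∈ L.lattice ↔ x ∈ L.lattice :=
  L.lattice.add_mem_iff_left hl

theorem sub_mem_lattice_comm {x y : ℂ} : x - y ∈ L.lattice ↔ y - x ∈ L.lattice := by
  rw [← neg_mem_iff, neg_sub]

theorem add_mem_poleSet_iff {x l : ℂ} (hl : l ∈ L.lattice) :
    x + l ∈ poleSet L b ↔ x ∈ poleSet L b := by
  simp only [poleSet, Set.mem_ofPred_eq, add_mem_lattice_iff hl, add_sub_right_comm]

theorem poleSet_zero : poleSet L 0 = L.lattice := by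
  ext x; simp [poleSet]

/-- Liouville's theorem for functions that are additively quasi-periodic up to removable
singularities. -/
theorem eq_affine_of_quasiPeriodic (f η : ℂ → ℂ)
    (hd : ∀ x, x ∉ poleSet L b → DifferentiableAt ℂ f x)
    (h0 : f =O[𝓝[≠] 0] (fun _ => (1 : ℝ))) (hb : f =O[𝓝[≠] b] (fun _ => (1 : ℝ)))
    (hp : ∀ l ∈ L.lattice, ∀ x, x ∉ poleSet L b → f (x + l) = f x + η l) :
    ∃ κ c : ℂ, (∀ x, x ∉ poleSet L b → f x = κ * x + c) ∧ ∀ l ∈ L.lattice, η l = κ * l := by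
  have hT := eventually_notMem_poleSet L b
  have htr : ∀ l ∈ L.lattice, ∀ a, f =O[𝓝[≠] a] (fun _ => (1 : ℝ)) →
      f =O[𝓝[≠] (a + l)] (fun _ => (1 : ℝ)) := by
    intro l hl a ha
    have h1 : (fun z => f (z - l) + η l) =O[𝓝[≠] (a + l)] (fun _ => (1 : ℝ)) := by
      refine IsBigO.add ?_ (isBigO_const_const _ one_ne_zero _)
      have := tendsto_sub_nhdsNE (a + l) l
      rw [add_sub_cancel_right] at this
      exact ha.comp_tendsto this
    refine h1.congr' ?_ EventuallyEq.rfl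
    filter_upwards [hT (a + l)] with z hz
    rw [← hp l hl, sub_add_cancel]
    rwa [← add_mem_poleSet_iff hl, sub_add_cancel]
  have hbd : ∀ x, f =O[𝓝[≠] x] (fun _ => (1 : ℝ)) := by
    intro x
    by_cases hx : x ∈ poleSet L b
    · rcases hx with hx | hx
      · simpa using htr x hx 0 h0
      · simpa using htr _ hx b hb
    · exact ((hd x hx).continuousAt.isBigO_one ℝ).mono nhdsWithin_le_nhds
  -- The entire extension of `f`. It ignores the values of `f` on the pole set, which are arbitrary.
  let g : ℂ → ℂ := fun x => limUnder (𝓝[≠] x) f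
  have hev : ∀ x, ∀ᶠ z in 𝓝[≠] x, DifferentiableAt ℂ f z := fun x =>
    (hT x).mono fun z hz => hd z hz
  have hlim : ∀ x, Tendsto f (𝓝[≠] x) (𝓝 (g x)) := by
    intro x
    refine Complex.tendsto_limUnder_of_differentiable_on_punctured_nhds_of_bounded_under (hev x) ?_
    have h1 := ((hbd x).sub (isBigO_const_const (f x) (one_ne_zero (α := ℝ)) _))
    exact h1.isBoundedUnder_le
  have hgf : ∀ x, x ∉ poleSet L b → g x = f x := fun x hx =>
    tendsto_nhds_unique (hlim x) ((hd x hx).continuousAt.tendsto.mono_left nhdsWithin_le_nhds)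
  have hg : Differentiable ℂ g := by
    intro x
    obtain ⟨s, hs, hs'⟩ := (eventually_nhdsWithin_iff.mp (hT x)).exists_mem
    -- Here `f x` may be a junk value; as a constant it does not affect boundedness.
    have hO : (fun z => f z - f x) =o[𝓝[≠] x] fun z => (z - x)⁻¹ :=
      ((hbd x).sub (isBigO_const_const (f x) (one_ne_zero (α := ℝ)) _)).isBoundedUnder_le
        |>.isLittleO_sub_self_inv
    have h1 := Complex.differentiableOn_update_limUnder_of_isLittleO hs
      (fun z hz => (hd z (hs' z hz.1 hz.2)).differentiableWithinAt) hO
    refine (h1.differentiableAt hs).congr_of_eventuallyEq ?_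
    filter_upwards [hs] with z hz
    by_cases hzx : z = x
    · subst hzx; simp [g]
    · rw [Function.update_of_ne hzx]
      exact hgf z (hs' z hz hzx)
  have hgp : ∀ l ∈ L.lattice, ∀ x, g (x + l) = g x + η l := by
    intro l hl x
    refine tendsto_nhds_unique ((hlim (x + l)).comp (tendsto_add_nhdsNE x l)) ?_
    refine ((hlim x).add_const (η l)).congr' ?_
    filter_upwards [hT x] with z hz
    exact (hp l hl z hz).symm
  have hg' : Differentiable ℂ (deriv g) := fun x => (hg.analyticAt x).deriv.differentiableAt
  have hper : ∀ z w, w ∈ L.lattice → deriv g (z + w) = deriv g z := by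
    intro z w hw
    rw [← deriv_comp_add_const, funext (hgp w hw), deriv_add_const]
  -- Differentiation removes the additive constant `η l`, so the derivative is continuous and
  -- periodic, hence bounded, and the classical theorem applies to it.
  have hc : ∀ x, deriv g x = deriv g 0 := fun x =>
    hg'.apply_eq_apply_of_bounded
      (IsZLattice.isCompact_range_of_periodic L.lattice _ hg'.continuous hper).isBounded x 0
  have haff : ∀ x, g x = deriv g 0 * x + g 0 := by
    intro x
    have hd1 : Differentiable ℂ fun x => g x - deriv g 0 * x :=
      hg.sub (differentiable_id.const_mul _)
    have := is_const_of_deriv_eq_zero hd1 (fun x => by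
      have h := ((hg x).hasDerivAt.sub ((hasDerivAt_id x).const_mul (deriv g 0))).deriv
      refine h.trans ?_
      rw [hc x, mul_one, sub_self]) x 0
    simp only [mul_zero, sub_zero] at this
    rw [← this]; ring
  refine ⟨deriv g 0, g 0, fun x hx => by rw [← hgf x hx, haff], fun l hl => ?_⟩
  have := hgp l hl 0
  rw [zero_add, haff l] at this
  linear_combination -this

theorem ω₁_ne_zero (L : PeriodPair) : L.ω₁ ≠ 0 := by
  intro h
  exact L.ω₁_div_two_notMem_lattice (by rw [h, zero_div]; exact zero_mem _)

/-- This is the case of zero quasi-periods: the slope of the affine function then annihilates the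
nonzero period `L.ω₁`. -/
theorem eq_const_of_periodic (f : ℂ → ℂ)
    (hd : ∀ x, x ∉ poleSet L b → DifferentiableAt ℂ f x)
    (h0 : f =O[𝓝[≠] 0] (fun _ => (1 : ℝ))) (hb : f =O[𝓝[≠] b] (fun _ => (1 : ℝ)))
    (hp : ∀ l ∈ L.lattice, ∀ x, x ∉ poleSet L b → f (x + l) = f x) :
    ∃ c : ℂ, ∀ x, x ∉ poleSet L b → f x = c := by
  obtain ⟨κ, c, h1, h2⟩ := eq_affine_of_quasiPeriodic f 0 hd h0 hb
    (fun l hl x hx => by rw [hp l hl x hx, Pi.zero_apply, add_zero])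
  have hκ : κ = 0 :=
    (mul_eq_zero.mp (h2 _ L.ω₁_mem_lattice).symm).resolve_right (ω₁_ne_zero L)
  exact ⟨c, fun x hx => by rw [h1 x hx, hκ, zero_mul, zero_add]⟩

/-- The lattice is countable, and removing a countable set from a real plane leaves it path
connected. This feeds the identity theorem and the arguments with vanishing derivative below. -/
theorem isPreconnected_compl_lattice (L : PeriodPair) : IsPreconnected (L.lattice : Set ℂ)ᶜ := by
  have h : Countable L.lattice := L.latticeEquivProd.injective.countable
  have : (L.lattice : Set ℂ).Countable := Set.countable_coe_iff.mp h
  exact (this.isPathConnected_compl_of_one_lt_rank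
    (by rw [Complex.rank_real_complex]; norm_num)).isConnected.isPreconnected

end Liouville

end EllConf

/-! ### The Weierstrass zeta function and its quasi-periods. -/

namespace EllConf

section Zeta

open Filter Topology

/-- The Weierstrass zeta function, with the linear term `c * x` subtracted. -/
noncomputable def zetaFn (L : PeriodPair) (c x : ℂ) : ℂ :=
  ∑' l : L.lattice, (1 / (x - l) + 1 / l + x / (l : ℂ) ^ 2) - c * x

/-- The Weierstrass zeta function without its pole at the origin. -/
noncomputable def zetaExcept (L : PeriodPair) (x : ℂ) : ℂ :=
  ∑' l : L.lattice, if (l : ℂ) = 0 then 0 else (1 / (x - l) + 1 / l + x / (l : ℂ) ^ 2)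

variable (L : PeriodPair)

/-- Over a common denominator the three terms combine to s² / ((s - l) l²), which is of order |l|⁻³
and therefore summable over a lattice of rank two. -/
theorem zeta_summand_bound (r : ℝ) (hr : 0 < r) (s : ℂ) (hs : ‖s‖ < r) (l : ℂ)
    (h : 2 * r ≤ ‖l‖) :
    ‖1 / (s - l) + 1 / l + s / l ^ 2‖ ≤ 2 * r ^ 2 * ‖l‖ ^ (-3 : ℝ) := by
  have h1 : s ≠ l := by rintro rfl; linarith
  have h2 : 0 < ‖l‖ := by linarith
  have h3 : l ≠ 0 := norm_pos_iff.mp h2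
  have h4 : ‖l‖ / 2 ≤ ‖s - l‖ := by
    rw [norm_sub_rev]
    exact .trans (by linarith) (norm_sub_norm_le l s)
  calc
    _ = ‖s ^ 2 / ((s - l) * l ^ 2)‖ := by
      have : s - l ≠ 0 := sub_ne_zero.mpr h1
      congr 1
      field_simp
      ring
    _ = ‖s‖ ^ 2 / (‖s - l‖ * ‖l‖ ^ 2) := by simp
    _ ≤ r ^ 2 / ((‖l‖ / 2) * ‖l‖ ^ 2) := by gcongr
    _ = 2 * r ^ 2 / ‖l‖ ^ 3 := by field
    _ = _ := by norm_cast

theorem hasSumLocallyUniformly_zetaExcept :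
    HasSumLocallyUniformly (fun (l : L.lattice) (x : ℂ) =>
      if (l : ℂ) = 0 then 0 else (1 / (x - l) + 1 / l + x / (l : ℂ) ^ 2)) (zetaExcept L) := by
  refine L.hasSumLocallyUniformly_aux (u := (2 * · ^ 2 * ‖·‖ ^ (-3 : ℝ))) _
    (fun _ _ => (ZLattice.summable_norm_rpow _ _ (by simp; norm_num)).mul_left _) fun r hr =>
    Filter.eventually_atTop.mpr ⟨2 * r, ?_⟩
  rintro _ h s hs l rfl
  split_ifs
  · simpa using! show 0 ≤ 2 * r ^ 2 * (‖(l : ℂ)‖ ^ 3)⁻¹ by positivity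
  · exact zeta_summand_bound r hr s hs l h

theorem hasDerivAt_zeta_summand {l x : ℂ} (h : x ≠ l) :
    HasDerivAt (fun x => 1 / (x - l) + 1 / l + x / l ^ 2) (-(1 / (x - l) ^ 2 - 1 / l ^ 2)) x := by
  have h' : x - l ≠ 0 := sub_ne_zero.mpr h
  have h1 := (((hasDerivAt_id x).sub_const l).inv h').add_const (1 / l)
  have h2 := h1.add ((hasDerivAt_id x).div_const (l ^ 2))
  refine (h2.congr_deriv ?_).congr_of_eventuallyEq ?_
  · simp only [id]; ring
  · filter_upwards with z; simp

/-- The series is differentiated term by term, and the differentiated series converges locally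
uniformly. The origin is allowed because the summand with a pole there has been removed. -/
theorem hasDerivAt_zetaExcept {x : ℂ} (hx : x ∉ L.lattice ∨ x = 0) :
    HasDerivAt (zetaExcept L) (-L.weierstrassPExcept 0 x) x := by
  have hU := L.isOpen_compl_lattice_sdiff (s := {0})
  have hxU : x ∈ ((L.lattice : Set ℂ) \ {0})ᶜ := by
    rintro ⟨h1, h2⟩
    rcases hx with hx | hx
    exacts [hx h1, h2 hx]
  have hs : ∀ l : L.lattice, ∀ z ∈ ((L.lattice : Set ℂ) \ {0})ᶜ,
      HasDerivAt (fun x => if (l : ℂ) = 0 then 0 else (1 / (x - l) + 1 / l + x / (l : ℂ) ^ 2))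
        (-if (l : ℂ) = 0 then 0 else (1 / (z - l) ^ 2 - 1 / (l : ℂ) ^ 2)) z := by
    intro l z hz
    split_ifs with h
    · simpa using hasDerivAt_const z (0 : ℂ)
    · refine hasDerivAt_zeta_summand ?_
      rintro rfl
      exact hz ⟨l.2, h⟩
  have hsum : ∀ (s : Finset L.lattice), ∀ z ∈ ((L.lattice : Set ℂ) \ {0})ᶜ,
      HasDerivAt (fun x => ∑ l ∈ s,
        if (l : ℂ) = 0 then 0 else (1 / (x - l) + 1 / l + x / (l : ℂ) ^ 2))
        (-∑ l ∈ s, if (l : ℂ) = 0 then 0 else (1 / (z - l) ^ 2 - 1 / (l : ℂ) ^ 2)) z := by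
    intro s z hz
    rw [← Finset.sum_neg_distrib]
    exact HasDerivAt.fun_sum fun l _ => hs l z hz
  have h1 := (hasSumLocallyUniformly_zetaExcept L).tendstoLocallyUniformlyOn
    (s := ((L.lattice : Set ℂ) \ {0})ᶜ)
  have h2 := (L.hasSumLocallyUniformly_weierstrassPExcept 0).hasSum (x := x)
  refine hasDerivAt_of_tendstoLocallyUniformlyOn (g' := -L.weierstrassPExcept 0) hU ?_
    (.of_forall hsum)
    (fun z hz => h1.tendsto_at hz) hxU
  exact ((L.hasSumLocallyUniformly_weierstrassPExcept 0).tendstoLocallyUniformlyOn).neg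

/-- With the convention that division by zero gives zero, the summand of index 0 is exactly 1 / x.
-/
theorem zetaFn_eq (c x : ℂ) : zetaFn L c x = 1 / x + zetaExcept L x - c * x := by
  have h : ∑' l : L.lattice, (1 / (x - l) + 1 / l + x / (l : ℂ) ^ 2) =
      ∑' l : L.lattice, ((if l = (0 : L.lattice) then 1 / x else 0) +
        if (l : ℂ) = 0 then 0 else (1 / (x - l) + 1 / l + x / (l : ℂ) ^ 2)) := by
    refine tsum_congr fun l => ?_
    by_cases hl : (l : ℂ) = 0
    · have : l = 0 := Subtype.ext hl
      simp [this]
    · have : l ≠ 0 := fun h => hl (congrArg Subtype.val h)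
      simp [hl, this]
  rw [zetaFn, h, Summable.tsum_add, tsum_ite_eq, zetaExcept]
  · exact summable_of_hasFiniteSupport ((Set.finite_singleton (0 : L.lattice)).subset (by simp))
  · exact (hasSumLocallyUniformly_zetaExcept L).hasSum.summable (f := fun (l : L.lattice) =>
      if (l : ℂ) = 0 then 0 else (1 / (x - l) + 1 / l + x / (l : ℂ) ^ 2))

theorem zetaExcept_neg (x : ℂ) : zetaExcept L (-x) = -zetaExcept L x := by
  simp only [zetaExcept]
  rw [← (Equiv.neg L.lattice).tsum_eq, ← tsum_neg]
  refine tsum_congr fun l => ?_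
  by_cases hl : (l : ℂ) = 0
  · simp [hl]
  · simp only [Equiv.neg_apply, NegMemClass.coe_neg, neg_eq_zero, hl, if_false]
    rw [show -x - -(l : ℂ) = -(x - l) by ring, div_neg, div_neg, neg_sq, neg_div]
    ring

theorem zetaFn_neg (c x : ℂ) : zetaFn L c (-x) = -zetaFn L c x := by
  rw [zetaFn_eq, zetaFn_eq, zetaExcept_neg]; ring

theorem weierstrassP_eq (x : ℂ) :
    L.weierstrassP x = 1 / x ^ 2 + L.weierstrassPExcept 0 x := by
  have := L.weierstrassPExcept_add 0 x
  simp only [ZeroMemClass.coe_zero, sub_zero] at this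
  rw [← this]; simp [add_comm]

theorem hasDerivAt_zetaFn (c : ℂ) {x : ℂ} (hx : x ∉ L.lattice) :
    HasDerivAt (zetaFn L c) (-L.weierstrassP x - c) x := by
  have hx0 : x ≠ 0 := fun h => hx (h ▸ zero_mem _)
  have h1 := (((hasDerivAt_id x).inv hx0).add (hasDerivAt_zetaExcept L (.inl hx))).sub
    ((hasDerivAt_id x).const_mul c)
  refine (h1.congr_deriv ?_).congr_of_eventuallyEq ?_
  · rw [weierstrassP_eq]; simp only [id]; ring
  · filter_upwards with z
    simp [zetaFn_eq]

variable {L} in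
theorem isOpen_compl_lattice : IsOpen (L.lattice : Set ℂ)ᶜ := L.isClosed_lattice.isOpen_compl

theorem hasDerivAt_weierstrassP {x : ℂ} (hx : x ∉ L.lattice) :
    HasDerivAt L.weierstrassP (L.derivWeierstrassP x) x := by
  have := (L.analyticOnNhd_weierstrassP x hx).differentiableAt.hasDerivAt
  rwa [L.deriv_weierstrassP] at this

/-- The difference has derivative zero, by periodicity of ℘, on the connected complement of the
lattice. -/
theorem exists_zetaFn_add (c : ℂ) (l : ℂ) (hl : l ∈ L.lattice) :
    ∃ e : ℂ, ∀ x, x ∉ L.lattice → zetaFn L c (x + l) = zetaFn L c x + e := by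
  have hd : ∀ x ∈ (L.lattice : Set ℂ)ᶜ,
      HasDerivAt (fun x => zetaFn L c (x + l) - zetaFn L c x) 0 x := by
    intro x hx
    have hx' : x + l ∉ L.lattice := fun h => hx ((add_mem_lattice_iff hl).mp h)
    have h1 := (hasDerivAt_zetaFn L c hx').comp_add_const x l
    refine (h1.sub (hasDerivAt_zetaFn L c hx)).congr_deriv ?_
    have := L.weierstrassP_add_coe x ⟨l, hl⟩
    simp only at this
    rw [this]; ring
  have hx₀ : L.ω₁ / 2 ∈ (L.lattice : Set ℂ)ᶜ := L.ω₁_div_two_notMem_lattice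
  refine ⟨zetaFn L c (L.ω₁ / 2 + l) - zetaFn L c (L.ω₁ / 2), fun x hx => ?_⟩
  have := (isOpen_compl_lattice (L := L)).is_const_of_deriv_eq_zero
    (isPreconnected_compl_lattice L) (fun x hx => (hd x hx).differentiableAt.differentiableWithinAt)
    (fun x hx => (hd x hx).deriv) hx hx₀
  linear_combination this

/-- The quasi-period of the zeta function. -/
noncomputable def quasiPeriod (c l : ℂ) : ℂ := zetaFn L c (L.ω₁ / 2 + l) - zetaFn L c (L.ω₁ / 2)

theorem zetaFn_add {c x l : ℂ} (hl : l ∈ L.lattice) (hx : x ∉ L.lattice) :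
    zetaFn L c (x + l) = zetaFn L c x + quasiPeriod L c l := by
  obtain ⟨e, he⟩ := exists_zetaFn_add L c l hl
  rw [he x hx, quasiPeriod, he _ L.ω₁_div_two_notMem_lattice]; ring

theorem quasiPeriod_neg {c l : ℂ} (hl : l ∈ L.lattice) :
    quasiPeriod L c (-l) = -quasiPeriod L c l := by
  have hx := L.ω₁_div_two_notMem_lattice
  have hx' : L.ω₁ / 2 + l ∉ L.lattice := fun h => hx ((add_mem_lattice_iff hl).mp h)
  have h1 := zetaFn_add L (c := c) hl hx
  have h2 := zetaFn_add L (c := c) (neg_mem hl) hx'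
  rw [add_neg_cancel_right] at h2
  linear_combination -h1 - h2

end Zeta

end EllConf

/-! ### Addition theorem, injectivity of (℘, ℘') modulo the lattice, discriminant, quasi-periods. -/

namespace EllConf

section Addition

open Filter Topology Asymptotics

variable (L : PeriodPair)

theorem tendsto_sq_mul_weierstrassP :
    Tendsto (fun x => x ^ 2 * L.weierstrassP x) (𝓝[≠] 0) (𝓝 1) := by
  have h1 : Tendsto (fun x => 1 + x ^ 2 * L.weierstrassPExcept 0 x) (𝓝[≠] 0) (𝓝 1) := by
    have : ContinuousAt (fun x => 1 + x ^ 2 * L.weierstrassPExcept 0 x) 0 := by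
      have := (L.analyticAt_weierstrassPExcept 0).continuousAt
      fun_prop
    simpa using this.tendsto.mono_left nhdsWithin_le_nhds
  refine h1.congr' ?_
  filter_upwards [self_mem_nhdsWithin] with x (hx : x ≠ 0)
  rw [weierstrassP_eq]; field_simp

/-- For a constant function x² ℘(x) would tend to 0 at the origin, not to 1. -/
theorem exists_weierstrassP_ne (e : ℂ) : ∃ x, x ∉ L.lattice ∧ L.weierstrassP x ≠ e := by
  by_contra! h
  have h1 : Tendsto (fun x : ℂ => x ^ 2 * e) (𝓝[≠] 0) (𝓝 1) := by
    refine (tendsto_sq_mul_weierstrassP L).congr' ?_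
    filter_upwards [eventually_notMem_lattice L 0] with x hx
    rw [h x hx]
  have h2 : Tendsto (fun x : ℂ => x ^ 2 * e) (𝓝[≠] 0) (𝓝 0) := by
    have : ContinuousAt (fun x : ℂ => x ^ 2 * e) 0 := by fun_prop
    simpa using this.tendsto.mono_left nhdsWithin_le_nhds
  exact one_ne_zero (tendsto_nhds_unique h1 h2)

theorem exists_derivWeierstrassP_ne_zero : ∃ x, x ∉ L.lattice ∧ L.derivWeierstrassP x ≠ 0 := by
  by_contra! h
  obtain ⟨x, hx, hne⟩ := exists_weierstrassP_ne L (L.weierstrassP (L.ω₁ / 2))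
  refine hne ((isOpen_compl_lattice (L := L)).is_const_of_deriv_eq_zero
    (isPreconnected_compl_lattice L) L.differentiableOn_weierstrassP
    (fun x hx => ?_) hx L.ω₁_div_two_notMem_lattice)
  rw [L.deriv_weierstrassP]; exact h x hx

/-- Differentiating the cubic equation gives the claim multiplied by ℘'. The factor cancels because
analytic functions on a connected set have no zero divisors and ℘' is not identically zero. -/
theorem hasDerivAt_derivWeierstrassP {x : ℂ} (hx : x ∉ L.lattice) :
    HasDerivAt L.derivWeierstrassP (6 * L.weierstrassP x ^ 2 - L.g₂ / 2) x := by
  have han : AnalyticOnNhd ℂ (fun x => deriv L.derivWeierstrassP x -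
      (6 * L.weierstrassP x ^ 2 - L.g₂ / 2)) (L.lattice : Set ℂ)ᶜ := by
    intro x hx
    have h1 := L.analyticOnNhd_weierstrassP x hx
    have h2 := (L.analyticOnNhd_derivWeierstrassP x hx).deriv
    fun_prop
  have hmul : ∀ z ∈ (L.lattice : Set ℂ)ᶜ, L.derivWeierstrassP z *
      (deriv L.derivWeierstrassP z - (6 * L.weierstrassP z ^ 2 - L.g₂ / 2)) = 0 := by
    intro z hz
    have h1 := hasDerivAt_weierstrassP L hz
    have h2 := (L.analyticOnNhd_derivWeierstrassP z hz).differentiableAt.hasDerivAt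
    have h3 := h2.pow 2
    have h4 := (((h1.pow 3).const_mul 4).sub (h1.const_mul L.g₂)).sub_const L.g₃
    have h5 := h3.unique (h4.congr_of_eventuallyEq (by
      filter_upwards [(isOpen_compl_lattice (L := L)).mem_nhds hz] with w hw
      exact L.derivWeierstrassP_sq w hw))
    norm_num at h5
    linear_combination h5 / 2
  have := (L.analyticOnNhd_derivWeierstrassP).eq_zero_or_eq_zero_of_mul_eq_zero han hmul
    (isPreconnected_compl_lattice L)
  rcases this with h | h
  · obtain ⟨y, hy, hy'⟩ := exists_derivWeierstrassP_ne_zero L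
    exact absurd (h y hy) hy'
  · have h1 := (L.analyticOnNhd_derivWeierstrassP x hx).differentiableAt.hasDerivAt
    rwa [sub_eq_zero.mp (h x hx)] at h1

/-- The slope of the line through two points of the curve, in terms of the zeta function. -/
noncomputable def slopeFn (c x y : ℂ) : ℂ := zetaFn L c (x - y) - zetaFn L c x + zetaFn L c y

/-- The double poles cancel since ε² = 1, the simple pole of 2 ε h(x) / x is removed by h(0) = 0,
and ℘(x) - 1/x² vanishes at the origin. This controls the square of a function with a simple pole of
residue ε. -/
theorem tendsto_sq_sub_weierstrassP {h : ℂ → ℂ} {h' ε : ℂ} (hh : HasDerivAt h h' 0) (h0 : h 0 = 0)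
    (hε : ε ^ 2 = 1) :
    Tendsto (fun x => (ε / x + h x) ^ 2 - L.weierstrassP x) (𝓝[≠] 0) (𝓝 (2 * ε * h')) := by
  have h1 : Tendsto (fun x => 2 * ε * (x⁻¹ * h x) + (h x ^ 2 - L.weierstrassPExcept 0 x)) (𝓝[≠] 0)
      (𝓝 (2 * ε * h' + (h 0 ^ 2 - L.weierstrassPExcept 0 0))) := by
    refine Tendsto.add ?_ ?_
    · have := (hasDerivAt_iff_tendsto_slope.mp hh).const_mul (2 * ε)
      simpa [slope_def_field, h0, div_eq_inv_mul] using this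
    · have h2 := hh.continuousAt
      have h3 := (L.analyticAt_weierstrassPExcept 0).continuousAt
      have : ContinuousAt (fun x => h x ^ 2 - L.weierstrassPExcept 0 x) 0 := by fun_prop
      exact this.tendsto.mono_left nhdsWithin_le_nhds
  rw [h0, L.weierstrassPExcept_zero] at h1
  norm_num at h1
  refine h1.congr' ?_
  filter_upwards [self_mem_nhdsWithin] with x (hx : x ≠ 0)
  rw [weierstrassP_eq]
  field_simp
  linear_combination -hε

theorem weierstrassP_add_mem {x l : ℂ} (hl : l ∈ L.lattice) :
    L.weierstrassP (x + l) = L.weierstrassP x := L.weierstrassP_add_coe x ⟨l, hl⟩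

theorem derivWeierstrassP_add_mem {x l : ℂ} (hl : l ∈ L.lattice) :
    L.derivWeierstrassP (x + l) = L.derivWeierstrassP x := L.derivWeierstrassP_add_coe x ⟨l, hl⟩

theorem hasDerivAt_slopeFn_left {c x y : ℂ} (hx : x ∉ L.lattice) (hxy : x - y ∉ L.lattice) :
    HasDerivAt (fun x => slopeFn L c x y) (L.weierstrassP x - L.weierstrassP (x - y)) x := by
  have h1 := (hasDerivAt_zetaFn L c hxy).comp_sub_const x y
  refine ((h1.sub (hasDerivAt_zetaFn L c hx)).add_const (zetaFn L c y)).congr_deriv ?_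
  ring

theorem hasDerivAt_slopeFn_right {c x y : ℂ} (hy : y ∉ L.lattice) (hxy : x - y ∉ L.lattice) :
    HasDerivAt (fun y => slopeFn L c x y) (L.weierstrassP (x - y) - L.weierstrassP y) y := by
  have h1 := (hasDerivAt_zetaFn L c hxy).comp_const_sub x y
  refine ((h1.sub_const (zetaFn L c x)).add (hasDerivAt_zetaFn L c hy)).congr_deriv ?_
  ring

/-- As a function of x the slope is periodic, because the quasi-periods of ζ(x - y) and ζ(x) cancel.
It has simple poles at 0 and y with residues -1 and 1. So the difference of the two sides is
periodic and bounded near both, hence constant, and its limit at 0 is 0. -/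
theorem slopeFn_sq {c x y : ℂ} (hx : x ∉ L.lattice) (hy : y ∉ L.lattice) (hxy : x - y ∉ L.lattice) :
    slopeFn L c x y ^ 2 = L.weierstrassP (x - y) + L.weierstrassP x + L.weierstrassP y := by
  let f : ℂ → ℂ := fun x => slopeFn L c x y ^ 2 -
    (L.weierstrassP (x - y) + L.weierstrassP x + L.weierstrassP y)
  have hny : -y ∉ L.lattice := by rwa [neg_mem_iff]
  have hlim0 : Tendsto f (𝓝[≠] 0) (𝓝 0) := by
    have hz := (hasDerivAt_zetaFn L c (x := 0 - y) (by rwa [zero_sub])).comp_sub_const 0 y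
    have hh : HasDerivAt (fun x => zetaFn L c (x - y) + zetaFn L c y - (zetaExcept L x - c * x))
        (-L.weierstrassP y) 0 := by
      refine ((hz.add_const _).sub ((hasDerivAt_zetaExcept L (.inr rfl)).sub
        ((hasDerivAt_id 0).const_mul c))).congr_deriv ?_
      rw [L.weierstrassPExcept_zero, zero_sub, L.weierstrassP_neg]; ring
    have h0 : zetaExcept L 0 = 0 := by
      have := zetaExcept_neg L 0
      rw [neg_zero] at this
      linear_combination this / 2
    have h1 := tendsto_sq_sub_weierstrassP L (ε := -1) hh
      (by rw [zero_sub, zetaFn_neg, h0]; ring) (by norm_num)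
    have h2 : Tendsto (fun x => L.weierstrassP (x - y) + L.weierstrassP y) (𝓝[≠] 0)
        (𝓝 (L.weierstrassP (0 - y) + L.weierstrassP y)) := by
      have := ((hasDerivAt_weierstrassP L (x := 0 - y) (by rwa [zero_sub])).comp_sub_const
        0 y).continuousAt
      exact (this.add continuousAt_const).tendsto.mono_left nhdsWithin_le_nhds
    have h3 := h1.sub h2
    rw [zero_sub, L.weierstrassP_neg, show 2 * -1 * -L.weierstrassP y -
      (L.weierstrassP y + L.weierstrassP y) = 0 by ring] at h3
    refine h3.congr fun x => ?_
    simp only [f, slopeFn, zetaFn_eq L c x]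
    ring
  -- Only boundedness near y is needed from this limit; the constant is identified at the origin.
  have hlimy : Tendsto f (𝓝[≠] y) (𝓝 (2 * 1 * (L.weierstrassP y - 0) -
      (L.weierstrassP y + L.weierstrassP y))) := by
    have hz := (hasDerivAt_zetaFn L c (x := 0 + y) (by rwa [zero_add])).comp_add_const 0 y
    have hh : HasDerivAt (fun t => zetaExcept L t - c * t - zetaFn L c (t + y) + zetaFn L c y)
        (L.weierstrassP y - 0) 0 := by
      refine ((((hasDerivAt_zetaExcept L (.inr rfl)).sub
        ((hasDerivAt_id 0).const_mul c)).sub hz).add_const _).congr_deriv ?_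
      rw [L.weierstrassPExcept_zero, zero_add]; ring
    have h0 : zetaExcept L 0 = 0 := by
      have := zetaExcept_neg L 0
      rw [neg_zero] at this
      linear_combination this / 2
    have h1 := tendsto_sq_sub_weierstrassP L (ε := 1) hh
      (by rw [zero_add, h0]; ring) (by norm_num)
    have h2 : Tendsto (fun x => L.weierstrassP x + L.weierstrassP y) (𝓝[≠] y)
        (𝓝 (L.weierstrassP y + L.weierstrassP y)) := by
      have := (hasDerivAt_weierstrassP L hy).continuousAt
      exact (this.add continuousAt_const).tendsto.mono_left nhdsWithin_le_nhds
    have h3 := tendsto_sub_nhdsNE y y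
    rw [sub_self] at h3
    refine ((h1.comp h3).sub h2).congr fun x => ?_
    simp only [f, slopeFn, Function.comp, sub_add_cancel, zetaFn_eq L c (x - y)]
    ring
  obtain ⟨C, hC⟩ := eq_const_of_periodic (L := L) (b := y) f
    (by
      intro x hx
      have hx1 : x ∉ L.lattice := fun h => hx (.inl h)
      have hx2 : x - y ∉ L.lattice := fun h => hx (.inr h)
      exact ((hasDerivAt_slopeFn_left L hx1 hx2).pow 2).differentiableAt.sub
        ((((hasDerivAt_weierstrassP L hx2).comp_sub_const x y).add
          (hasDerivAt_weierstrassP L hx1)).add_const _).differentiableAt)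
    (hlim0.isBigO_one ℝ) (hlimy.isBigO_one ℝ)
    (by
      intro l hl x hx
      have hx1 : x ∉ L.lattice := fun h => hx (.inl h)
      have hx2 : x - y ∉ L.lattice := fun h => hx (.inr h)
      simp only [f, slopeFn]
      rw [add_sub_right_comm, zetaFn_add L hl hx1, zetaFn_add L hl hx2, weierstrassP_add_mem L hl,
        weierstrassP_add_mem L hl]
      ring)
  have hC0 : C = 0 := by
    refine tendsto_nhds_unique (tendsto_const_nhds.congr' ?_) hlim0
    filter_upwards [eventually_notMem_poleSet L y 0] with x hx
    exact (hC x hx).symm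
  have := hC x (by rintro (h | h); exacts [hx h, hxy h])
  rw [hC0] at this
  exact sub_eq_zero.mp this

variable {c x y : ℂ}

theorem eventually_notMem_lattice_nhds {x : ℂ} (hx : x ∉ L.lattice) :
    ∀ᶠ z in 𝓝 x, z ∉ L.lattice := (isOpen_compl_lattice (L := L)).mem_nhds hx

/-- The derivative of `slopeFn_sq` in x. Adding the analogous derivative in y eliminates x - y and
gives the classical slope formula `two_slopeFn_mul_sub`. -/
theorem two_slopeFn_mul_left (hx : x ∉ L.lattice) (hy : y ∉ L.lattice) (hxy : x - y ∉ L.lattice) :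
    2 * slopeFn L c x y * (L.weierstrassP x - L.weierstrassP (x - y)) =
      L.derivWeierstrassP (x - y) + L.derivWeierstrassP x := by
  have h1 := (hasDerivAt_slopeFn_left L (c := c) hx hxy).pow 2
  have h2 := (((hasDerivAt_weierstrassP L hxy).comp_sub_const x y).add
    (hasDerivAt_weierstrassP L hx)).add_const (L.weierstrassP y)
  have hev : ∀ᶠ z in 𝓝 x, z - y ∉ L.lattice :=
    (continuous_sub_right y).continuousAt.eventually (eventually_notMem_lattice_nhds L hxy)
  have h3 := h1.unique (h2.congr_of_eventuallyEq (by
    filter_upwards [hev, eventually_notMem_lattice_nhds L hx] with z hz hz'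
    exact slopeFn_sq L hz' hy hz))
  simpa using h3

theorem two_slopeFn_mul_right (hx : x ∉ L.lattice) (hy : y ∉ L.lattice)
    (hxy : x - y ∉ L.lattice) :
    2 * slopeFn L c x y * (L.weierstrassP (x - y) - L.weierstrassP y) =
      -L.derivWeierstrassP (x - y) + L.derivWeierstrassP y := by
  have h1 := (hasDerivAt_slopeFn_right L (c := c) hy hxy).pow 2
  have h2 := (((hasDerivAt_weierstrassP L hxy).comp_const_sub x y).add_const
    (L.weierstrassP x)).add (hasDerivAt_weierstrassP L hy)
  have hev : ∀ᶠ z in 𝓝 y, x - z ∉ L.lattice :=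
    (continuous_sub_left x).continuousAt.eventually (eventually_notMem_lattice_nhds L hxy)
  have h3 := h1.unique (h2.congr_of_eventuallyEq (by
    filter_upwards [hev, eventually_notMem_lattice_nhds L hy] with z hz hz'
    exact slopeFn_sq L hx hz' hz))
  simpa using h3

theorem two_slopeFn_mul_sub (hx : x ∉ L.lattice) (hy : y ∉ L.lattice) (hxy : x - y ∉ L.lattice) :
    2 * slopeFn L c x y * (L.weierstrassP x - L.weierstrassP y) =
      L.derivWeierstrassP x + L.derivWeierstrassP y := by
  linear_combination two_slopeFn_mul_left L (c := c) hx hy hxy +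
    two_slopeFn_mul_right L (c := c) hx hy hxy

/-- Apply ∂_x + ∂_y to `two_slopeFn_mul_sub`; this operator sends the slope to ℘(x) - ℘(y). The
result still determines the slope where ℘(x) = ℘(y) and ℘'(x) ≠ ℘'(y). -/
theorem two_slopeFn_mul_deriv_sub (hx : x ∉ L.lattice) (hy : y ∉ L.lattice)
    (hxy : x - y ∉ L.lattice) :
    2 * slopeFn L c x y * (L.derivWeierstrassP x - L.derivWeierstrassP y) =
      4 * (L.weierstrassP x ^ 2 + L.weierstrassP x * L.weierstrassP y + L.weierstrassP y ^ 2) -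
        L.g₂ := by
  have hev : ∀ᶠ z in 𝓝 x, z - y ∉ L.lattice :=
    (continuous_sub_right y).continuousAt.eventually (eventually_notMem_lattice_nhds L hxy)
  have hev' : ∀ᶠ z in 𝓝 y, x - z ∉ L.lattice :=
    (continuous_sub_left x).continuousAt.eventually (eventually_notMem_lattice_nhds L hxy)
  have h1 := ((hasDerivAt_slopeFn_left L (c := c) hx hxy).const_mul 2).mul
    ((hasDerivAt_weierstrassP L hx).sub_const (L.weierstrassP y))
  have h2 := (hasDerivAt_derivWeierstrassP L hx).add_const (L.derivWeierstrassP y)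
  have h3 := h1.unique (h2.congr_of_eventuallyEq (by
    filter_upwards [hev, eventually_notMem_lattice_nhds L hx] with z hz hz'
    exact two_slopeFn_mul_sub L hz' hy hz))
  have h4 := ((hasDerivAt_slopeFn_right L (c := c) hy hxy).const_mul 2).mul
    ((hasDerivAt_weierstrassP L hy).const_sub (L.weierstrassP x))
  have h5 := (hasDerivAt_derivWeierstrassP L hy).const_add (L.derivWeierstrassP x)
  have h6 := h4.unique (h5.congr_of_eventuallyEq (by
    filter_upwards [hev', eventually_notMem_lattice_nhds L hy] with z hz hz'
    exact two_slopeFn_mul_sub L hx hz' hz))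
  linear_combination h3 + h6

/-- Under these hypotheses u = ℘(a) is a double root of the cubic, so ℘'² = 4 (℘ - u)² (℘ + 2u). If
℘' vanishes to finite order k at a, then ℘ - u vanishes to order k + 1, and 2k = 2(k + 1) + m is
impossible. If the order is infinite, ℘' vanishes identically, which is false. -/
theorem not_double_zero {a : ℂ} (ha : a ∉ L.lattice) (h1 : L.derivWeierstrassP a = 0)
    (h2 : 12 * L.weierstrassP a ^ 2 - L.g₂ = 0) : False := by
  have hP := L.analyticOnNhd_weierstrassP a ha
  have hP' := L.analyticOnNhd_derivWeierstrassP a ha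
  have e1 := hP.analyticOrderAt_deriv_add_one
  rw [L.deriv_weierstrassP] at e1
  have hrel := L.derivWeierstrassP_sq a ha
  set u := L.weierstrassP a with hu
  have hQ : AnalyticAt ℂ (fun z => L.weierstrassP z - u) a := by fun_prop
  have hR : AnalyticAt ℂ (fun z => 4 * (L.weierstrassP z + 2 * u)) a := by fun_prop
  have e2 : analyticOrderAt (L.derivWeierstrassP ^ 2) a =
      analyticOrderAt ((fun z => L.weierstrassP z - u) ^ 2 *
        fun z => 4 * (L.weierstrassP z + 2 * u)) a := by
    refine analyticOrderAt_congr ?_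
    filter_upwards [eventually_notMem_lattice_nhds L ha] with z hz
    simp only [Pi.pow_apply, Pi.mul_apply]
    rw [L.derivWeierstrassP_sq z hz]
    rw [h1] at hrel
    linear_combination (L.weierstrassP z - u) * h2 - hrel
  rw [analyticOrderAt_mul (hQ.pow 2) hR, analyticOrderAt_pow hP', analyticOrderAt_pow hQ, ← e1]
    at e2
  have h3 : analyticOrderAt L.derivWeierstrassP a = ⊤ := by
    generalize analyticOrderAt L.derivWeierstrassP a = k at e2
    generalize analyticOrderAt (fun z => 4 * (L.weierstrassP z + 2 * u)) a = m at e2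
    cases k with
    | top => rfl
    | coe k =>
      cases m with
      | top =>
        rw [add_top, nsmul_eq_mul] at e2
        exact absurd e2 (by exact_mod_cast ENat.natCast_ne_top (2 * k))
      | coe m =>
        exfalso
        rw [nsmul_eq_mul, nsmul_eq_mul] at e2
        norm_cast at e2
        omega
  obtain ⟨y, hy, hy'⟩ := exists_derivWeierstrassP_ne_zero L
  exact hy' (L.analyticOnNhd_derivWeierstrassP.eqOn_zero_of_preconnected_of_eventuallyEq_zero
    (isPreconnected_compl_lattice L) ha (analyticOrderAt_eq_top.mp h3) hy)

/-- Otherwise both slope formulas hold with vanishing left sides, and they say that ℘(a) is a double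
root of the cubic with ℘'(a) = 0. -/
theorem sub_mem_lattice_of_eq {a b : ℂ} (ha : a ∉ L.lattice) (hb : b ∉ L.lattice)
    (h1 : L.weierstrassP a = L.weierstrassP b)
    (h2 : L.derivWeierstrassP a = L.derivWeierstrassP b) : a - b ∈ L.lattice := by
  by_contra hab
  have e1 := two_slopeFn_mul_sub L (c := 0) ha hb hab
  have e2 := two_slopeFn_mul_deriv_sub L (c := 0) ha hb hab
  rw [← h1, ← h2, sub_self, mul_zero] at e1
  rw [← h1, ← h2, sub_self, mul_zero] at e2
  refine not_double_zero L ha ?_ ?_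
  · linear_combination -e1 / 2
  · linear_combination -e2

theorem sub_or_add_mem_lattice_of_eq {a b : ℂ} (ha : a ∉ L.lattice) (hb : b ∉ L.lattice)
    (h1 : L.weierstrassP a = L.weierstrassP b) : a - b ∈ L.lattice ∨ a + b ∈ L.lattice := by
  have e1 := L.derivWeierstrassP_sq a ha
  rw [h1, ← L.derivWeierstrassP_sq b hb] at e1
  rcases sq_eq_sq_iff_eq_or_eq_neg.mp e1 with h | h
  · exact .inl (sub_mem_lattice_of_eq L ha hb h1 h)
  · right
    have := sub_mem_lattice_of_eq L ha (b := -b) (by rwa [neg_mem_iff])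
      (by rw [L.weierstrassP_neg, h1]) (by rw [L.derivWeierstrassP_neg, h])
    rwa [sub_neg_eq_add] at this

/-- If the value e were omitted, 1 / (℘ - e) would be elliptic without poles and tend to 0 at the
origin, hence be zero; but an inverse of a nonzero number is not zero. -/
theorem exists_weierstrassP_eq (e : ℂ) : ∃ x, x ∉ L.lattice ∧ L.weierstrassP x = e := by
  by_contra! h
  let f : ℂ → ℂ := fun x => (L.weierstrassP x - e)⁻¹
  have hlim : Tendsto f (𝓝[≠] 0) (𝓝 0) := by
    have h1 : Tendsto (fun x : ℂ => x ^ 2) (𝓝[≠] 0) (𝓝 0) := by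
      have : ContinuousAt (fun x : ℂ => x ^ 2) 0 := by fun_prop
      simpa using this.tendsto.mono_left nhdsWithin_le_nhds
    have h2 : Tendsto (fun x : ℂ => x ^ 2 * L.weierstrassP x - x ^ 2 * e) (𝓝[≠] 0)
        (𝓝 (1 - 0 * e)) := (tendsto_sq_mul_weierstrassP L).sub (h1.mul_const e)
    have h3 := h1.div h2 (by simp)
    rw [zero_div] at h3
    refine h3.congr' ?_
    filter_upwards [self_mem_nhdsWithin] with x (hx : x ≠ 0)
    simp only [f, Pi.div_apply]
    rw [← mul_sub, div_mul_eq_div_div, div_self (pow_ne_zero 2 hx), one_div]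
  obtain ⟨C, hC⟩ := eq_const_of_periodic (L := L) (b := 0) f
    (by
      intro x hx
      rw [poleSet_zero] at hx
      exact ((hasDerivAt_weierstrassP L hx).sub_const e).differentiableAt.inv
        (sub_ne_zero.mpr (h x hx)))
    (hlim.isBigO_one ℝ) (hlim.isBigO_one ℝ)
    (by
      intro l hl x hx
      simp only [f, weierstrassP_add_mem L hl])
  rw [poleSet_zero] at hC
  have hC0 : C = 0 := by
    refine tendsto_nhds_unique (tendsto_const_nhds.congr' ?_) hlim
    filter_upwards [eventually_notMem_lattice L 0] with x hx
    exact (hC x hx).symm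
  have hx := L.ω₁_div_two_notMem_lattice
  have := hC _ hx
  rw [hC0] at this
  exact sub_ne_zero.mpr (h _ hx) (inv_eq_zero.mp this)

/-- A vanishing discriminant produces a double root of the cubic; it is a value of ℘, which
`not_double_zero` excludes. -/
theorem discriminant_ne_zero : L.g₂ ^ 3 - 27 * L.g₃ ^ 2 ≠ 0 := by
  intro hΔ
  obtain ⟨e, he1, he2⟩ : ∃ e : ℂ, 12 * e ^ 2 - L.g₂ = 0 ∧ 4 * e ^ 3 - L.g₂ * e - L.g₃ = 0 := by
    by_cases hg : L.g₂ = 0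
    · have h3 : L.g₃ = 0 := by
        rw [hg] at hΔ
        have : L.g₃ ^ 2 = 0 := by linear_combination -hΔ / 27
        exact pow_eq_zero_iff (two_ne_zero) |>.mp this
      exact ⟨0, by simp [hg], by simp [h3]⟩
    -- The double root: eliminating e³ from the cubic by 12 e² = g₂ leaves a linear equation for e.
    · refine ⟨-3 * L.g₃ / (2 * L.g₂), ?_, ?_⟩
      · field_simp
        linear_combination -4 * hΔ
      · field_simp
        linear_combination 4 * L.g₃ * hΔ
  obtain ⟨x, hx, rfl⟩ := exists_weierstrassP_eq L e
  have h := L.derivWeierstrassP_sq x hx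
  exact not_double_zero L hx (pow_eq_zero_iff (two_ne_zero) |>.mp (h.trans he2)) he1

/-- This takes the place of the Legendre relation. If η were linear, f = ζ - κx would be elliptic
with a single simple pole, and f² - ℘ would be a constant C. Being odd and periodic, f vanishes at
the half periods ω₁/2 and ω₂/2, so ℘ takes the same value -C at both. But ℘ separates points up to
sign modulo the lattice. -/
theorem not_quasiPeriod_linear (c κ : ℂ) (h : ∀ l ∈ L.lattice, quasiPeriod L c l = κ * l) :
    False := by
  let f : ℂ → ℂ := fun x => zetaFn L c x - κ * x
  have hper : ∀ l ∈ L.lattice, ∀ x, x ∉ L.lattice → f (x + l) = f x := by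
    intro l hl x hx
    simp only [f]
    rw [zetaFn_add L hl hx, h l hl]; ring
  have h0 : zetaExcept L 0 = 0 := by
    have := zetaExcept_neg L 0
    rw [neg_zero] at this
    linear_combination this / 2
  have hlim : ∃ m, Tendsto (fun x => f x ^ 2 - L.weierstrassP x) (𝓝[≠] 0) (𝓝 m) := by
    have hh : HasDerivAt (fun x => zetaExcept L x - (c + κ) * x) _ 0 :=
      (hasDerivAt_zetaExcept L (.inr rfl)).sub ((hasDerivAt_id 0).const_mul (c + κ))
    refine ⟨_, (tendsto_sq_sub_weierstrassP L (ε := 1) hh (by rw [h0]; ring)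
      (by norm_num)).congr fun x => ?_⟩
    simp only [f, zetaFn_eq]; ring
  obtain ⟨m, hlim⟩ := hlim
  obtain ⟨C, hC⟩ := eq_const_of_periodic (L := L) (b := 0) (fun x => f x ^ 2 - L.weierstrassP x)
    (by
      intro x hx
      rw [poleSet_zero] at hx
      exact (((hasDerivAt_zetaFn L c hx).sub ((hasDerivAt_id x).const_mul κ)).pow 2
        |>.sub (hasDerivAt_weierstrassP L hx)).differentiableAt)
    (hlim.isBigO_one ℝ) (hlim.isBigO_one ℝ)
    (by
      intro l hl x hx
      rw [poleSet_zero] at hx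
      simp only [hper l hl x hx, weierstrassP_add_mem L hl])
  rw [poleSet_zero] at hC
  have hhalf : ∀ l ∈ L.lattice, l / 2 ∉ L.lattice → L.weierstrassP (l / 2) = -C := by
    intro l hl hl2
    have h1 := hper l hl (-(l / 2)) (by rwa [neg_mem_iff])
    rw [show -(l / 2) + l = l / 2 by ring] at h1
    have h2 : f (l / 2) = 0 := by
      have h3 : f (-(l / 2)) = -f (l / 2) := by simp only [f, zetaFn_neg]; ring
      linear_combination (h1 + h3) / 2
    have h4 := hC _ hl2
    simp only [h2] at h4
    linear_combination -h4
  have e : L.weierstrassP (L.ω₁ / 2) = L.weierstrassP (L.ω₂ / 2) :=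
    (hhalf _ L.ω₁_mem_lattice L.ω₁_div_two_notMem_lattice).trans
      (hhalf _ L.ω₂_mem_lattice L.ω₂_div_two_notMem_lattice).symm
  rcases sub_or_add_mem_lattice_of_eq L L.ω₁_div_two_notMem_lattice L.ω₂_div_two_notMem_lattice e
    with h1 | h1
  · have := PeriodPair.mul_ω₁_add_mul_ω₂_mem_lattice (L := L) (α := 1 / 2) (β := -1 / 2)
    have h2 := (this.mp (by convert h1 using 1; push_cast; ring)).1
    norm_num at h2
  · have := PeriodPair.mul_ω₁_add_mul_ω₂_mem_lattice (L := L) (α := 1 / 2) (β := 1 / 2)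
    have h2 := (this.mp (by convert h1 using 1; push_cast; ring)).1
    norm_num at h2

end Addition

end EllConf

/-! ### The Eisenstein functions 𝓔_m as polynomials in ℘ and ℘'. -/

namespace EllConf

section Eisenstein

open Filter Topology
open scoped Nat

variable (L : PeriodPair)

/-- The Eisenstein functions, with `𝓔_1 = ζ`. -/
noncomputable def eisFn (c : ℂ) (m : ℕ) (x : ℂ) : ℂ :=
  if m = 1 then zetaFn L c x else ∑' l : L.lattice, (1 / (x + l) ^ m - 1 / (l : ℂ) ^ m)

/-- The Eisenstein functions without their pole at the origin. -/
noncomputable def eisExcept (c : ℂ) (m : ℕ) (x : ℂ) : ℂ :=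
  if m = 1 then zetaExcept L x - c * x
  else ∑' l : L.lattice, if (l : ℂ) = 0 then 0 else (1 / (x + l) ^ m - 1 / (l : ℂ) ^ m)

/-- For |l| ≥ 2r and |s| < r one has |s + l| ≥ |l| / 2, so each of the two terms is separately of
order |l|⁻ᵐ, which is summable for m ≥ 3. The case m = 2 is taken from ℘. -/
theorem hasSumLocallyUniformly_eisExcept {m : ℕ} (hm : 3 ≤ m) :
    HasSumLocallyUniformly (fun (l : L.lattice) (x : ℂ) =>
      if (l : ℂ) = 0 then 0 else (1 / (x + l) ^ m - 1 / (l : ℂ) ^ m))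
      (fun x => ∑' l : L.lattice,
        if (l : ℂ) = 0 then 0 else (1 / (x + l) ^ m - 1 / (l : ℂ) ^ m)) := by
  refine L.hasSumLocallyUniformly_aux (u := fun _ l => (2 ^ m + 1) * ‖l‖ ^ (-m : ℝ)) _
    (fun _ _ => (ZLattice.summable_norm_rpow _ _ (by
      simp only [PeriodPair.finrank_lattice]
      have : (3 : ℝ) ≤ m := by exact_mod_cast hm
      push_cast
      linarith)).mul_left _) fun r hr =>
    Filter.eventually_atTop.mpr ⟨2 * r, ?_⟩
  rintro _ h s hs l rfl
  change 2 * r ≤ ‖(l : ℂ)‖ at h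
  change _ ≤ (2 ^ m + 1) * ‖(l : ℂ)‖ ^ (-m : ℝ)
  have h2 : 0 < ‖(l : ℂ)‖ := by linarith
  split_ifs
  · simp only [norm_zero]; positivity
  have h4 : ‖(l : ℂ)‖ / 2 ≤ ‖s + l‖ := by
    have := norm_sub_norm_le (l : ℂ) (-s)
    rw [sub_neg_eq_add, norm_neg, add_comm] at this
    linarith
  refine (norm_sub_le _ _).trans ?_
  rw [add_mul, one_mul, Real.rpow_neg h2.le, Real.rpow_natCast]
  refine add_le_add ?_ (by simp)
  simp only [norm_div, norm_one, norm_pow]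
  calc 1 / ‖s + l‖ ^ m ≤ 1 / (‖(l : ℂ)‖ / 2) ^ m := by gcongr
    _ = _ := by rw [div_pow]; field

theorem weierstrassPExcept_zero_neg (x : ℂ) :
    L.weierstrassPExcept 0 (-x) = L.weierstrassPExcept 0 x := by
  rw [L.weierstrassPExcept_neg, neg_zero]

theorem eisExcept_two (c x : ℂ) : eisExcept L c 2 x = L.weierstrassPExcept 0 x := by
  rw [← weierstrassPExcept_zero_neg, eisExcept, if_neg (by norm_num), PeriodPair.weierstrassPExcept]
  refine tsum_congr fun l => ?_
  split_ifs with h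
  · rfl
  · rw [show -x - (l : ℂ) = -(x + l) by ring, neg_sq]

theorem differentiableAt_eisExcept (c : ℂ) {m : ℕ} (hm : 1 ≤ m) {x : ℂ}
    (hx : x ∉ L.lattice ∨ x = 0) : DifferentiableAt ℂ (eisExcept L c m) x := by
  rcases (by omega : m = 1 ∨ m = 2 ∨ 3 ≤ m) with rfl | rfl | hm
  · have : eisExcept L c 1 = fun x => zetaExcept L x - c * x := by
      funext x; rw [eisExcept, if_pos rfl]
    rw [this]
    exact ((hasDerivAt_zetaExcept L hx).sub ((hasDerivAt_id x).const_mul c)).differentiableAt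
  · rw [funext (eisExcept_two L c)]
    have hxU : x ∈ ((L.lattice : Set ℂ) \ {0})ᶜ := by
      rintro ⟨h1, h2⟩
      rcases hx with hx | hx
      exacts [hx h1, h2 hx]
    exact (L.analyticOnNhd_weierstrassPExcept 0 x hxU).differentiableAt
  · have h1 : eisExcept L c m = fun x => ∑' l : L.lattice,
        if (l : ℂ) = 0 then 0 else (1 / (x + l) ^ m - 1 / (l : ℂ) ^ m) := by
      funext x; rw [eisExcept, if_neg (by omega)]
    have hxU : x ∈ ((L.lattice : Set ℂ) \ {0})ᶜ := by
      rintro ⟨h1, h2⟩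
      rcases hx with hx | hx
      exacts [hx h1, h2 hx]
    rw [h1]
    refine ((hasSumLocallyUniformly_eisExcept L hm).hasSumLocallyUniformlyOn.differentiableOn
      (.of_forall fun s => .fun_sum fun l _ => ?_)
      (L.isOpen_compl_lattice_sdiff (s := {0}))).differentiableAt
      ((L.isOpen_compl_lattice_sdiff (s := {0})).mem_nhds hxU)
    split_ifs with hl
    · simp
    · refine .sub (.div (by fun_prop) (by fun_prop) fun z hz => ?_) (by fun_prop)
      refine pow_ne_zero _ fun h => hz ?_
      have : z = -l := eq_neg_of_add_eq_zero_left h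
      rw [this]
      exact ⟨neg_mem l.2, by simpa using hl⟩

theorem eisExcept_zero (c : ℂ) {m : ℕ} : eisExcept L c m 0 = 0 := by
  rw [eisExcept]
  split_ifs
  · have := zetaExcept_neg L 0
    rw [neg_zero] at this
    linear_combination this / 2
  · simp

theorem eisFn_two (c x : ℂ) : eisFn L c 2 x = L.weierstrassP x := by
  rw [← L.weierstrassP_neg, eisFn, if_neg (by norm_num), PeriodPair.weierstrassP]
  refine tsum_congr fun l => ?_
  rw [show -x - (l : ℂ) = -(x + l) by ring, neg_sq]

theorem eisFn_eq (c : ℂ) {m : ℕ} (hm : 1 ≤ m) (x : ℂ) :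
    eisFn L c m x = 1 / x ^ m + eisExcept L c m x := by
  rcases (by omega : m = 1 ∨ m = 2 ∨ 3 ≤ m) with rfl | rfl | hm
  · rw [eisFn, eisExcept, if_pos rfl, if_pos rfl, zetaFn_eq, pow_one]; ring
  · rw [eisFn_two, eisExcept_two, weierstrassP_eq]
  have h : ∑' l : L.lattice, (1 / (x + l) ^ m - 1 / (l : ℂ) ^ m) =
      ∑' l : L.lattice, ((if l = (0 : L.lattice) then 1 / x ^ m else 0) +
        if (l : ℂ) = 0 then 0 else (1 / (x + l) ^ m - 1 / (l : ℂ) ^ m)) := by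
    refine tsum_congr fun l => ?_
    by_cases hl : (l : ℂ) = 0
    · have : l = 0 := Subtype.ext hl
      simp [this]; omega
    · have : l ≠ 0 := fun h => hl (congrArg Subtype.val h)
      simp [hl, this]
  rw [eisFn, eisExcept, if_neg (by omega), if_neg (by omega), h, Summable.tsum_add, tsum_ite_eq]
  · exact summable_of_hasFiniteSupport ((Set.finite_singleton (0 : L.lattice)).subset (by simp))
  · exact (hasSumLocallyUniformly_eisExcept L hm).hasSum.summable (f := fun (l : L.lattice) =>
      if (l : ℂ) = 0 then 0 else (1 / (x + l) ^ m - 1 / (l : ℂ) ^ m))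

theorem differentiableAt_eisFn (c : ℂ) {m : ℕ} (hm : 1 ≤ m) {x : ℂ} (hx : x ∉ L.lattice) :
    DifferentiableAt ℂ (eisFn L c m) x := by
  rw [funext (eisFn_eq L c hm)]
  have hx0 : x ≠ 0 := fun h => hx (h ▸ zero_mem _)
  have := differentiableAt_eisExcept L c hm (.inl hx)
  have h2 : x ^ m ≠ 0 := pow_ne_zero _ hx0
  fun_prop (disch := assumption)

theorem eisFn_neg (c : ℂ) (m : ℕ) (x : ℂ) : eisFn L c m (-x) = (-1) ^ m * eisFn L c m x := by
  rw [eisFn, eisFn]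
  split_ifs with h
  · rw [h, zetaFn_neg]; ring
  · rw [← (Equiv.neg L.lattice).tsum_eq, ← tsum_mul_left]
    refine tsum_congr fun l => ?_
    have h1 : ((-1 : ℂ) ^ m)⁻¹ = (-1) ^ m := by
      rcases neg_one_pow_eq_or ℂ m with h | h <;> rw [h] <;> norm_num
    simp only [Equiv.neg_apply, NegMemClass.coe_neg]
    rw [show -x + -(l : ℂ) = -(x + l) by ring, neg_pow, neg_pow (l : ℂ), one_div, one_div, mul_inv,
      mul_inv, h1]
    ring

/-- The derivation of polynomials in `℘`, `℘'`. -/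
theorem exists_hasDerivAt_eval (p : MvPolynomial (Fin 2) ℂ) :
    ∃ q : MvPolynomial (Fin 2) ℂ, ∀ x, x ∉ L.lattice →
      HasDerivAt (fun x => MvPolynomial.eval ![L.weierstrassP x, L.derivWeierstrassP x] p)
        (MvPolynomial.eval ![L.weierstrassP x, L.derivWeierstrassP x] q) x := by
  induction p using MvPolynomial.induction_on with
  | C a => exact ⟨0, fun x _ => by simpa using hasDerivAt_const x a⟩
  | add p q hp hq =>
    obtain ⟨p', hp⟩ := hp
    obtain ⟨q', hq⟩ := hq
    exact ⟨p' + q', fun x hx => by simpa only [map_add] using (hp x hx).fun_add (hq x hx)⟩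
  | mul_X p i hp =>
    obtain ⟨p', hp⟩ := hp
    obtain rfl | rfl : i = 0 ∨ i = 1 := by fin_cases i <;> simp
    · refine ⟨p' * .X 0 + p * .X 1, fun x hx => ?_⟩
      simpa using (hp x hx).fun_mul (hasDerivAt_weierstrassP L hx)
    · refine ⟨p' * .X 1 + p * (6 * .X 0 ^ 2 - .C (L.g₂ / 2)), fun x hx => ?_⟩
      simpa using (hp x hx).fun_mul (hasDerivAt_derivWeierstrassP L hx)

theorem exists_iteratedDeriv_weierstrassP_eq (k : ℕ) :
    ∃ q : MvPolynomial (Fin 2) ℂ, ∀ x, x ∉ L.lattice → iteratedDeriv k L.weierstrassP x =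
      MvPolynomial.eval ![L.weierstrassP x, L.derivWeierstrassP x] q := by
  induction k with
  | zero => exact ⟨.X 0, fun x _ => by simp⟩
  | succ k ih =>
    obtain ⟨q, hq⟩ := ih
    obtain ⟨q', hq'⟩ := exists_hasDerivAt_eval L q
    refine ⟨q', fun x hx => ?_⟩
    rw [iteratedDeriv_succ]
    refine ((hq' x hx).congr_of_eventuallyEq ?_).deriv
    filter_upwards [eventually_notMem_lattice_nhds L hx] with z hz
    exact hq z hz

/-- For m ≥ 3 the function is, up to a factor and an additive constant, the derivative of order m -
2 of ℘, and polynomials in ℘ and ℘' are closed under differentiation. -/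
theorem exists_eisFn_eq (c : ℂ) {m : ℕ} (hm : 2 ≤ m) :
    ∃ q : MvPolynomial (Fin 2) ℂ, ∀ x, x ∉ L.lattice → eisFn L c m x =
      MvPolynomial.eval ![L.weierstrassP x, L.derivWeierstrassP x] q := by
  rcases hm.eq_or_lt with rfl | hm
  · exact ⟨.X 0, fun x _ => by simp [eisFn_two]⟩
  obtain ⟨k, rfl⟩ : ∃ k, m = k + 1 + 2 := ⟨m - 3, by omega⟩
  obtain ⟨q, hq⟩ := exists_iteratedDeriv_weierstrassP_eq L (k + 1)
  -- With m = k + 3, the factorial (m - 1)! comes from differentiating 1/x² exactly m - 2 times, the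
  -- sign from passing from (l - x)⁻ᵐ to (x + l)⁻ᵐ, and the Eisenstein sum is the subtracted ∑ l⁻ᵐ.
  refine ⟨.C ((-1) ^ (k + 1 + 2) / (k + 1 + 1)!) * q - .C (L.G (k + 1 + 2)), fun x hx => ?_⟩
  have h1 := L.iteratedDeriv_weierstrassPExcept_self x (n := k + 1)
  rw [L.weierstrassPExcept_of_notMem x hx, if_neg (by omega), hq x hx] at h1
  have hf : ((k + 1 + 1)! : ℂ) ≠ 0 := by exact_mod_cast Nat.factorial_ne_zero _
  simp only [map_sub, map_mul, MvPolynomial.eval_C]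
  rw [h1, div_mul_eq_mul_div, mul_left_comm, mul_div_cancel_left₀ _ hf, eisFn, if_neg (by omega),
    PeriodPair.sumInvPow, PeriodPair.G, ← tsum_mul_left]
  have s1 := L.hasSum_sumInvPow x (r := k + 1 + 2) (by omega)
  have s2 := L.hasSum_sumInvPow 0 (r := k + 1 + 2) (by omega)
  simp only [sub_zero] at s2
  have h2 : ((-1 : ℂ) ^ (k + 1 + 2))⁻¹ = (-1) ^ (k + 1 + 2) := by
    rcases neg_one_pow_eq_or ℂ (k + 1 + 2) with h | h <;> rw [h] <;> norm_num
  have s3 : HasSum (fun l : L.lattice => ((-1 : ℂ) ^ (k + 1 + 2)) * (((l : ℂ) - x) ^ (k + 1 + 2))⁻¹)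
      (∑' l : L.lattice, 1 / (x + l) ^ (k + 1 + 2)) := by
    have h3 : (fun l : L.lattice => ((-1 : ℂ) ^ (k + 1 + 2)) * (((l : ℂ) - x) ^ (k + 1 + 2))⁻¹) =
        (fun l : L.lattice => 1 / (x + l) ^ (k + 1 + 2)) ∘ Equiv.neg L.lattice := by
      funext l
      simp only [Function.comp, Equiv.neg_apply, NegMemClass.coe_neg]
      rw [show x + -(l : ℂ) = -(l - x) by ring, neg_pow ((l : ℂ) - x), one_div, mul_inv, h2]
    rw [← (Equiv.neg L.lattice).tsum_eq]
    rw [h3]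
    exact (h3 ▸ s1.summable.mul_left _).hasSum
  rw [s3.tsum_eq]
  have s4 : Summable (fun l : L.lattice => 1 / (x + l) ^ (k + 1 + 2)) := by
    rw [← (Equiv.neg L.lattice).summable_iff]
    refine (s3.summable).congr fun l => ?_
    simp only [Function.comp, Equiv.neg_apply, NegMemClass.coe_neg]
    rw [show x + -(l : ℂ) = -(l - x) by ring, neg_pow ((l : ℂ) - x), one_div, mul_inv, h2]
  rw [Summable.tsum_sub s4 (by simpa using s2.summable)]
  simp

theorem eisFn_add (c : ℂ) {m : ℕ} (hm : 2 ≤ m) {x l : ℂ} (hl : l ∈ L.lattice)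
    (hx : x ∉ L.lattice) : eisFn L c m (x + l) = eisFn L c m x := by
  obtain ⟨q, hq⟩ := exists_eisFn_eq L c hm
  rw [hq _ hx, hq _ fun h => hx ((add_mem_lattice_iff hl).mp h), weierstrassP_add_mem L hl,
    derivWeierstrassP_add_mem L hl]

end Eisenstein

end EllConf

/-! ### Formal exponentials of power series. -/

namespace EllConf

section FormalExp

open PowerSeries
open scoped Nat

/-- The exponential of the power series `∑_{m ≥ 1} l m t^m`. -/
noncomputable def expS (l : ℕ → ℂ) : PowerSeries ℂ :=
  (PowerSeries.exp ℂ).subst (PowerSeries.mk fun m => if m = 0 then 0 else l m)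

variable (l : ℕ → ℂ)

theorem hasSubst_log : HasSubst (PowerSeries.mk fun m => if m = 0 then 0 else l m) :=
  HasSubst.of_constantCoeff_zero' (by simp [← coeff_zero_eq_constantCoeff_apply])

/-- Together with the constant coefficient 1, this differential equation characterises the
exponential. The identities below are obtained from it instead of from the substitution. -/
theorem derivative_expS : d⁄dX ℂ (expS l) = PowerSeries.mk (fun m => (m + 1) * l (m + 1)) *
    expS l := by
  rw [expS, derivative_subst (hasSubst_log l), derivative_exp, mul_comm]
  congr 1
  ext m
  simp [coeff_derivative, mul_comm]

theorem coeff_zero_expS : coeff 0 (expS l) = 1 := by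
  rw [expS, coeff_subst' (hasSubst_log l), finsum_eq_single _ 0]
  · simp
  · intro n hn
    have : coeff 0 ((PowerSeries.mk fun m => if m = 0 then 0 else l m) ^ n) = 0 := by
      rw [coeff_zero_eq_constantCoeff_apply, map_pow, ← coeff_zero_eq_constantCoeff_apply]
      simp [hn]
    rw [this, smul_zero]

theorem coeff_succ_expS (n : ℕ) : coeff (n + 1) (expS l) =
    (∑ p ∈ Finset.HasAntidiagonal.antidiagonal n, ((p.1 + 1) * l (p.1 + 1)) * coeff p.2 (expS l)) / (n + 1) := by
  have h := congrArg (coeff n) (derivative_expS l)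
  rw [coeff_derivative, coeff_mul] at h
  simp only [coeff_mk] at h
  rw [← h, mul_div_cancel_right₀]
  exact Nat.cast_add_one_ne_zero n

/-- The coefficient of index n of the equation expresses the coefficient of index n + 1 of the
solution through the earlier ones. -/
theorem eq_of_derivative_eq_mul {P S T : PowerSeries ℂ} (hS : d⁄dX ℂ S = P * S)
    (hT : d⁄dX ℂ T = P * T) (h0 : coeff 0 S = coeff 0 T) : S = T := by
  ext n
  induction n using Nat.strong_induction_on with
  | _ n ih =>
    rcases n with _ | n
    · exact h0
    have h1 := congrArg (coeff n) hS
    have h2 := congrArg (coeff n) hT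
    rw [coeff_derivative, coeff_mul] at h1 h2
    have h3 : coeff (n + 1) S * ((n : ℂ) + 1) = coeff (n + 1) T * (n + 1) := by
      rw [h1, h2]
      refine Finset.sum_congr rfl fun p hp => ?_
      rw [ih p.2 (by have := Finset.HasAntidiagonal.mem_antidiagonal.mp hp; omega)]
    exact mul_right_cancel₀ (Nat.cast_add_one_ne_zero n) h3

theorem expS_congr {l l' : ℕ → ℂ} (h : ∀ m, 1 ≤ m → l m = l' m) : expS l = expS l' := by
  unfold expS
  congr 2
  funext m
  split_ifs with hm
  · rfl
  · exact h m (by omega)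

theorem expS_add (l l' : ℕ → ℂ) : expS (l + l') = expS l * expS l' := by
  refine eq_of_derivative_eq_mul (derivative_expS _) ?_ ?_
  · rw [Derivation.leibniz, derivative_expS, derivative_expS, smul_eq_mul, smul_eq_mul]
    have : PowerSeries.mk (fun m : ℕ => ((m : ℂ) + 1) * (l + l') (m + 1)) =
        PowerSeries.mk (fun m : ℕ => ((m : ℂ) + 1) * l (m + 1)) +
          PowerSeries.mk (fun m : ℕ => ((m : ℂ) + 1) * l' (m + 1)) := by
      ext m; simp [mul_add]
    rw [this]; ring
  · rw [coeff_zero_eq_constantCoeff_apply (expS l * expS l'), map_mul,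
      ← coeff_zero_eq_constantCoeff_apply, ← coeff_zero_eq_constantCoeff_apply]
    simp only [coeff_zero_expS, one_mul]

theorem expS_zero {l : ℕ → ℂ} (h : ∀ m, 1 ≤ m → l m = 0) : expS l = 1 := by
  refine eq_of_derivative_eq_mul (derivative_expS _) ?_ ?_
  · have : PowerSeries.mk (fun m : ℕ => ((m : ℂ) + 1) * l (m + 1)) = 0 := by
      ext m; simp [h (m + 1) (by omega)]
    rw [this, zero_mul]
    exact derivative_one
  · simp [coeff_zero_expS, -coeff_zero_eq_constantCoeff]

/-- The coefficients of `exp (y t)`. -/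
theorem coeff_expS_linear (y : ℂ) (n : ℕ) :
    coeff n (expS fun m => if m = 1 then y else 0) = y ^ n / n ! := by
  induction n with
  | zero => simp [coeff_zero_expS, -coeff_zero_eq_constantCoeff]
  | succ n ih =>
    rw [coeff_succ_expS, Finset.sum_eq_single (0, n)]
    · simp only [zero_add, if_true, Nat.cast_zero, one_mul]
      rw [ih, Nat.factorial_succ]
      push_cast
      field
    · rintro ⟨a, b⟩ hab hne
      have := Finset.HasAntidiagonal.mem_antidiagonal.mp hab
      have ha : a ≠ 0 := by
        rintro rfl
        simp only [zero_add] at this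
        exact hne (by rw [this])
      simp [ha]
    · intro h; simp at h

theorem expS_linear_neg_mul (y : ℂ) :
    (expS fun m => if m = 1 then -y else 0) * (expS fun m => if m = 1 then y else 0) = 1 := by
  rw [← expS_add]
  refine expS_zero fun m _ => ?_
  simp only [Pi.add_apply]
  split_ifs <;> simp

/-- The exponent is log(1 + y t). With y = 1/x this isolates the contribution of the principal parts
of all 𝓔_m. -/
theorem expS_geometric (y : ℂ) :
    (expS fun m => -((-1) ^ m / (m : ℂ) * y ^ m)) = 1 + C y * X := by
  refine eq_of_derivative_eq_mul (derivative_expS _) ?_ ?_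
  · have h1 : PowerSeries.mk (fun m : ℕ => ((m : ℂ) + 1) *
        -((-1) ^ (m + 1) / ((m + 1 : ℕ) : ℂ) * y ^ (m + 1))) =
          PowerSeries.mk (fun m : ℕ => (-1) ^ m * y ^ (m + 1)) := by
      ext m
      have : (m : ℂ) + 1 ≠ 0 := Nat.cast_add_one_ne_zero m
      simp only [coeff_mk]
      push_cast
      field_simp
      ring
    rw [h1, map_add, derivative_one, zero_add, Derivation.leibniz, derivative_X, derivative_C]
    simp only [smul_eq_mul, mul_zero, add_zero, mul_one]
    ext m
    rw [mul_add, mul_one, mul_left_comm, map_add, coeff_C_mul]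
    rcases m with _ | m
    · simp
    · rw [coeff_succ_mul_X]
      simp only [coeff_mk, coeff_C, Nat.add_one_ne_zero, if_false]
      ring
  · rw [coeff_zero_expS, coeff_zero_eq_constantCoeff_apply]; simp

/-- This is the substitution t ↦ -t, read off from the recursion for the coefficients. -/
theorem coeff_expS_parity {l l' : ℕ → ℂ} (h : ∀ m, 1 ≤ m → l' m = (-1) ^ m * l m) (n : ℕ) :
    coeff n (expS l') = (-1) ^ n * coeff n (expS l) := by
  induction n using Nat.strong_induction_on with
  | _ n ih =>
    rcases n with _ | n
    · simp [coeff_zero_expS, -coeff_zero_eq_constantCoeff]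
    rw [coeff_succ_expS, coeff_succ_expS, ← mul_div_assoc, Finset.mul_sum]
    congr 1
    refine Finset.sum_congr rfl fun p hp => ?_
    have hp' := Finset.HasAntidiagonal.mem_antidiagonal.mp hp
    rw [ih p.2 (by omega), h _ (by omega), ← hp']
    ring

theorem differentiableAt_coeff_expS {l : ℂ → ℕ → ℂ} {x : ℂ}
    (h : ∀ m, 1 ≤ m → DifferentiableAt ℂ (fun z => l z m) x) (n : ℕ) :
    DifferentiableAt ℂ (fun z => coeff n (expS (l z))) x := by
  induction n using Nat.strong_induction_on with
  | _ n ih =>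
    rcases n with _ | n
    · simp only [coeff_zero_expS]; exact differentiableAt_const _
    simp only [coeff_succ_expS]
    refine DifferentiableAt.div_const (DifferentiableAt.fun_sum fun p hp => ?_) _
    have hp' := Finset.HasAntidiagonal.mem_antidiagonal.mp hp
    exact ((h (p.1 + 1) (by omega)).const_mul _).mul (ih p.2 (by omega))

/-- The coefficients of the exponential are universal polynomials in those of the series. -/
theorem exists_coeff_expS_eq {ι : Type*} {σ : Type*} {s : Set ι} {ev : ι → σ → ℂ} {l : ι → ℕ → ℂ}
    (h : ∀ m, 1 ≤ m → ∃ q : MvPolynomial σ ℂ, ∀ z ∈ s, l z m = MvPolynomial.eval (ev z) q) (n : ℕ) :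
    ∃ q : MvPolynomial σ ℂ, ∀ z ∈ s, coeff n (expS (l z)) = MvPolynomial.eval (ev z) q := by
  choose! q hq using h
  induction n using Nat.strong_induction_on with
  | _ n ih =>
    rcases n with _ | n
    · exact ⟨1, fun z _ => by simp [coeff_zero_expS, -coeff_zero_eq_constantCoeff]⟩
    choose! r hr using ih
    refine ⟨MvPolynomial.C (1 / ((n : ℂ) + 1)) * ∑ p ∈ Finset.HasAntidiagonal.antidiagonal n,
      MvPolynomial.C ((p.1 : ℂ) + 1) * q (p.1 + 1) * r p.2, fun z hz => ?_⟩
    rw [coeff_succ_expS, map_mul, map_sum, MvPolynomial.eval_C, one_div, div_eq_inv_mul]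
    congr 1
    refine Finset.sum_congr rfl fun p hp => ?_
    have hp' := Finset.HasAntidiagonal.mem_antidiagonal.mp hp
    rw [map_mul, map_mul, MvPolynomial.eval_C, hq _ (by omega) z hz, hr p.2 (by omega) z hz]

end FormalExp

end EllConf

/-! ### The Fay identity for the Kronecker series. -/

namespace EllConf

section Fay

open Filter Topology Asymptotics

variable (L : PeriodPair) (c : ℂ)

/-- The series `α F(x, α)` for the Kronecker function `F`. -/
noncomputable def kronS (x : ℂ) : PowerSeries ℂ :=
  expS fun m => -((-1) ^ m / (m : ℂ) * eisFn L c m x)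

/-- The series `x α F(x, α) / (x + α)`. -/
noncomputable def kronR (x : ℂ) : PowerSeries ℂ :=
  expS fun m => -((-1) ^ m / (m : ℂ) * eisExcept L c m x)

/-- The series `exp (y t)`. -/
noncomputable def linS (y : ℂ) : PowerSeries ℂ := expS fun m => if m = 1 then y else 0

/-- The principal parts 1/xᵐ sum to log(1 + t/x), so although the 𝓔_m have poles of all orders,
every coefficient of the series has at most a simple pole at 0. -/
theorem kronS_eq (x : ℂ) :
    kronS L c x = (1 + PowerSeries.C x⁻¹ * PowerSeries.X) * kronR L c x := by
  rw [← expS_geometric, kronR, ← expS_add]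
  refine expS_congr fun m hm => ?_
  simp only [Pi.add_apply]
  rw [eisFn_eq L c hm, inv_pow, one_div]
  ring

theorem kronR_zero : kronR L c 0 = 1 :=
  expS_zero fun m _ => by rw [eisExcept_zero, mul_zero, neg_zero]

/-- Only 𝓔_1 = ζ fails to be periodic, and it enters the exponent linearly. -/
theorem kronS_add {x l : ℂ} (hl : l ∈ L.lattice) (hx : x ∉ L.lattice) :
    kronS L c (x + l) = linS (quasiPeriod L c l) * kronS L c x := by
  rw [linS, kronS, kronS, ← expS_add]
  refine expS_congr fun m hm => ?_
  simp only [Pi.add_apply]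
  by_cases h : m = 1
  · subst h
    simp only [eisFn, if_true, zetaFn_add L hl hx]
    push_cast
    ring
  · rw [eisFn_add L c (by omega) hl hx, if_neg h, zero_add]

theorem differentiableAt_coeff_kronS {x : ℂ} (hx : x ∉ L.lattice) (n : ℕ) :
    DifferentiableAt ℂ (fun z => PowerSeries.coeff n (kronS L c z)) x :=
  differentiableAt_coeff_expS
    (fun _ hm => ((differentiableAt_eisFn L c hm hx).const_mul _).neg) n

theorem differentiableAt_coeff_kronR (n : ℕ) :
    DifferentiableAt ℂ (fun z => PowerSeries.coeff n (kronR L c z)) 0 :=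
  differentiableAt_coeff_expS
    (fun _ hm => ((differentiableAt_eisExcept L c hm (.inr rfl)).const_mul _).neg) n

/-- The power series `f(α)` in `α = X 0`, `β = X 1`. -/
noncomputable def serAlpha : PowerSeries ℂ →ₐ[ℂ] MvPowerSeries (Fin 2) ℂ :=
  PowerSeries.substAlgHom (PowerSeries.HasSubst.X 0)

/-- The power series `f(β)`. -/
noncomputable def serBeta : PowerSeries ℂ →ₐ[ℂ] MvPowerSeries (Fin 2) ℂ :=
  PowerSeries.substAlgHom (PowerSeries.HasSubst.X 1)

/-- The power series `f(α + β)`. -/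
noncomputable def serSum : PowerSeries ℂ →ₐ[ℂ] MvPowerSeries (Fin 2) ℂ :=
  PowerSeries.substAlgHom ((PowerSeries.HasSubst.X 0).add (PowerSeries.HasSubst.X 1))

theorem coeff_serAlpha (f : PowerSeries ℂ) (e : Fin 2 →₀ ℕ) :
    MvPowerSeries.coeff e (serAlpha f) = if e 1 = 0 then PowerSeries.coeff (e 0) f else 0 := by
  rw [serAlpha, PowerSeries.coe_substAlgHom, PowerSeries.coeff_subst_single]
  refine if_congr ?_ rfl rfl
  rw [Finsupp.ext_iff, Fin.forall_fin_two]
  simp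

theorem coeff_serBeta (f : PowerSeries ℂ) (e : Fin 2 →₀ ℕ) :
    MvPowerSeries.coeff e (serBeta f) = if e 0 = 0 then PowerSeries.coeff (e 1) f else 0 := by
  rw [serBeta, PowerSeries.coe_substAlgHom, PowerSeries.coeff_subst_single]
  refine if_congr ?_ rfl rfl
  rw [Finsupp.ext_iff, Fin.forall_fin_two]
  simp

theorem coeff_serSum (f : PowerSeries ℂ) (e : Fin 2 →₀ ℕ) :
    MvPowerSeries.coeff e (serSum f) =
      (e 0 + e 1).choose (e 0) * PowerSeries.coeff (e 0 + e 1) f := by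
  rw [serSum, PowerSeries.coe_substAlgHom, PowerSeries.coeff_subst_X_zero_add_X_one]

theorem serAlpha_eq (f : PowerSeries ℂ) :
    serAlpha f = XiFree.inAlpha fun m => PowerSeries.coeff m f := by
  ext e; exact coeff_serAlpha f e

theorem serBeta_eq (f : PowerSeries ℂ) :
    serBeta f = XiFree.inBeta fun m => PowerSeries.coeff m f := by
  ext e; exact coeff_serBeta f e

theorem serSum_eq (f : PowerSeries ℂ) :
    serSum f = XiFree.inSum fun m => PowerSeries.coeff m f := by
  ext e; exact (coeff_serSum f e).trans (nsmul_eq_mul _ _).symm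

theorem serAlpha_C_mul_X (y : ℂ) : serAlpha (PowerSeries.C y * PowerSeries.X) =
    MvPowerSeries.C y * MvPowerSeries.X 0 := by
  rw [map_mul, serAlpha, PowerSeries.substAlgHom_X]
  congr 1
  rw [PowerSeries.coe_substAlgHom, PowerSeries.subst_C]

theorem serBeta_C_mul_X (y : ℂ) : serBeta (PowerSeries.C y * PowerSeries.X) =
    MvPowerSeries.C y * MvPowerSeries.X 1 := by
  rw [map_mul, serBeta, PowerSeries.substAlgHom_X]
  congr 1
  rw [PowerSeries.coe_substAlgHom, PowerSeries.subst_C]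

theorem serSum_C_mul_X (y : ℂ) : serSum (PowerSeries.C y * PowerSeries.X) =
    MvPowerSeries.C y * (MvPowerSeries.X 0 + MvPowerSeries.X 1) := by
  rw [map_mul, serSum, PowerSeries.substAlgHom_X]
  congr 1
  rw [PowerSeries.coe_substAlgHom, PowerSeries.subst_C]

theorem serSum_linS (y : ℂ) : serSum (linS y) = serAlpha (linS y) * serBeta (linS y) := by
  ext e
  rw [coeff_serSum, serAlpha, serBeta, PowerSeries.coe_substAlgHom, PowerSeries.coe_substAlgHom,
    PowerSeries.coeff_subst_X_zero_subst_mul_X_one, linS, coeff_expS_linear, coeff_expS_linear,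
    coeff_expS_linear, Nat.choose_symm_add, Nat.add_choose, Nat.cast_div (Nat.factorial_mul_factorial_dvd_factorial_add _ _)
      (by exact_mod_cast (Nat.mul_pos (Nat.factorial_pos _) (Nat.factorial_pos _)).ne')]
  have h1 := Nat.cast_ne_zero (R := ℂ).mpr (Nat.factorial_ne_zero (e 0))
  have h2 := Nat.cast_ne_zero (R := ℂ).mpr (Nat.factorial_ne_zero (e 1))
  have h3 := Nat.cast_ne_zero (R := ℂ).mpr (Nat.factorial_ne_zero (e 0 + e 1))
  push_cast
  field_simp
  ring

/-- Differentiability of all coefficients of a family of power series. -/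
def CoeffDiffAt (f : ℂ → MvPowerSeries (Fin 2) ℂ) (x : ℂ) : Prop :=
  ∀ e, DifferentiableAt ℂ (fun z => MvPowerSeries.coeff e (f z)) x

namespace CoeffDiffAt

variable {f g : ℂ → MvPowerSeries (Fin 2) ℂ} {x : ℂ}

theorem const (F : MvPowerSeries (Fin 2) ℂ) : CoeffDiffAt (fun _ => F) x :=
  fun _ => differentiableAt_const _

theorem sub (hf : CoeffDiffAt f x) (hg : CoeffDiffAt g x) :
    CoeffDiffAt (fun z => f z - g z) x := fun e => by
  simpa only [map_sub] using (hf e).fun_sub (hg e)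

theorem mul (hf : CoeffDiffAt f x) (hg : CoeffDiffAt g x) :
    CoeffDiffAt (fun z => f z * g z) x := fun e => by
  classical
  simp only [MvPowerSeries.coeff_mul]
  exact DifferentiableAt.fun_sum fun p _ => (hf p.1).mul (hg p.2)

theorem serAlpha {F : ℂ → PowerSeries ℂ}
    (h : ∀ n, DifferentiableAt ℂ (fun z => PowerSeries.coeff n (F z)) x) :
    CoeffDiffAt (fun z => serAlpha (F z)) x := fun e => by
  simp only [coeff_serAlpha]
  split_ifs
  exacts [h _, differentiableAt_const _]

theorem serBeta {F : ℂ → PowerSeries ℂ}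
    (h : ∀ n, DifferentiableAt ℂ (fun z => PowerSeries.coeff n (F z)) x) :
    CoeffDiffAt (fun z => serBeta (F z)) x := fun e => by
  simp only [coeff_serBeta]
  split_ifs
  exacts [h _, differentiableAt_const _]

theorem serSum {F : ℂ → PowerSeries ℂ}
    (h : ∀ n, DifferentiableAt ℂ (fun z => PowerSeries.coeff n (F z)) x) :
    CoeffDiffAt (fun z => serSum (F z)) x := fun e => by
  simp only [coeff_serSum]
  exact (h _).const_mul _

/-- A simple pole with vanishing residue is removable. -/
theorem isBigO_one {D : ℂ → MvPowerSeries (Fin 2) ℂ} (hf : CoeffDiffAt f 0) (hg : CoeffDiffAt g 0)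
    (g0 : g 0 = 0) (h : ∀ᶠ z in 𝓝[≠] 0, D z = f z + MvPowerSeries.C z⁻¹ * g z) (e : Fin 2 →₀ ℕ) :
    (fun z => MvPowerSeries.coeff e (D z)) =O[𝓝[≠] 0] (fun _ => (1 : ℝ)) := by
  have h1 := (hf e).continuousAt.tendsto.mono_left (nhdsWithin_le_nhds (s := {0}ᶜ))
  -- Since g vanishes at 0, g(z) / z is a difference quotient and has a limit.
  have h2 := hasDerivAt_iff_tendsto_slope.mp (hg e).hasDerivAt
  refine ((h1.add h2).isBigO_one ℝ).congr' ?_ EventuallyEq.rfl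
  filter_upwards [h] with z hz
  rw [hz, map_add, MvPowerSeries.coeff_C_mul, slope_def_field, g0, map_zero, sub_zero, sub_zero,
    div_eq_inv_mul]

end CoeffDiffAt

/-- The difference of the two sides of the Fay identity. -/
noncomputable def fayDiff (b a : ℂ) : MvPowerSeries (Fin 2) ℂ :=
  (MvPowerSeries.X 0 + MvPowerSeries.X 1) * (serAlpha (kronS L c a) * serBeta (kronS L c b)) -
    MvPowerSeries.X 0 * (serBeta (kronS L c (b - a)) * serSum (kronS L c a)) -
    MvPowerSeries.X 1 * (serSum (kronS L c b) * serAlpha (kronS L c (a - b)))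

variable {L} {b : ℂ}

theorem coeffDiffAt_fayDiff {a : ℂ} (ha : a ∉ poleSet L b) :
    CoeffDiffAt (fayDiff L c b) a := by
  have h1 : a ∉ L.lattice := fun h => ha (.inl h)
  have h2 : a - b ∉ L.lattice := fun h => ha (.inr h)
  have h3 : b - a ∉ L.lattice := fun h => h2 (sub_mem_lattice_comm.mp h)
  have d1 := differentiableAt_coeff_kronS L c h1
  have d2 : ∀ n, DifferentiableAt ℂ (fun z => PowerSeries.coeff n (kronS L c (z - b))) a := fun n =>
    (differentiableAt_coeff_kronS L c h2 n).comp (f := fun z => z - b) a (by fun_prop)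
  have d3 : ∀ n, DifferentiableAt ℂ (fun z => PowerSeries.coeff n (kronS L c (b - z))) a := fun n =>
    (differentiableAt_coeff_kronS L c h3 n).comp (f := fun z => b - z) a (by fun_prop)
  exact (((CoeffDiffAt.const _).mul ((CoeffDiffAt.serAlpha d1).mul (.const _))).sub
    ((CoeffDiffAt.const _).mul ((CoeffDiffAt.serBeta d3).mul (.serSum d1)))).sub
    ((CoeffDiffAt.const _).mul ((CoeffDiffAt.const _).mul (.serAlpha d2)))

/-- Only the first two products are singular at a = 0. Their residues there are αβ-series with the
common factor α(α + β), multiplied by the Kronecker series of b in β with opposite signs. -/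
theorem fayDiff_isBigO_zero (hb : b ∉ L.lattice) (e : Fin 2 →₀ ℕ) :
    (fun z => MvPowerSeries.coeff e (fayDiff L c b z)) =O[𝓝[≠] 0] (fun _ => (1 : ℝ)) := by
  have hb' : 0 - b ∉ L.lattice := by rwa [zero_sub, neg_mem_iff]
  have d1 := differentiableAt_coeff_kronR L c
  have d2 : ∀ n, DifferentiableAt ℂ (fun z => PowerSeries.coeff n (kronS L c (z - b))) 0 := fun n =>
    (differentiableAt_coeff_kronS L c hb' n).comp (f := fun z => z - b) 0 (by fun_prop)
  have d3 : ∀ n, DifferentiableAt ℂ (fun z => PowerSeries.coeff n (kronS L c (b - z))) 0 := fun n =>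
    (differentiableAt_coeff_kronS L c (by rwa [sub_zero]) n).comp (f := fun z => b - z) 0
      (by fun_prop)
  refine CoeffDiffAt.isBigO_one
    (f := fun z => (MvPowerSeries.X 0 + MvPowerSeries.X 1) *
        (serAlpha (kronR L c z) * serBeta (kronS L c b)) -
      MvPowerSeries.X 0 * (serBeta (kronS L c (b - z)) * serSum (kronR L c z)) -
      MvPowerSeries.X 1 * (serSum (kronS L c b) * serAlpha (kronS L c (z - b))))
    (g := fun z => (MvPowerSeries.X 0 * (MvPowerSeries.X 0 + MvPowerSeries.X 1)) *
      (serAlpha (kronR L c z) * serBeta (kronS L c b) -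
        serBeta (kronS L c (b - z)) * serSum (kronR L c z)))
    ?_ ?_ ?_ (.of_forall fun z => ?_) e
  · exact (((CoeffDiffAt.const _).mul ((CoeffDiffAt.serAlpha d1).mul (.const _))).sub
      ((CoeffDiffAt.const _).mul ((CoeffDiffAt.serBeta d3).mul (.serSum d1)))).sub
      ((CoeffDiffAt.const _).mul ((CoeffDiffAt.const _).mul (.serAlpha d2)))
  · exact (CoeffDiffAt.const _).mul (((CoeffDiffAt.serAlpha d1).mul (.const _)).sub
      ((CoeffDiffAt.serBeta d3).mul (.serSum d1)))
  · simp only [kronR_zero, map_one, sub_zero, one_mul, mul_one, sub_self, mul_zero]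
  · rw [fayDiff, kronS_eq L c z, map_mul, map_mul, map_add, map_add, map_one, map_one,
      serAlpha_C_mul_X, serSum_C_mul_X]
    ring

/-- At a = b the last two products are singular. Their residues are αβ times the Kronecker series of
b in α + β, with opposite signs because the arguments b - a and a - b are. -/
theorem fayDiff_isBigO_self (hb : b ∉ L.lattice) (e : Fin 2 →₀ ℕ) :
    (fun z => MvPowerSeries.coeff e (fayDiff L c b z)) =O[𝓝[≠] b] (fun _ => (1 : ℝ)) := by
  have d1 := differentiableAt_coeff_kronR L c
  have d2 : ∀ n, DifferentiableAt ℂ (fun t => PowerSeries.coeff n (kronS L c (t + b))) 0 := fun n =>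
    (differentiableAt_coeff_kronS L c (by rwa [zero_add]) n).comp (f := fun t => t + b) 0
      (by fun_prop)
  have d3 : ∀ n, DifferentiableAt ℂ (fun t => PowerSeries.coeff n (kronR L c (-t))) 0 := fun n =>
    DifferentiableAt.comp (g := fun t => PowerSeries.coeff n (kronR L c t)) (f := fun t => -t) 0
      (by rw [neg_zero]; exact d1 n) (by fun_prop)
  have key : (fun t => MvPowerSeries.coeff e (fayDiff L c b (t + b))) =O[𝓝[≠] 0]
      (fun _ => (1 : ℝ)) := by
    refine CoeffDiffAt.isBigO_one
      (f := fun t => (MvPowerSeries.X 0 + MvPowerSeries.X 1) *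
          (serAlpha (kronS L c (t + b)) * serBeta (kronS L c b)) -
        MvPowerSeries.X 0 * (serBeta (kronR L c (-t)) * serSum (kronS L c (t + b))) -
        MvPowerSeries.X 1 * (serSum (kronS L c b) * serAlpha (kronR L c t)))
      (g := fun t => (MvPowerSeries.X 0 * MvPowerSeries.X 1) *
        (serBeta (kronR L c (-t)) * serSum (kronS L c (t + b)) -
          serSum (kronS L c b) * serAlpha (kronR L c t)))
      ?_ ?_ ?_ (.of_forall fun t => ?_) e
    · exact (((CoeffDiffAt.const _).mul ((CoeffDiffAt.serAlpha d2).mul (.const _))).sub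
        ((CoeffDiffAt.const _).mul ((CoeffDiffAt.serBeta d3).mul (.serSum d2)))).sub
        ((CoeffDiffAt.const _).mul ((CoeffDiffAt.const _).mul (.serAlpha d1)))
    · exact (CoeffDiffAt.const _).mul (((CoeffDiffAt.serBeta d3).mul (.serSum d2)).sub
        ((CoeffDiffAt.const _).mul (.serAlpha d1)))
    · simp only [neg_zero, kronR_zero, map_one, zero_add, one_mul, mul_one, sub_self, mul_zero]
    · rw [fayDiff, show b - (t + b) = -t by ring, add_sub_cancel_right, kronS_eq L c t,
        kronS_eq L c (-t), map_mul, map_mul, map_add, map_add, map_one, map_one,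
        serAlpha_C_mul_X, serBeta_C_mul_X, inv_neg, map_neg]
      ring
  have := tendsto_sub_nhdsNE b b
  rw [sub_self] at this
  simpa only [Function.comp_def, sub_add_cancel] using key.comp_tendsto this

/-- All three products acquire the same factor exp(η α): in the second one exp(η(α + β)) meets
exp(-η β), which comes from the argument b - a. -/
theorem fayDiff_add {a l : ℂ} (hl : l ∈ L.lattice) (ha : a ∉ poleSet L b) :
    fayDiff L c b (a + l) = serAlpha (linS (quasiPeriod L c l)) * fayDiff L c b a := by
  have h1 : a ∉ L.lattice := fun h => ha (.inl h)
  have h2 : a - b ∉ L.lattice := fun h => ha (.inr h)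
  have h3 : b - a ∉ L.lattice := fun h => h2 (sub_mem_lattice_comm.mp h)
  have h4 : serBeta (linS (-quasiPeriod L c l)) * serBeta (linS (quasiPeriod L c l)) = 1 := by
    rw [← map_mul, linS, linS, expS_linear_neg_mul, map_one]
  rw [fayDiff, fayDiff, show b - (a + l) = b - a + -l by ring, show a + l - b = a - b + l by ring,
    kronS_add L c hl h1, kronS_add L c hl h2, kronS_add L c (neg_mem hl) h3,
    quasiPeriod_neg L hl, map_mul, map_mul, map_mul, map_mul, serSum_linS]
  linear_combination (-MvPowerSeries.X 0 * serBeta (kronS L c (b - a)) * serSum (kronS L c a) *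
    serAlpha (linS (quasiPeriod L c l))) * h4

/-- The expansion to second order suffices to follow the two lowest coefficients in α under
translation. -/
theorem exists_linS_eq (y : ℂ) : ∃ g : PowerSeries ℂ,
    linS y = 1 + PowerSeries.C y * PowerSeries.X + PowerSeries.X ^ 2 * g := by
  have : PowerSeries.X ^ 2 ∣ linS y - (1 + PowerSeries.C y * PowerSeries.X) := by
    rw [PowerSeries.X_pow_dvd_iff]
    intro m hm
    rw [map_sub, linS, coeff_expS_linear]
    interval_cases m
    · simp
    · simp [PowerSeries.coeff_one]
  obtain ⟨g, hg⟩ := this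
  exact ⟨g, by rw [← hg]; ring⟩

/-- Induction on the degree in α, for all degrees in β at once. If all coefficients of α-degree
below p vanish, those of degree p are periodic, hence constant; a nonzero constant would make η
linear through the coefficient of degree p + 1. -/
theorem coeff_fayDiff_eq_zero (hb : b ∉ L.lattice) (p : ℕ) : ∀ e : Fin 2 →₀ ℕ, e 0 < p →
    ∀ a, a ∉ poleSet L b → MvPowerSeries.coeff e (fayDiff L c b a) = 0 := by
  induction p with
  | zero => intro e he; omega
  | succ p ih =>
    intro e he a ha
    rcases Nat.lt_succ_iff_lt_or_eq.mp he with he | he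
    · exact ih e he a ha
    have hdvd : ∀ a, a ∉ poleSet L b →
        (MvPowerSeries.X 0 : MvPowerSeries (Fin 2) ℂ) ^ p ∣ fayDiff L c b a := fun a ha =>
      MvPowerSeries.X_pow_dvd_iff.mpr fun e he => ih e he a ha
    -- As αᵖ divides the series, the part of exp(η α) beyond first order contributes only from
    -- α-degree p + 2 on.
    have hexp : ∀ l ∈ L.lattice, ∀ a, a ∉ poleSet L b → ∃ G : MvPowerSeries (Fin 2) ℂ,
        fayDiff L c b (a + l) = fayDiff L c b a +
          MvPowerSeries.C (quasiPeriod L c l) * (MvPowerSeries.X 0 * fayDiff L c b a) +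
          MvPowerSeries.X 0 ^ (p + 2) * G := by
      intro l hl a ha
      obtain ⟨g, hg⟩ := exists_linS_eq (quasiPeriod L c l)
      obtain ⟨G, hG⟩ := hdvd a ha
      refine ⟨serAlpha g * G, ?_⟩
      rw [fayDiff_add c hl ha, hg, map_add, map_add, map_one, serAlpha_C_mul_X, map_mul, map_pow]
      have : serAlpha PowerSeries.X = MvPowerSeries.X 0 := PowerSeries.substAlgHom_X _
      rw [this]
      linear_combination (serAlpha g * MvPowerSeries.X 0 ^ 2) * hG
    have hlow : ∀ (q : ℕ) (e : Fin 2 →₀ ℕ) (G : MvPowerSeries (Fin 2) ℂ), e 0 < q →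
        MvPowerSeries.coeff e (MvPowerSeries.X 0 ^ q * G) = 0 := fun q e G he =>
      MvPowerSeries.X_pow_dvd_iff.mp (dvd_mul_right _ G) e he
    obtain ⟨C, hC⟩ := eq_const_of_periodic (L := L) (b := b)
      (fun a => MvPowerSeries.coeff e (fayDiff L c b a))
      (fun a ha => coeffDiffAt_fayDiff c ha e) (fayDiff_isBigO_zero c hb e)
      (fayDiff_isBigO_self c hb e) (by
        intro l hl a ha
        obtain ⟨G, hG⟩ := hexp l hl a ha
        obtain ⟨H, hH⟩ := hdvd a ha
        have hX : MvPowerSeries.coeff e (MvPowerSeries.X 0 * fayDiff L c b a) = 0 := by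
          rw [hH, ← mul_assoc, ← pow_succ']
          exact hlow _ _ _ (by omega)
        simp only [hG, map_add]
        rw [MvPowerSeries.coeff_C_mul, hX, hlow _ _ _ (by omega)]
        ring)
    by_cases hC0 : C = 0
    · rw [hC a ha, hC0]
    exfalso
    -- The coefficient one step higher in α changes by `quasiPeriod L c l * C` under translation by
    -- `l`, so these constants are linear in `l`.
    obtain ⟨κ, d, -, h2⟩ := eq_affine_of_quasiPeriodic (L := L) (b := b)
      (fun a => MvPowerSeries.coeff (Finsupp.single 0 1 + e) (fayDiff L c b a))
      (fun l => quasiPeriod L c l * C)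
      (fun a ha => coeffDiffAt_fayDiff c ha _) (fayDiff_isBigO_zero c hb _)
      (fayDiff_isBigO_self c hb _) (by
        intro l hl a ha
        obtain ⟨G, hG⟩ := hexp l hl a ha
        have hX : MvPowerSeries.coeff (Finsupp.single 0 1 + e)
            (MvPowerSeries.X 0 * fayDiff L c b a) = C := by
          rw [MvPowerSeries.X, MvPowerSeries.coeff_add_monomial_mul, one_mul]
          exact hC a ha
        simp only [hG, map_add]
        rw [MvPowerSeries.coeff_C_mul, hX, hlow _ _ _ (by simp; omega)]
        ring)
    refine not_quasiPeriod_linear L c (κ / C) fun l hl => ?_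
    have := h2 l hl
    field_simp
    linear_combination this

theorem fayDiff_eq_zero {a : ℂ} (ha : a ∉ L.lattice) (hb : b ∉ L.lattice)
    (hab : a - b ∉ L.lattice) : fayDiff L c b a = 0 := by
  ext e
  exact coeff_fayDiff_eq_zero c hb (e 0 + 1) e (by omega) a (by rintro (h | h); exacts [ha h, hab h])

/-- The Fay identity for the Kronecker series, twisted by exponentials. -/
theorem fay_linS_mul_kronS (ρ : ℂ → ℂ) {x y z : ℂ} (hxz : x - z ∉ L.lattice)
    (hyz : y - z ∉ L.lattice) (hxy : x - y ∉ L.lattice) (S : ℂ → ℂ → PowerSeries ℂ)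
    (hS : ∀ x y, S x y = linS (ρ x - ρ y) * kronS L c (x - y)) :
    (MvPowerSeries.X 0 + MvPowerSeries.X 1) * (serAlpha (S x z) * serBeta (S y z)) -
      MvPowerSeries.X 0 * (serBeta (S y x) * serSum (S x z)) -
      MvPowerSeries.X 1 * (serSum (S y z) * serAlpha (S x y)) = 0 := by
  have h := fayDiff_eq_zero c hxz hyz (by rwa [sub_sub_sub_cancel_right])
  rw [fayDiff, sub_sub_sub_cancel_right, sub_sub_sub_cancel_right] at h
  -- The exponential factors form a cocycle, so each product in the twisted identity carries the
  -- same factor exp(α(ρ x - ρ z)) exp(β(ρ y - ρ z)).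
  have hlin : ∀ u v w, linS (u - v) * linS (v - w) = linS (u - w) := by
    intro u v w
    rw [linS, linS, linS, ← expS_add]
    refine expS_congr fun m _ => ?_
    simp only [Pi.add_apply]
    split_ifs <;> ring
  simp only [hS, map_mul, serSum_linS]
  have e1 := congrArg serAlpha (hlin (ρ x) (ρ y) (ρ z))
  have e2 := congrArg serBeta (hlin (ρ y) (ρ x) (ρ z))
  rw [map_mul] at e1 e2
  linear_combination (serAlpha (linS (ρ x - ρ z)) * serBeta (linS (ρ y - ρ z))) * h -
    (MvPowerSeries.X 0 * serBeta (kronS L c (y - x)) * serSum (kronS L c (x - z)) *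
      serAlpha (linS (ρ x - ρ z))) * e2 -
    (MvPowerSeries.X 1 * serSum (kronS L c (y - z)) * serAlpha (kronS L c (x - y)) *
      serBeta (linS (ρ y - ρ z))) * e1

end Fay

end EllConf

/-! ### Regular functions on the configuration space. -/

namespace EllConf

section Ring

open UpperHalfPlane KaehlerDifferential

variable {τ : ℍ} {n : ℕ}

/-- A point of `ℂ^n` over a configuration. -/
def IsLift (Q : Conf τ n) (z : Fin n → ℂ) : Prop := ∀ i, EllCurve.mk τ (z i) = Q.1 i

theorem exists_isLift (Q : Conf τ n) : ∃ z, IsLift Q z :=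
  ⟨fun i => Quotient.out (Q.1 i), fun i => Quotient.out_eq (Q.1 i)⟩

namespace IsLift

variable {Q : Conf τ n} {z : Fin n → ℂ}

theorem notMem (h : IsLift Q z) (i : Fin n) : z i ∉ (periods τ).lattice := fun hz =>
  Q.2.1 i (by rw [← h i]; exact (Submodule.Quotient.mk_eq_zero _).mpr hz)

theorem sub_notMem (h : IsLift Q z) {i j : Fin n} (hij : i ≠ j) :
    z i - z j ∉ (periods τ).lattice := fun hz =>
  Q.2.2 i j hij (by rw [← h i, ← h j]; exact (Submodule.Quotient.eq _).mpr hz)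

theorem u_eq (h : IsLift Q z) (i : Fin n) : (CoordRing.u τ i).1 Q = (periods τ).weierstrassP (z i) := by
  change EllCurve.u τ (Q.1 i) = _
  rw [← h i]; rfl

theorem v_eq (h : IsLift Q z) (i : Fin n) :
    (CoordRing.v τ i).1 Q = (periods τ).derivWeierstrassP (z i) := by
  change EllCurve.v τ (Q.1 i) = _
  rw [← h i]; rfl

end IsLift

namespace CoordRing

theorem ext_lift {f g : CoordRing τ n}
    (h : ∀ (Q : Conf τ n) (z : Fin n → ℂ), IsLift Q z → f.1 Q = g.1 Q) : f = g := by
  apply Subtype.ext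
  funext Q
  obtain ⟨z, hz⟩ := exists_isLift Q
  exact h Q z hz

/-- Evaluation at a configuration. -/
noncomputable def evalAt (Q : Conf τ n) : CoordRing τ n →ₐ[ℂ] ℂ :=
  (Pi.evalAlgHom ℂ (fun _ => ℂ) Q).comp (regularFunctions τ n).val

theorem ext_evalAt {f g : CoordRing τ n}
    (h : ∀ (Q : Conf τ n) (z : Fin n → ℂ), IsLift Q z → evalAt Q f = evalAt Q g) : f = g :=
  ext_lift h

/-- The slope `ζ(x_i - x_j) - ζ(x_i) + ζ(x_j)` as a function on the configuration space. -/
noncomputable def slopeVal (Q : Conf τ n) (i j : Fin n) : ℂ :=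
  slopeFn (periods τ) (EisensteinSeries.G2 τ) ((exists_isLift Q).choose i)
    ((exists_isLift Q).choose j)

variable {i j : Fin n}

/-- The factors u_i - u_j and v_i - v_j have no common zero on the configuration space, so one of
the two slope formulas can be solved for s. -/
theorem slopeFn_unique {Q : Conf τ n} {z : Fin n → ℂ} (hz : IsLift Q z) (hij : i ≠ j) {s s' : ℂ}
    (h1 : 2 * s * ((u τ i).1 Q - (u τ j).1 Q) = (v τ i).1 Q + (v τ j).1 Q)
    (h1' : 2 * s' * ((u τ i).1 Q - (u τ j).1 Q) = (v τ i).1 Q + (v τ j).1 Q)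
    (h2 : 2 * s * ((v τ i).1 Q - (v τ j).1 Q) = 2 * s' * ((v τ i).1 Q - (v τ j).1 Q)) :
    s = s' := by
  by_cases hu : (u τ i).1 Q - (u τ j).1 Q = 0
  · have hv : (v τ i).1 Q - (v τ j).1 Q ≠ 0 := by
      intro hv
      rw [hz.u_eq, hz.u_eq] at hu
      rw [hz.v_eq, hz.v_eq] at hv
      exact hz.sub_notMem hij (sub_mem_lattice_of_eq _ (hz.notMem i) (hz.notMem j)
        (sub_eq_zero.mp hu) (sub_eq_zero.mp hv))
    have := mul_right_cancel₀ hv h2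
    linear_combination this / 2
  · have := mul_right_cancel₀ hu (h1.trans h1'.symm)
    linear_combination this / 2

/-- The chosen lift is irrelevant: the slope formulas involve only the values of ℘ and ℘', which
depend on the configuration alone. -/
theorem slopeVal_eq {Q : Conf τ n} {z : Fin n → ℂ} (hz : IsLift Q z) (hij : i ≠ j) :
    slopeVal Q i j = slopeFn (periods τ) (EisensteinSeries.G2 τ) (z i) (z j) := by
  have hz' := (exists_isLift Q).choose_spec
  refine slopeFn_unique hz hij ?_ ?_ ?_
  · rw [hz'.u_eq, hz'.u_eq, hz'.v_eq, hz'.v_eq]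
    exact two_slopeFn_mul_sub _ (hz'.notMem i) (hz'.notMem j) (hz'.sub_notMem hij)
  · rw [hz.u_eq, hz.u_eq, hz.v_eq, hz.v_eq]
    exact two_slopeFn_mul_sub _ (hz.notMem i) (hz.notMem j) (hz.sub_notMem hij)
  · have e1 := two_slopeFn_mul_deriv_sub _ (c := EisensteinSeries.G2 τ) (hz'.notMem i)
      (hz'.notMem j) (hz'.sub_notMem hij)
    have e2 := two_slopeFn_mul_deriv_sub _ (c := EisensteinSeries.G2 τ) (hz.notMem i)
      (hz.notMem j) (hz.sub_notMem hij)
    rw [← hz'.u_eq, ← hz'.u_eq, ← hz'.v_eq, ← hz'.v_eq] at e1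
    rw [← hz.u_eq, ← hz.u_eq, ← hz.v_eq, ← hz.v_eq] at e2
    exact e1.trans e2.symm

/-- The two slope formulas give fractions on the open sets v_i ≠ v_j and u_i ≠ u_j, which cover the
configuration space. -/
theorem slopeVal_mem (hij : i ≠ j) : (fun Q : Conf τ n => slopeVal Q i j) ∈ regularFunctions τ n := by
  intro P
  obtain ⟨z, hz⟩ := exists_isLift P
  have eu : ∀ (Q : Conf τ n) (k : Fin n), Q.eval (MvPolynomial.X (.inl k)) = (u τ k).1 Q :=
    fun Q k => by simp [Conf.eval, u]
  have ev : ∀ (Q : Conf τ n) (k : Fin n), Q.eval (MvPolynomial.X (.inr k)) = (v τ k).1 Q :=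
    fun Q k => by simp [Conf.eval, v]
  by_cases hu : (u τ i).1 P - (u τ j).1 P = 0
  · have hv : (v τ i).1 P - (v τ j).1 P ≠ 0 := by
      intro hv
      rw [hz.u_eq, hz.u_eq] at hu
      rw [hz.v_eq, hz.v_eq] at hv
      exact hz.sub_notMem hij (sub_mem_lattice_of_eq _ (hz.notMem i) (hz.notMem j)
        (sub_eq_zero.mp hu) (sub_eq_zero.mp hv))
    refine ⟨MvPolynomial.C 4 * (MvPolynomial.X (.inl i) ^ 2 + MvPolynomial.X (.inl i) *
      MvPolynomial.X (.inl j) + MvPolynomial.X (.inl j) ^ 2) - MvPolynomial.C (periods τ).g₂,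
      MvPolynomial.C 2 * (MvPolynomial.X (.inr i) - MvPolynomial.X (.inr j)), ?_, fun Q hQ => ?_⟩
    · rw [map_mul, map_sub, ev, ev]
      refine mul_ne_zero ?_ hv
      rw [Conf.eval, MvPolynomial.aeval_C]
      exact two_ne_zero
    · rw [eq_div_iff hQ]
      obtain ⟨z, hz⟩ := exists_isLift Q
      have := two_slopeFn_mul_deriv_sub _ (c := EisensteinSeries.G2 τ) (hz.notMem i)
        (hz.notMem j) (hz.sub_notMem hij)
      rw [← hz.u_eq, ← hz.u_eq, ← hz.v_eq, ← hz.v_eq] at this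
      simp only [map_mul, map_sub, map_add, map_pow, eu, ev, slopeVal_eq hz hij]
      simp only [Conf.eval, MvPolynomial.aeval_C, Algebra.algebraMap_self, RingHom.id_apply]
      linear_combination this
  · refine ⟨MvPolynomial.X (.inr i) + MvPolynomial.X (.inr j),
      MvPolynomial.C 2 * (MvPolynomial.X (.inl i) - MvPolynomial.X (.inl j)), ?_, fun Q hQ => ?_⟩
    · rw [map_mul, map_sub, eu, eu]
      refine mul_ne_zero ?_ hu
      rw [Conf.eval, MvPolynomial.aeval_C]
      exact two_ne_zero
    · rw [eq_div_iff hQ]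
      obtain ⟨z, hz⟩ := exists_isLift Q
      have := two_slopeFn_mul_sub _ (c := EisensteinSeries.G2 τ) (hz.notMem i)
        (hz.notMem j) (hz.sub_notMem hij)
      rw [← hz.u_eq, ← hz.u_eq, ← hz.v_eq, ← hz.v_eq] at this
      simp only [map_mul, map_sub, map_add, eu, ev, slopeVal_eq hz hij]
      simp only [Conf.eval, MvPolynomial.aeval_C, Algebra.algebraMap_self, RingHom.id_apply]
      linear_combination this

/-- The regular function `ζ(x_i - x_j) - ζ(x_i) + ζ(x_j)`. -/
noncomputable def slope (hij : i ≠ j) : CoordRing τ n := ⟨fun Q => slopeVal Q i j, slopeVal_mem hij⟩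

/-- The regular function `℘(x_i - x_j)`. -/
noncomputable def diffU (hij : i ≠ j) : CoordRing τ n := slope hij ^ 2 - u τ i - u τ j

/-- The regular function `℘'(x_i - x_j)`. -/
noncomputable def diffV (hij : i ≠ j) : CoordRing τ n :=
  -v τ i - 2 * slope hij * (diffU hij - u τ i)

variable {Q : Conf τ n} {z : Fin n → ℂ}

theorem evalAt_u (hz : IsLift Q z) : evalAt Q (u τ i) = (periods τ).weierstrassP (z i) := hz.u_eq i

theorem evalAt_v (hz : IsLift Q z) : evalAt Q (v τ i) = (periods τ).derivWeierstrassP (z i) :=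
  hz.v_eq i

theorem evalAt_slope (hz : IsLift Q z) (hij : i ≠ j) : evalAt Q (slope hij) =
    slopeFn (periods τ) (EisensteinSeries.G2 τ) (z i) (z j) := slopeVal_eq hz hij

theorem evalAt_diffU (hz : IsLift Q z) (hij : i ≠ j) :
    evalAt Q (diffU hij) = (periods τ).weierstrassP (z i - z j) := by
  have := slopeFn_sq _ (c := EisensteinSeries.G2 τ) (hz.notMem i) (hz.notMem j) (hz.sub_notMem hij)
  rw [diffU, map_sub, map_sub, map_pow, evalAt_slope hz, evalAt_u hz, evalAt_u hz, this]
  ring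

theorem evalAt_diffV (hz : IsLift Q z) (hij : i ≠ j) :
    evalAt Q (diffV hij) = (periods τ).derivWeierstrassP (z i - z j) := by
  have := two_slopeFn_mul_left _ (c := EisensteinSeries.G2 τ) (hz.notMem i) (hz.notMem j)
    (hz.sub_notMem hij)
  rw [diffV, map_sub, map_mul, map_mul, map_neg, map_sub, map_ofNat, evalAt_slope hz,
    evalAt_u hz, evalAt_v hz, evalAt_diffU hz]
  linear_combination this

variable (τ n) in
/-- The constant `g₂ / 2`. -/
noncomputable def halfG₂ : CoordRing τ n := algebraMap ℂ (CoordRing τ n) ((periods τ).g₂ / 2)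

variable (τ n) in
/-- The constant `g₃`. -/
noncomputable def constG₃ : CoordRing τ n := algebraMap ℂ (CoordRing τ n) (periods τ).g₃

theorem evalAt_halfG₂ : evalAt Q (halfG₂ τ n) = (periods τ).g₂ / 2 := AlgHom.commutes _ _

theorem evalAt_constG₃ : evalAt Q (constG₃ τ n) = (periods τ).g₃ := AlgHom.commutes _ _

variable (τ) in
theorem v_sq (i : Fin n) :
    v τ i ^ 2 = 4 * u τ i ^ 3 - 2 * halfG₂ τ n * u τ i - constG₃ τ n := by
  refine ext_evalAt fun Q z hz => ?_
  simp only [map_sub, map_mul, map_pow, map_ofNat, evalAt_u hz, evalAt_v hz, evalAt_halfG₂,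
    evalAt_constG₃]
  rw [(periods τ).derivWeierstrassP_sq _ (hz.notMem i)]
  ring

theorem two_slope_mul_sub (hij : i ≠ j) :
    2 * slope hij * (u τ i - u τ j) = v τ i + v τ j := by
  refine ext_evalAt fun Q z hz => ?_
  simp only [map_sub, map_mul, map_add, map_ofNat, evalAt_u hz, evalAt_v hz, evalAt_slope hz]
  exact two_slopeFn_mul_sub _ (hz.notMem i) (hz.notMem j) (hz.sub_notMem hij)

theorem slope_mul_deriv_sub (hij : i ≠ j) :
    slope hij * (v τ i - v τ j) =
      2 * (u τ i ^ 2 + u τ i * u τ j + u τ j ^ 2) - halfG₂ τ n := by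
  refine ext_evalAt fun Q z hz => ?_
  have := two_slopeFn_mul_deriv_sub _ (c := EisensteinSeries.G2 τ) (hz.notMem i) (hz.notMem j)
    (hz.sub_notMem hij)
  simp only [map_sub, map_mul, map_add, map_pow, map_ofNat, evalAt_u hz, evalAt_v hz,
    evalAt_slope hz, evalAt_halfG₂]
  linear_combination this / 2

theorem two_smul_cancel {M : Type*} [AddCommGroup M] [Module (CoordRing τ n) M] {x : M}
    (h : (2 : CoordRing τ n) • x = 0) : x = 0 := by
  have h2 : algebraMap ℂ (CoordRing τ n) (1 / 2) * 2 = 1 := by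
    rw [← map_ofNat (algebraMap ℂ (CoordRing τ n)) 2, ← map_mul]
    norm_num
  have := congrArg (algebraMap ℂ (CoordRing τ n) (1 / 2) • ·) h
  simpa only [smul_zero, smul_smul, h2, one_smul] using this

variable (τ n) in
/-- The inverse of the discriminant. -/
noncomputable def invDisc : CoordRing τ n :=
  algebraMap ℂ (CoordRing τ n) ((periods τ).g₂ ^ 3 - 27 * (periods τ).g₃ ^ 2)⁻¹

variable (τ) in
/-- `v_i` and `P'(u_i)` generate the unit ideal. -/
theorem disc_identity (i : Fin n) :
    invDisc τ n * ((27 * constG₃ τ n - 36 * halfG₂ τ n * u τ i) * v τ i ^ 2 +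
      (24 * halfG₂ τ n * u τ i ^ 2 - 18 * constG₃ τ n * u τ i - 8 * halfG₂ τ n ^ 2) *
        (6 * u τ i ^ 2 - halfG₂ τ n)) = 1 := by
  -- The Bézout identity for the cubic P(u_i) = v_i² and its half derivative, whose value is the
  -- discriminant.
  have h : (27 * constG₃ τ n - 36 * halfG₂ τ n * u τ i) * v τ i ^ 2 +
      (24 * halfG₂ τ n * u τ i ^ 2 - 18 * constG₃ τ n * u τ i - 8 * halfG₂ τ n ^ 2) *
        (6 * u τ i ^ 2 - halfG₂ τ n) = algebraMap ℂ (CoordRing τ n)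
          ((periods τ).g₂ ^ 3 - 27 * (periods τ).g₃ ^ 2) := by
    have e : algebraMap ℂ (CoordRing τ n) ((periods τ).g₂ ^ 3 - 27 * (periods τ).g₃ ^ 2) =
        8 * halfG₂ τ n ^ 3 - 27 * constG₃ τ n ^ 2 := by
      rw [halfG₂, constG₃, ← map_pow, ← map_pow, ← map_ofNat (algebraMap ℂ (CoordRing τ n)) 8,
        ← map_ofNat (algebraMap ℂ (CoordRing τ n)) 27, ← map_mul, ← map_mul, ← map_sub]
      congr 1
      ring
    rw [e, v_sq]
    ring
  rw [h, invDisc, ← map_mul, inv_mul_cancel₀ (discriminant_ne_zero _), map_one]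

/-- The two multipliers generate the unit ideal. Equalities of differential forms can thus be tested
after multiplication, without knowing that the module of differentials is free or torsion-free. -/
theorem eq_zero_of_smul {M : Type*} [AddCommGroup M] [Module (CoordRing τ n) M] {x : M}
    (h1 : v τ i • x = 0) (h2 : (6 * u τ i ^ 2 - halfG₂ τ n) • x = 0) : x = 0 := by
  have := congrArg (· • x) (disc_identity τ i)
  simp only [one_smul] at this
  rw [← this, mul_smul, add_smul, pow_two (v τ i), ← mul_assoc, mul_smul _ (v τ i), h1,
    mul_smul _ (6 * u τ i ^ 2 - halfG₂ τ n), h2]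
  simp

/-- By the slope relations, 2 v_i and P'(u_i) are combinations of u_i - u_j and v_i - v_j, so these
also generate the unit ideal. -/
theorem eq_zero_of_sub_smul {M : Type*} [AddCommGroup M] [Module (CoordRing τ n) M] {x : M}
    (hij : i ≠ j) (h1 : (u τ i - u τ j) • x = 0) (h2 : (v τ i - v τ j) • x = 0) : x = 0 := by
  refine eq_zero_of_smul (τ := τ) (n := n) (i := i) (two_smul_cancel (τ := τ) (n := n) ?_)
    (two_smul_cancel (τ := τ) (n := n) ?_)
  · rw [smul_smul, show 2 * v τ i = (v τ i - v τ j) + 2 * slope hij * (u τ i - u τ j) by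
      rw [two_slope_mul_sub]; ring, add_smul, mul_smul, h1, h2, smul_zero, add_zero]
  · rw [smul_smul, show 2 * (6 * u τ i ^ 2 - halfG₂ τ n) = 2 * slope hij * (v τ i - v τ j) +
      4 * (2 * u τ i + u τ j) * (u τ i - u τ j) by
        linear_combination (-2) * slope_mul_deriv_sub (τ := τ) hij, add_smul,
      mul_smul, mul_smul (4 * (2 * u τ i + u τ j)), h1, h2, smul_zero, smul_zero, add_zero]

/-! ### Kähler differentials of the coordinate ring. -/

/-- The form `dx_i`. -/
noncomputable def dx (τ : ℍ) {n : ℕ} (i : Fin n) : Ω[CoordRing τ n⁄ℂ] :=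
  invDisc τ n • (((27 * constG₃ τ n - 36 * halfG₂ τ n * u τ i) * v τ i) • D ℂ (CoordRing τ n) (u τ i) +
    (24 * halfG₂ τ n * u τ i ^ 2 - 18 * constG₃ τ n * u τ i - 8 * halfG₂ τ n ^ 2) •
      D ℂ (CoordRing τ n) (v τ i))

theorem D_two : D ℂ (CoordRing τ n) 2 = 0 := (D ℂ (CoordRing τ n)).map_natCast 2

theorem D_four : D ℂ (CoordRing τ n) 4 = 0 := (D ℂ (CoordRing τ n)).map_natCast 4

theorem D_halfG₂ : D ℂ (CoordRing τ n) (halfG₂ τ n) = 0 := Derivation.map_algebraMap _ _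

theorem D_constG₃ : D ℂ (CoordRing τ n) (constG₃ τ n) = 0 := Derivation.map_algebraMap _ _

variable (τ) in
theorem v_smul_D_v (i : Fin n) : v τ i • D ℂ (CoordRing τ n) (v τ i) =
    (6 * u τ i ^ 2 - halfG₂ τ n) • D ℂ (CoordRing τ n) (u τ i) := by
  have h := congrArg (D ℂ (CoordRing τ n)) (v_sq τ i)
  simp only [map_sub, Derivation.leibniz, Derivation.leibniz_pow, D_two, D_four, D_halfG₂,
    D_constG₃, smul_zero, add_zero, sub_zero] at h
  refine sub_eq_zero.mp (two_smul_cancel (τ := τ) (n := n) ?_)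
  rw [← sub_eq_zero] at h
  rw [← h]
  module

variable (τ) in
-- The form was built by writing 1 as the Bézout combination A v² + B P'(u)/2 and replacing v² by v
-- du and P'(u)/2 by dv. Both equations then follow from v dv = (P'(u)/2) du, the differential of
-- the curve equation.
theorem isDx_dx (i : Fin n) : IsDx i (dx τ i) := by
  have h := v_smul_D_v τ i
  have h1 := disc_identity τ i
  constructor
  · rw [← one_smul (CoordRing τ n) (D ℂ (CoordRing τ n) (u τ i)), ← h1, dx]
    linear_combination (norm := module) (-(invDisc τ n * (24 * halfG₂ τ n * u τ i ^ 2 -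
      18 * constG₃ τ n * u τ i - 8 * halfG₂ τ n ^ 2))) • h
  · change _ = (6 * u τ i ^ 2 - halfG₂ τ n) • _
    rw [← one_smul (CoordRing τ n) (D ℂ (CoordRing τ n) (v τ i)), ← h1, dx]
    linear_combination (norm := module) (invDisc τ n * (27 * constG₃ τ n - 36 * halfG₂ τ n * u τ i) *
      v τ i) • h

variable (τ) in
theorem D_u (i : Fin n) : D ℂ (CoordRing τ n) (u τ i) = v τ i • dx τ i := (isDx_dx τ i).1

variable (τ) in
theorem D_v (i : Fin n) :
    D ℂ (CoordRing τ n) (v τ i) = (6 * u τ i ^ 2 - halfG₂ τ n) • dx τ i := (isDx_dx τ i).2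

theorem isDx_iff (η : Ω[CoordRing τ n⁄ℂ]) : IsDx i η ↔ η = dx τ i := by
  refine ⟨fun h => sub_eq_zero.mp (eq_zero_of_smul (τ := τ) (n := n) (i := i) ?_ ?_),
    fun h => h ▸ isDx_dx τ i⟩
  · rw [smul_sub, ← h.1, ← D_u, sub_self]
  · have h2 : D ℂ (CoordRing τ n) (v τ i) = (6 * u τ i ^ 2 - halfG₂ τ n) • η := h.2
    rw [smul_sub, ← h2, ← D_v, sub_self]

/-- The differentials of the two slope relations determine ds multiplied by u_i - u_j and by v_i -
v_j, which is enough by `eq_zero_of_sub_smul`. -/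
theorem D_slope (hij : i ≠ j) : D ℂ (CoordRing τ n) (slope hij) =
    (u τ i - diffU hij) • dx τ i - (u τ j - diffU hij) • dx τ j := by
  have r1 := two_slope_mul_sub (τ := τ) hij
  have r2 := slope_mul_deriv_sub (τ := τ) hij
  have d1 := congrArg (D ℂ (CoordRing τ n)) r1
  have d2 := congrArg (D ℂ (CoordRing τ n)) r2
  simp only [map_sub, map_add, Derivation.leibniz, Derivation.leibniz_pow, D_two, D_halfG₂,
    D_u, D_v, smul_zero, add_zero, sub_zero] at d1 d2
  -- These four identities match the coefficients of dx_i and dx_j in the two multiplied equations.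
  have ci : 2 * ((u τ i - u τ j) * (u τ i - diffU hij)) =
      6 * u τ i ^ 2 - halfG₂ τ n - 2 * slope hij * v τ i := by
    rw [diffU]; linear_combination (-slope hij) * r1 + r2
  have cj : 2 * ((u τ i - u τ j) * (u τ j - diffU hij)) =
      -(2 * slope hij * v τ j) - (6 * u τ j ^ 2 - halfG₂ τ n) := by
    rw [diffU]; linear_combination (-slope hij) * r1 - r2
  have ei : 2 * ((v τ i - v τ j) * (u τ i - diffU hij)) =
      4 * (2 * u τ i + u τ j) * v τ i - 2 * slope hij * (6 * u τ i ^ 2 - halfG₂ τ n) := by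
    rw [diffU]; linear_combination (-2 * slope hij) * r2 + 2 * (2 * u τ i + u τ j) * r1
  have ej : 2 * ((v τ i - v τ j) * (u τ j - diffU hij)) =
      -(4 * (2 * u τ j + u τ i) * v τ j) - 2 * slope hij * (6 * u τ j ^ 2 - halfG₂ τ n) := by
    rw [diffU]; linear_combination (-2 * slope hij) * r2 - 2 * (2 * u τ j + u τ i) * r1
  refine sub_eq_zero.mp (eq_zero_of_sub_smul (τ := τ) (n := n) hij
    (two_smul_cancel (τ := τ) (n := n) ?_) (two_smul_cancel (τ := τ) (n := n) ?_))
  · have ci' := congrArg (· • dx τ i) ci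
    have cj' := congrArg (· • dx τ j) cj
    linear_combination (norm := module) d1 - ci' + cj'
  · have ei' := congrArg (· • dx τ i) ei
    have ej' := congrArg (· • dx τ j) ej
    linear_combination (norm := module) (2 : CoordRing τ n) • d2 - ei' + ej'

theorem D_diffU (hij : i ≠ j) : D ℂ (CoordRing τ n) (diffU hij) =
    (diffV hij : CoordRing τ n) • (dx τ i - dx τ j) := by
  have c := congrArg (· • dx τ j) (two_slope_mul_sub (τ := τ) hij)
  rw [diffV]
  conv_lhs => rw [diffU]
  rw [map_sub, map_sub, Derivation.leibniz_pow, D_u, D_u, D_slope]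
  linear_combination (norm := module) c

/-- The factor is 6 ℘² - g₂/2 at x_i - x_j. Only proportionality to dx_i - dx_j matters later. -/
theorem D_diffV (hij : i ≠ j) : ∃ f : CoordRing τ n, D ℂ (CoordRing τ n) (diffV hij) =
    f • (dx τ i - dx τ j) := by
  have r1 := two_slope_mul_sub (τ := τ) hij
  have r2 := slope_mul_deriv_sub (τ := τ) hij
  refine ⟨6 * diffU hij ^ 2 - halfG₂ τ n, ?_⟩
  have c : halfG₂ τ n - 6 * u τ i ^ 2 - 2 * slope hij * (diffV hij - v τ i) -
      2 * (diffU hij - u τ i) * (u τ i - diffU hij) = 6 * diffU hij ^ 2 - halfG₂ τ n := by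
    rw [diffV, diffU]; linear_combination (-2 * slope hij) * r1 + 2 * r2
  have e : 2 * slope hij * diffV hij + 2 * (diffU hij - u τ i) * (u τ j - diffU hij) =
    -(6 * diffU hij ^ 2 - halfG₂ τ n) := by
    rw [diffV, diffU]; linear_combination slope hij * r1 - r2
  have c' := congrArg (· • dx τ i) c
  have e' := congrArg (· • dx τ j) e
  rw [show D ℂ (CoordRing τ n) (diffV hij) = D ℂ (CoordRing τ n)
    (-v τ i - 2 * slope hij * (diffU hij - u τ i)) from rfl]
  simp only [map_sub, map_neg, Derivation.leibniz, D_two, D_u, D_v, D_slope, D_diffU, smul_zero,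
    add_zero]
  linear_combination (norm := module) c' + e'

end CoordRing

end Ring

end EllConf

/-! ### The coefficients of the Kronecker series as regular functions, and their differentials. -/

namespace EllConf

section KroneckerSeries

open UpperHalfPlane KaehlerDifferential
open scoped Nat

/-- The series `exp (-∑_{m ≥ 2} (-t)^m / m * 𝓔_m(x))`. -/
noncomputable def kronTail (L : PeriodPair) (c x : ℂ) : PowerSeries ℂ :=
  expS fun m => if 2 ≤ m then -((-1) ^ m / (m : ℂ) * eisFn L c m x) else 0

/-- Moving ζ(x - y) from the linear exponential into the tail completes the Kronecker series; what
remains is the coboundary of -ζ, the shape required by `fay_linS_mul_kronS`. -/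
theorem linS_mul_kronTail (L : PeriodPair) (c x y : ℂ) :
    linS (slopeFn L c x y) * kronTail L c (x - y) =
      linS (-zetaFn L c x - -zetaFn L c y) * kronS L c (x - y) := by
  rw [linS, linS, kronTail, kronS, ← expS_add, ← expS_add]
  refine expS_congr fun m hm => ?_
  simp only [Pi.add_apply]
  rcases eq_or_lt_of_le hm with rfl | hm
  · simp [slopeFn, eisFn]; ring
  · rw [if_neg (by omega), if_pos (by omega), if_neg (by omega)]

theorem kroneckerSeries_eq (τ : ℍ) (x y : ℂ) : kroneckerSeries τ x y =
    linS (slopeFn (periods τ) (EisensteinSeries.G2 τ) x y) *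
      kronTail (periods τ) (EisensteinSeries.G2 τ) (x - y) := by
  rw [kroneckerSeries, linS, kronTail, expS, expS]
  congr 3
  · funext m
    rcases m with _ | m
    · simp
    · rw [if_neg (by omega : m + 1 ≠ 0)]; rfl
  · funext m
    rcases m with _ | m
    · simp
    · rw [if_neg (by omega : m + 1 ≠ 0)]; rfl

theorem coeff_kroneckerSeries (τ : ℍ) (x y : ℂ) (m : ℕ) :
    PowerSeries.coeff m (kroneckerSeries τ x y) =
      ∑ p ∈ Finset.HasAntidiagonal.antidiagonal m,
        slopeFn (periods τ) (EisensteinSeries.G2 τ) x y ^ p.1 / p.1 ! *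
          PowerSeries.coeff p.2 (kronTail (periods τ) (EisensteinSeries.G2 τ) (x - y)) := by
  rw [kroneckerSeries_eq, PowerSeries.coeff_mul]
  exact Finset.sum_congr rfl fun p _ => by rw [linS, coeff_expS_linear]

/-- Exchanging x and y multiplies the exponent of index k by (-1)ᵏ: 𝓔_k has parity (-1)ᵏ and the
coboundary term, of index 1, changes sign. -/
theorem coeff_kroneckerSeries_swap (τ : ℍ) (x y : ℂ) (m : ℕ) :
    PowerSeries.coeff m (kroneckerSeries τ y x) =
      (-1) ^ m * PowerSeries.coeff m (kroneckerSeries τ x y) := by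
  rw [kroneckerSeries_eq, kroneckerSeries_eq, linS_mul_kronTail, linS_mul_kronTail, linS, linS,
    kronS, kronS, ← expS_add, ← expS_add]
  refine coeff_expS_parity (fun k _ => ?_) m
  simp only [Pi.add_apply]
  rw [← neg_sub x y, eisFn_neg]
  split_ifs with h
  · subst h; ring
  · ring

theorem exists_coeff_kronTail_eq (τ : ℍ) (m : ℕ) : ∃ q : MvPolynomial (Fin 2) ℂ,
    ∀ x ∈ {x : ℂ | x ∉ (periods τ).lattice},
      PowerSeries.coeff m (kronTail (periods τ) (EisensteinSeries.G2 τ) x) =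
        MvPolynomial.eval ![(periods τ).weierstrassP x, (periods τ).derivWeierstrassP x] q := by
  refine exists_coeff_expS_eq (fun m _ => ?_) m
  by_cases hm : 2 ≤ m
  · obtain ⟨q, hq⟩ := exists_eisFn_eq (periods τ) (EisensteinSeries.G2 τ) hm
    refine ⟨MvPolynomial.C (-((-1) ^ m / (m : ℂ))) * q, fun x hx => ?_⟩
    rw [if_pos hm, hq x hx, map_mul, MvPolynomial.eval_C]
    ring
  · exact ⟨0, fun x _ => by rw [if_neg hm, map_zero]⟩

/-- The derivative of a coefficient of `exp (s t) * ∑ a m t^m`. -/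
theorem _root_.Derivation.map_exp_mul {R M : Type*} [CommRing R] [Algebra ℂ R] [AddCommGroup M]
    [Module R M] [Module ℂ M] [IsScalarTower ℂ R M] (d : Derivation ℂ R M) (s : R) {a b : ℕ → R}
    {θ : M} (h : ∀ m, d (a m) = b m • θ) (m : ℕ) :
    d (∑ p ∈ Finset.HasAntidiagonal.antidiagonal (m + 1), ((p.1 ! : ℂ)⁻¹ • s ^ p.1) * a p.2) =
      (∑ p ∈ Finset.HasAntidiagonal.antidiagonal m, ((p.1 ! : ℂ)⁻¹ • s ^ p.1) * a p.2) • d s +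
        (∑ p ∈ Finset.HasAntidiagonal.antidiagonal (m + 1),
          ((p.1 ! : ℂ)⁻¹ • s ^ p.1) * b p.2) • θ := by
  have hs : ∀ k : ℕ, d (((k + 1) ! : ℂ)⁻¹ • s ^ (k + 1)) = ((k ! : ℂ)⁻¹ • s ^ k) • d s := by
    intro k
    rw [Derivation.map_smul, Derivation.leibniz_pow, Nat.add_sub_cancel, Nat.factorial_succ,
      ← Nat.cast_smul_eq_nsmul ℂ, smul_smul, smul_assoc]
    congr 1
    have : ((k + 1 : ℕ) : ℂ) ≠ 0 := Nat.cast_ne_zero.mpr k.succ_ne_zero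
    have : (k ! : ℂ) ≠ 0 := Nat.cast_ne_zero.mpr k.factorial_ne_zero
    push_cast at *
    field_simp
  rw [map_sum]
  simp only [Derivation.leibniz, Finset.sum_add_distrib, h]
  rw [add_comm, Finset.sum_smul, Finset.sum_smul]
  congr 1
  -- The term with exponent 0 of `s` has derivative zero; the others shift down by one, which lowers
  -- the index from m + 1 to m.
  · rw [Finset.Nat.sum_antidiagonal_succ]
    simp only [hs, pow_zero, Derivation.map_smul, Derivation.map_one_eq_zero, smul_zero, zero_add]
    exact Finset.sum_congr rfl fun p _ => by rw [smul_smul, mul_comm]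
  · exact Finset.sum_congr rfl fun p _ => by rw [mul_smul]

namespace CoordRing

variable {τ : ℍ} {n : ℕ} {i j : Fin n}

/-- The coefficient of `t^m` in `exp (-∑_{m ≥ 2} (-t)^m / m * 𝓔_m(x_i - x_j))`. -/
noncomputable def tail (hij : i ≠ j) (m : ℕ) : CoordRing τ n :=
  MvPolynomial.aeval ![diffU hij, diffV hij] (exists_coeff_kronTail_eq τ m).choose

theorem evalAt_tail {Q : Conf τ n} {z : Fin n → ℂ} (hz : IsLift Q z) (hij : i ≠ j) (m : ℕ) :
    evalAt Q (tail hij m) = PowerSeries.coeff m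
      (kronTail (periods τ) (EisensteinSeries.G2 τ) (z i - z j)) := by
  rw [(exists_coeff_kronTail_eq τ m).choose_spec _ (hz.sub_notMem hij), tail,
    MvPolynomial.comp_aeval_apply, ← MvPolynomial.aeval_eq_eval]
  congr 2
  funext k
  fin_cases k
  exacts [evalAt_diffU hz hij, evalAt_diffV hz hij]

/-- The coefficients of the Kronecker series. -/
noncomputable def kron (τ : ℍ) {n : ℕ} (i j : Fin n) (m : ℕ) : CoordRing τ n :=
  if hij : i ≠ j then ∑ p ∈ Finset.HasAntidiagonal.antidiagonal m,
    ((p.1 ! : ℂ)⁻¹ • slope hij ^ p.1) * tail hij p.2 else 0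

theorem kron_of_ne (hij : i ≠ j) (m : ℕ) : kron τ i j m =
    ∑ p ∈ Finset.HasAntidiagonal.antidiagonal m,
      ((p.1 ! : ℂ)⁻¹ • slope hij ^ p.1) * tail hij p.2 := dif_pos hij

theorem evalAt_kron {Q : Conf τ n} {z : Fin n → ℂ} (hz : IsLift Q z) (hij : i ≠ j) (m : ℕ) :
    evalAt Q (kron τ i j m) = PowerSeries.coeff m (kroneckerSeries τ (z i) (z j)) := by
  rw [kron_of_ne hij, coeff_kroneckerSeries, map_sum]
  refine Finset.sum_congr rfl fun p _ => ?_
  rw [map_mul, map_smul, map_pow, evalAt_slope hz, evalAt_tail hz, smul_eq_mul, div_eq_inv_mul]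

theorem kron_zero (hij : i ≠ j) : kron τ i j 0 = 1 := by
  refine ext_evalAt fun Q z hz => ?_
  rw [evalAt_kron hz hij, coeff_kroneckerSeries, map_one]
  simp [kronTail, coeff_zero_expS, -PowerSeries.coeff_zero_eq_constantCoeff]

theorem kron_swap (i j : Fin n) (m : ℕ) : kron τ j i m = (-1) ^ m * kron τ i j m := by
  by_cases hij : i = j
  · subst hij; simp [kron]
  refine ext_evalAt fun Q z hz => ?_
  rw [map_mul, map_pow, map_neg, map_one, evalAt_kron hz hij, evalAt_kron hz (Ne.symm hij),
    coeff_kroneckerSeries_swap]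

/-- The tail is a polynomial in ℘(x_i - x_j) and ℘'(x_i - x_j), whose differentials are multiples of
dx_i - dx_j. -/
theorem D_tail (hij : i ≠ j) (m : ℕ) : ∃ f : CoordRing τ n,
    D ℂ (CoordRing τ n) (tail hij m) = f • (dx τ i - dx τ j) := by
  rw [tail]
  induction (exists_coeff_kronTail_eq τ m).choose using MvPolynomial.induction_on with
  | C a =>
    refine ⟨0, ?_⟩
    rw [MvPolynomial.aeval_C, Derivation.map_algebraMap]; module
  | add p q hp hq =>
    obtain ⟨f, hf⟩ := hp
    obtain ⟨g, hg⟩ := hq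
    exact ⟨f + g, by rw [map_add, map_add, hf, hg]; module⟩
  | mul_X p k hp =>
    obtain ⟨f, hf⟩ := hp
    obtain ⟨g, hg⟩ : ∃ g : CoordRing τ n, D ℂ (CoordRing τ n)
        ((![diffU hij, diffV hij] : Fin 2 → CoordRing τ n) k) = g • (dx τ i - dx τ j) := by
      fin_cases k
      exacts [⟨_, D_diffU hij⟩, D_diffV hij]
    refine ⟨MvPolynomial.aeval (![diffU hij, diffV hij] : Fin 2 → CoordRing τ n) p * g +
      (![diffU hij, diffV hij] : Fin 2 → CoordRing τ n) k * f, ?_⟩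
    rw [map_mul, MvPolynomial.aeval_X, Derivation.leibniz, hf, hg]; module

/-- Differentiating exp(α s) produces the coefficient of index m times ds. The part of ds containing
℘(x_i - x_j) and the differential of the tail are absorbed into the last term, which disappears
after multiplication by dx_i - dx_j. -/
theorem D_kron_succ (hij : i ≠ j) (m : ℕ) : ∃ f : CoordRing τ n,
    D ℂ (CoordRing τ n) (kron τ i j (m + 1)) =
      kron τ i j m • (u τ i • dx τ i - u τ j • dx τ j) + f • (dx τ i - dx τ j) := by
  choose t ht using D_tail (τ := τ) hij
  have key := (D ℂ (CoordRing τ n)).map_exp_mul (slope hij) ht m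
  rw [← kron_of_ne, ← kron_of_ne, D_slope] at key
  refine ⟨(∑ p ∈ Finset.HasAntidiagonal.antidiagonal (m + 1),
    ((p.1 ! : ℂ)⁻¹ • slope hij ^ p.1) * t p.2) - kron τ i j m * diffU hij, ?_⟩
  rw [key]
  module

end CoordRing

end KroneckerSeries

end EllConf

/-! ### From the scalar Fay identity to the quadratic relations between forms. -/

namespace EllConf

section Fay

open UpperHalfPlane KaehlerDifferential

namespace XiFree

variable {A B : Type*} [Ring A] [Ring B] (f : A →+* B) (a : ℕ → A)

theorem map_inAlpha : MvPowerSeries.map f (inAlpha a) = inAlpha fun m => f (a m) := by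
  funext e
  change f (ite _ _ _) = ite _ _ _
  split_ifs <;> simp

theorem map_inBeta : MvPowerSeries.map f (inBeta a) = inBeta fun m => f (a m) := by
  funext e
  change f (ite _ _ _) = ite _ _ _
  split_ifs <;> simp

theorem map_inSum : MvPowerSeries.map f (inSum a) = inSum fun m => f (a m) := by
  funext e
  exact map_nsmul f _ _

theorem inAlpha_mul (t : A) : inAlpha (fun m => a m * t) = inAlpha a * MvPowerSeries.C t := by
  ext e
  rw [MvPowerSeries.coeff_mul_C]
  change ite _ _ _ = ite _ _ _ * t
  split_ifs <;> simp

theorem inBeta_mul (t : A) : inBeta (fun m => a m * t) = inBeta a * MvPowerSeries.C t := by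
  ext e
  rw [MvPowerSeries.coeff_mul_C]
  change ite _ _ _ = ite _ _ _ * t
  split_ifs <;> simp

theorem inSum_mul (t : A) : inSum (fun m => a m * t) = inSum a * MvPowerSeries.C t := by
  ext e
  rw [MvPowerSeries.coeff_mul_C]
  exact (smul_mul_assoc ..).symm

theorem map_algebraMap_mul_C_mul {R : Type*} [CommRing R] [Algebra R A]
    (F G : MvPowerSeries (Fin 2) R) (s t : A) :
    MvPowerSeries.map (algebraMap R A) F * MvPowerSeries.C s *
      (MvPowerSeries.map (algebraMap R A) G * MvPowerSeries.C t) =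
        MvPowerSeries.map (algebraMap R A) (F * G) * MvPowerSeries.C (s * t) := by
  have h : MvPowerSeries.C s * MvPowerSeries.map (algebraMap R A) G =
      MvPowerSeries.map (algebraMap R A) G * MvPowerSeries.C s := by
    ext e
    rw [MvPowerSeries.coeff_C_mul, MvPowerSeries.coeff_mul_C, MvPowerSeries.coeff_map]
    exact (Algebra.commutes _ s).symm
  rw [mul_assoc, ← mul_assoc (MvPowerSeries.C s), h, map_mul, map_mul]
  simp only [mul_assoc]

/-- In the exterior algebra (x_j - x_i)(x_i - x_l) and (x_j - x_l)(x_i - x_j) both equal -(x_i -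
x_l)(x_j - x_l), so the relation is one scalar series times one product. -/
theorem fay_ι_smul {R M : Type*} [CommRing R] [AddCommGroup M] [Module R M] {n : ℕ}
    (K : Fin n → Fin n → ℕ → R) (x : Fin n → M) (i j l : Fin n)
    (hK : i ≠ j → i ≠ l → j ≠ l →
      (MvPowerSeries.X 0 + MvPowerSeries.X 1) * (inAlpha (K i l) * inBeta (K j l)) -
        MvPowerSeries.X 0 * (inBeta (K j i) * inSum (K i l)) -
        MvPowerSeries.X 1 * (inSum (K j l) * inAlpha (K i j)) = 0) :
    fay (fun i j m => ExteriorAlgebra.ι R (K i j m • (x i - x j))) i j l = 0 := by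
  have hι : ∀ (i j : Fin n) (m : ℕ), ExteriorAlgebra.ι R (K i j m • (x i - x j)) =
      algebraMap R (ExteriorAlgebra R M) (K i j m) * ExteriorAlgebra.ι R (x i - x j) := by
    intro i j m
    rw [map_smul, Algebra.smul_def]
  have hsq : ∀ i : Fin n, ExteriorAlgebra.ι R (x i) * ExteriorAlgebra.ι R (x i) = 0 := fun i =>
    ExteriorAlgebra.ι_sq_zero _
  have hac : ∀ i j : Fin n, ExteriorAlgebra.ι R (x i) * ExteriorAlgebra.ι R (x j) =
      -(ExteriorAlgebra.ι R (x j) * ExteriorAlgebra.ι R (x i)) := fun i j =>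
    eq_neg_of_add_eq_zero_left (ExteriorAlgebra.ι_add_mul_swap _ _)
  simp only [fay, hι, inAlpha_mul, inBeta_mul, inSum_mul, ← map_inAlpha, ← map_inBeta,
    ← map_inSum, map_algebraMap_mul_C_mul]
  have e2 : ExteriorAlgebra.ι R (x j - x i) * ExteriorAlgebra.ι R (x i - x l) =
      -(ExteriorAlgebra.ι R (x i - x l) * ExteriorAlgebra.ι R (x j - x l)) := by
    simp only [map_sub, sub_mul, mul_sub]
    rw [hsq, hsq, hac j i, hac j l]
    abel
  have e3 : ExteriorAlgebra.ι R (x j - x l) * ExteriorAlgebra.ι R (x i - x j) =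
      -(ExteriorAlgebra.ι R (x i - x l) * ExteriorAlgebra.ι R (x j - x l)) := by
    simp only [map_sub, sub_mul, mul_sub]
    rw [hsq, hsq, hac j i, hac l i]
    abel
  rw [e2, e3]
  by_cases h : i ≠ j ∧ i ≠ l ∧ j ≠ l
  · have key := congrArg (MvPowerSeries.map (algebraMap R (ExteriorAlgebra R M)))
      (hK h.1 h.2.1 h.2.2)
    rw [map_sub, map_sub, map_mul, map_mul _ (MvPowerSeries.X 0),
      map_mul _ (MvPowerSeries.X 1), map_add, MvPowerSeries.map_X, MvPowerSeries.map_X,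
      map_zero] at key
    rw [map_neg, mul_neg, mul_neg, mul_neg, mul_neg, ← mul_assoc, ← mul_assoc, ← mul_assoc,
      ← sub_eq_add_neg, ← sub_eq_add_neg, ← sub_mul, ← sub_mul, key, zero_mul]
  -- When two of the indices coincide, the common product itself vanishes and no scalar identity is
  -- needed.
  · have h0 : ExteriorAlgebra.ι R (x i - x l) * ExteriorAlgebra.ι R (x j - x l) = 0 := by
      by_cases h1 : i = l
      · rw [h1, sub_self, map_zero, zero_mul]
      by_cases h2 : j = l
      · rw [h2, sub_self, map_zero, mul_zero]
      · have h3 : i = j := by tauto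
        rw [h3]
        exact ExteriorAlgebra.ι_sq_zero _
    rw [h0]
    simp

theorem ι_smul_sub_add_smul_mul_ι {R M : Type*} [CommRing R] [AddCommGroup M] [Module R M]
    (f g : R) (x y z : M) :
    ExteriorAlgebra.ι R (f • (x - y) + g • z) * ExteriorAlgebra.ι R z =
      (ExteriorAlgebra.ι R x - ExteriorAlgebra.ι R y) * ExteriorAlgebra.ι R (f • z) := by
  rw [map_add, map_smul, map_smul, map_smul, add_mul, smul_mul_assoc, smul_mul_assoc,
    ExteriorAlgebra.ι_sq_zero, smul_zero, add_zero, map_sub, mul_smul_comm]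

theorem ι_smul_sub_add_neg_one_pow {R M : Type*} [CommRing R] [AddCommGroup M] [Module R M]
    (f : R) (m : ℕ) (x y : M) : ExteriorAlgebra.ι R (f • (x - y)) +
      (-1) ^ m * ExteriorAlgebra.ι R (((-1) ^ m * f) • (y - x)) = 0 := by
  rcases Nat.even_or_odd m with h | h
  · rw [h.neg_one_pow, h.neg_one_pow, one_mul, one_mul, ← map_add, ← smul_add,
      sub_add_sub_cancel', sub_self, smul_zero, map_zero]
  · rw [h.neg_one_pow, h.neg_one_pow, neg_mul, neg_mul, one_mul, one_mul, ← map_neg, ← map_add,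
      show f • (x - y) + -(-f • (y - x)) = 0 by module, map_zero]

end XiFree

namespace CoordRing

open XiFree

variable {τ : ℍ} {n : ℕ} {i j l : Fin n}

/-- Regular functions are determined by their values, so it suffices to evaluate each coefficient at
a lifted configuration, where the analytic identity applies with ρ = -ζ. -/
theorem fay_kron (hij : i ≠ j) (hil : i ≠ l) (hjl : j ≠ l) :
    (MvPowerSeries.X 0 + MvPowerSeries.X 1) * (inAlpha (kron τ i l) * inBeta (kron τ j l)) -
      MvPowerSeries.X 0 * (inBeta (kron τ j i) * inSum (kron τ i l)) -
      MvPowerSeries.X 1 * (inSum (kron τ j l) * inAlpha (kron τ i j)) = 0 := by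
  ext1 e
  refine ext_evalAt fun Q z hz => ?_
  have h := fay_linS_mul_kronS (L := periods τ) (EisensteinSeries.G2 τ)
    (fun x => -zetaFn (periods τ) (EisensteinSeries.G2 τ) x) (hz.sub_notMem hil)
    (hz.sub_notMem hjl) (hz.sub_notMem hij) (kroneckerSeries τ)
    (fun x y => by rw [kroneckerSeries_eq, linS_mul_kronTail])
  simp only [serAlpha_eq, serBeta_eq, serSum_eq, ← evalAt_kron hz hij, ← evalAt_kron hz hil,
    ← evalAt_kron hz hjl, ← evalAt_kron hz hij.symm] at h
  have key : MvPowerSeries.map (evalAt Q : CoordRing τ n →+* ℂ)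
      ((MvPowerSeries.X 0 + MvPowerSeries.X 1) * (inAlpha (kron τ i l) * inBeta (kron τ j l)) -
        MvPowerSeries.X 0 * (inBeta (kron τ j i) * inSum (kron τ i l)) -
        MvPowerSeries.X 1 * (inSum (kron τ j l) * inAlpha (kron τ i j))) = 0 := by
    rw [← h]
    simp only [map_sub, map_mul, map_add, map_inAlpha, map_inBeta, map_inSum, MvPowerSeries.map_X]
    rfl
  have hm := congrArg (MvPowerSeries.coeff e) key
  rw [MvPowerSeries.coeff_map] at hm
  exact hm.trans ((map_zero _).trans (map_zero (evalAt Q)).symm)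

variable (τ) in
theorem fay_form (i j l : Fin n) :
    fay (fun (i j : Fin n) m =>
      DeRham.form ((kron τ i j m : CoordRing τ n) • (dx τ i - dx τ j))) i j l = 0 :=
  fay_ι_smul _ _ _ _ _ fay_kron

end CoordRing

end Fay

/-! ### The morphism and its compatibility with the differentials. -/

section Hom

open UpperHalfPlane KaehlerDifferential

theorem DeRham.d_form_smul {k R : Type*} [CommRing k] [CommRing R] [Algebra k R] (f : R)
    (η : Ω[R⁄k]) : d k R (form (f • η)) = form (D k R f) * form η + f • d k R (form η) := by
  rw [form, map_smul, Algebra.smul_def, d_mul, d_algebraMap, AlgHom.commutes, Algebra.smul_def]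

namespace CoordRing

variable {τ : ℍ} {n : ℕ}

/-- Apply d to du = v dx and dv = (P'(u)/2) dx. As the differentials of both multipliers are
multiples of dx, their products with dx vanish, so v and P'(u)/2 both annihilate d(dx). -/
theorem d_form_dx (i : Fin n) : DeRham.d ℂ (CoordRing τ n) (DeRham.form (dx τ i)) = 0 := by
  have h : ∀ f g : CoordRing τ n, D ℂ (CoordRing τ n) g = f • dx τ i →
      D ℂ (CoordRing τ n) f ∈ Submodule.span (CoordRing τ n) {dx τ i} →
      f • DeRham.d ℂ (CoordRing τ n) (DeRham.form (dx τ i)) = 0 := by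
    intro f g hg hf
    obtain ⟨a, ha⟩ := Submodule.mem_span_singleton.mp hf
    have := DeRham.d_form_D (k := ℂ) g
    rwa [hg, DeRham.d_form_smul, ← ha, DeRham.form, map_smul, smul_mul_assoc,
      ExteriorAlgebra.ι_sq_zero, smul_zero, zero_add] at this
  refine eq_zero_of_smul (τ := τ) (n := n) (i := i) (h _ _ (D_u τ i) ?_) (h _ _ (D_v τ i) ?_)
  · rw [D_v]
    exact Submodule.smul_mem _ _ (Submodule.mem_span_singleton_self _)
  · rw [map_sub, D_halfG₂, sub_zero, Derivation.leibniz, Derivation.leibniz_pow, D_u]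
    have : D ℂ (CoordRing τ n) 6 = 0 := (D ℂ (CoordRing τ n)).map_natCast 6
    rw [this, smul_zero, add_zero]
    exact Submodule.smul_mem _ _ (nsmul_mem (Submodule.smul_mem _ _
      (Submodule.smul_mem _ _ (Submodule.mem_span_singleton_self _))) _)

theorem d_form_u_smul_dx (i : Fin n) :
    DeRham.d ℂ (CoordRing τ n) (DeRham.form (u τ i • dx τ i)) = 0 := by
  rw [DeRham.d_form_smul, d_form_dx, D_u, DeRham.form, map_smul, smul_mul_assoc,
    ExteriorAlgebra.ι_sq_zero, smul_zero, smul_zero, zero_add]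

theorem d_form_smul_sub (i j : Fin n) (f : CoordRing τ n) :
    DeRham.d ℂ (CoordRing τ n) (DeRham.form (f • (dx τ i - dx τ j))) =
      DeRham.form (D ℂ (CoordRing τ n) f) * DeRham.form (dx τ i - dx τ j) := by
  have h : DeRham.d ℂ (CoordRing τ n) (DeRham.form (dx τ i - dx τ j)) = 0 := by
    rw [DeRham.form, map_sub, map_sub]
    exact (congrArg₂ (· - ·) (d_form_dx i) (d_form_dx j)).trans (sub_zero 0)
  rw [DeRham.d_form_smul, h, smul_zero, add_zero]

theorem d_form_kron_zero (i j : Fin n) :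
    DeRham.d ℂ (CoordRing τ n) (DeRham.form (kron τ i j 0 • (dx τ i - dx τ j))) = 0 := by
  rw [d_form_smul_sub]
  by_cases hij : i = j
  · rw [hij, sub_self, DeRham.form, DeRham.form, map_zero, mul_zero]
  · rw [kron_zero hij, Derivation.map_one_eq_zero, DeRham.form, map_zero, zero_mul]

theorem d_form_kron_succ (i j : Fin n) (m : ℕ) :
    DeRham.d ℂ (CoordRing τ n) (DeRham.form (kron τ i j (m + 1) • (dx τ i - dx τ j))) =
      (DeRham.form (u τ i • dx τ i) - DeRham.form (u τ j • dx τ j)) *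
        DeRham.form (kron τ i j m • (dx τ i - dx τ j)) := by
  rw [d_form_smul_sub]
  by_cases hij : i = j
  · rw [hij, sub_self, sub_self, DeRham.form, DeRham.form, map_zero, mul_zero, zero_mul]
  · obtain ⟨f, hf⟩ := D_kron_succ (τ := τ) hij m
    rw [hf]
    exact XiFree.ι_smul_sub_add_smul_mul_ι _ _ _ _ _

/-- The images of the generators. -/
noncomputable def genForm (τ : ℍ) {n : ℕ} : XiGen n → Ω[CoordRing τ n⁄ℂ]
  | .nu i => u τ i • dx τ i
  | .om i => dx τ i
  | .kr i j m => kron τ i j m • (dx τ i - dx τ j)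

/-- The morphism on the free algebra. -/
noncomputable def freeHom (τ : ℍ) (n : ℕ) : XiFree n →ₐ[ℂ] DeRham ℂ (CoordRing τ n) :=
  FreeAlgebra.lift ℂ fun x => DeRham.form (genForm τ x)

theorem freeHom_gen (x : XiGen n) : freeHom τ n (XiFree.gen x) = DeRham.form (genForm τ x) :=
  FreeAlgebra.lift_ι_apply _ _

theorem freeHom_rel {a b : XiFree n} (h : XiRel n a b) : freeHom τ n a = freeHom τ n b := by
  induction h with
  | anticomm x y =>
    rw [map_mul, map_neg, map_mul, freeHom_gen, freeHom_gen, DeRham.form_mul_form]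
  | antisymm i j m =>
    rw [map_add, map_mul, map_pow, map_neg, map_one, map_zero, freeHom_gen, freeHom_gen]
    change DeRham.form (kron τ i j m • (dx τ i - dx τ j)) +
      (-1) ^ m * DeRham.form (kron τ j i m • (dx τ j - dx τ i)) = 0
    rw [kron_swap i j]
    exact XiFree.ι_smul_sub_add_neg_one_pow _ _ _ _
  | zero i j =>
    rw [map_sub, freeHom_gen, freeHom_gen, freeHom_gen, DeRham.form, ← map_sub]
    -- On the diagonal `kron` has the default value 0 instead of 1, which is harmless because dx_i -
    -- dx_i = 0.
    by_cases hij : i = j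
    · subst hij; simp [genForm]
    · simp only [genForm]
      rw [kron_zero hij]
      congr 1
      module
  | fay i j l e =>
    have h := Xi.map_fay (freeHom τ n : XiFree n →+* DeRham ℂ (CoordRing τ n))
      (fun i j m => XiFree.gen (.kr i j m)) i j l
    have h' := congrArg (MvPowerSeries.coeff e) h
    rw [MvPowerSeries.coeff_map] at h'
    rw [map_zero]
    refine h'.trans ?_
    have h2 := congrArg (MvPowerSeries.coeff e) (fay_form τ i j l)
    rw [map_zero] at h2
    rw [← h2]
    congr 2
    funext i j m
    exact freeHom_gen _

/-- The morphism `Ξ_n → Ω_dR(Γ_n)`. -/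
noncomputable def hom (τ : ℍ) (n : ℕ) : Xi n →ₐ[ℂ] DeRham ℂ (CoordRing τ n) :=
  Xi.lift (freeHom τ n) fun _ _ => freeHom_rel

theorem hom_gen (x : XiGen n) : hom τ n (Xi.gen x) = DeRham.form (genForm τ x) :=
  (Xi.lift_mk ..).trans (freeHom_gen x)

theorem hom_mem (p : ℕ) (a : Xi n) (ha : a ∈ Xi.deg n p) :
    hom τ n a ∈ DeRham.deg ℂ (CoordRing τ n) p := by
  unfold Xi.deg at ha
  change hom τ n a ∈ ⋀[CoordRing τ n]^p (Ω[CoordRing τ n⁄ℂ])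
  induction ha using Submodule.pow_induction_on_left' with
  | algebraMap r =>
    rw [AlgHom.commutes, IsScalarTower.algebraMap_apply ℂ (CoordRing τ n),
      ExteriorAlgebra.exteriorPower, pow_zero]
    exact Submodule.algebraMap_mem _
  | add x y i hx hy ihx ihy => rw [map_add]; exact add_mem ihx ihy
  | mem_mul m hm i x hx ih =>
    have h : hom τ n m ∈ LinearMap.range (ExteriorAlgebra.ι (CoordRing τ n)
        (M := Ω[CoordRing τ n⁄ℂ])) := by
      unfold Xi.degOne at hm
      induction hm using Submodule.span_induction with
      | mem y hy => obtain ⟨y, rfl⟩ := hy; rw [hom_gen]; exact ⟨_, rfl⟩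
      | zero => rw [map_zero]; exact zero_mem _
      | add u v _ _ hu hv => rw [map_add]; exact add_mem hu hv
      | smul c u _ hu =>
        rw [map_smul, ← algebraMap_smul (CoordRing τ n) c]
        exact Submodule.smul_mem _ _ hu
    rw [map_mul, ExteriorAlgebra.exteriorPower, pow_succ']
    exact Submodule.mul_mem_mul h ih

theorem hom_dGen (x : XiGen n) :
    hom τ n (Xi.dGen x) = DeRham.d ℂ (CoordRing τ n) (DeRham.form (genForm τ x)) := by
  rcases x with i | i | ⟨i, j, _ | m⟩
  · exact (map_zero _).trans (d_form_u_smul_dx i).symm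
  · exact (map_zero _).trans (d_form_dx i).symm
  · exact (map_zero _).trans (d_form_kron_zero i j).symm
  · refine Eq.trans ?_ (d_form_kron_succ i j m).symm
    change hom τ n ((Xi.nu i - Xi.nu j) * Xi.kr i j m) = _
    rw [map_mul, map_sub, hom_gen, hom_gen, hom_gen]
    rfl

/-- Compatibility with the sign automorphisms is proved along with it, because the graded Leibniz
rule of a product involves them. -/
theorem hom_d (a : Xi n) : hom τ n (Xi.d n a) = DeRham.d ℂ (CoordRing τ n) (hom τ n a) ∧
    hom τ n (Xi.inv a) = DeRham.inv (hom τ n a) := by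
  induction a using Xi.induction with
  | h0 c =>
    rw [Xi.d_algebraMap, AlgHom.commutes, AlgHom.commutes, map_zero, AlgHom.commutes,
      IsScalarTower.algebraMap_apply ℂ (CoordRing τ n), DeRham.d_algebraMap,
      Derivation.map_algebraMap, AlgHom.commutes, DeRham.form, map_zero]
    exact ⟨rfl, rfl⟩
  | h1 x => rw [Xi.d_gen, hom_dGen, Xi.inv_gen, map_neg, hom_gen, DeRham.inv_form]; exact ⟨rfl, rfl⟩
  | hm a b ha hb =>
    constructor
    · rw [Xi.d_mul, map_add, map_mul, map_mul, map_mul, ha.1, ha.2, hb.1, DeRham.d_mul]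
    · rw [map_mul, map_mul, map_mul, map_mul, ha.2, hb.2]
  | ha a b ha hb =>
    rw [map_add, map_add, map_add, map_add, map_add, map_add, map_add, ha.1, hb.1, ha.2, hb.2]
    exact ⟨rfl, rfl⟩

end CoordRing

end Hom

end EllConf

theorem mainTheorem5 (τ : UpperHalfPlane) (n : ℕ) :
    ∃ (dx : Fin n → KaehlerDifferential ℂ (EllConf.CoordRing τ n))
      (K : Fin n → Fin n → ℕ → EllConf.CoordRing τ n),
      (∀ (i : Fin n) (η : KaehlerDifferential ℂ (EllConf.CoordRing τ n)),
        EllConf.CoordRing.IsDx i η ↔ η = dx i) ∧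
      (∀ i j : Fin n, i ≠ j → ∀ (m : ℕ) (x : EllConf.Conf τ n) (z : Fin n → ℂ),
        (∀ l, EllConf.EllCurve.mk τ (z l) = x.1 l) →
          (K i j m).1 x = PowerSeries.coeff m (EllConf.kroneckerSeries τ (z i) (z j))) ∧
      ∃! φ : EllConf.Xi n →ₐ[ℂ] EllConf.DeRham ℂ (EllConf.CoordRing τ n),
        EllConf.IsDGAlgebraHom (EllConf.Xi.deg n) (EllConf.Xi.d n)
          (EllConf.DeRham.deg ℂ (EllConf.CoordRing τ n))
          (EllConf.DeRham.d ℂ (EllConf.CoordRing τ n)) φ ∧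
        (∀ i : Fin n,
          φ (EllConf.Xi.nu i) = EllConf.DeRham.form (EllConf.CoordRing.u τ i • dx i)) ∧
        (∀ i : Fin n, φ (EllConf.Xi.om i) = EllConf.DeRham.form (dx i)) ∧
        (∀ (i j : Fin n) (m : ℕ),
          φ (EllConf.Xi.kr i j m) = EllConf.DeRham.form (K i j m • (dx i - dx j))) := by
  refine ⟨EllConf.CoordRing.dx τ, EllConf.CoordRing.kron τ,
    fun _ η => EllConf.CoordRing.isDx_iff η,
    fun i j hij m x z hz => EllConf.CoordRing.evalAt_kron hz hij m,
    EllConf.CoordRing.hom τ n,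
    ⟨⟨EllConf.CoordRing.hom_mem, fun a => (EllConf.CoordRing.hom_d a).1⟩,
      fun i => EllConf.CoordRing.hom_gen _, fun i => EllConf.CoordRing.hom_gen _,
      fun i j m => EllConf.CoordRing.hom_gen _⟩, ?_⟩
  -- Uniqueness: the prescribed values on all generators determine an algebra homomorphism.
  rintro ψ ⟨-, h1, h2, h3⟩
  refine EllConf.Xi.hom_ext fun x => Eq.trans ?_ (EllConf.CoordRing.hom_gen x).symm
  rcases x with i | i | ⟨i, j, m⟩
  exacts [h1 i, h2 i, h3 i j m]
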